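/- Let $k$ be a field of characteristic different from $2$, and let $r : S \to \mathbb{P}^2_k$ be a finite flat morphism of degree $2$, with $S$ an integral scheme, whose branch divisor is a smooth sextic curve $D \subset \mathbb{P}^2_k$. Assume that $r^* : \mathrm{Pic}(\mathbb{P}^2_k) \to \mathrm{Pic}(S)$ is an isomorphism. Let $L \subset \mathbb{P}^2_k$ be a line, and let $d \in k(\mathbb{P}^2)^\times$ be a rational function with divisor $D - 6L$ such that $k(S) = k(\mathbb{P}^2)(\sqrt{d})$. Let $C \subset \mathbb{P}^2_k$ be an integral curve with generic point $\gamma$, different from $D$ and $L$, such that the restriction of $d$ to $\gamma$ is a square in the residue field $k(\gamma)$ (that is, its class in $H^1(k(\gamma), \mu_2) = k(\gamma)^\times / k(\gamma)^{\times 2}$ is trivial). Then there exist a positive integer $n$ and a rational function $f_\gamma \in k(\mathbb{P}^2)^\times$ such that $\operatorname{div}(f_\gamma) = C - 2nL$ and $f_\gamma$ is a norm from the quadratic extension $k(S)/k(\mathbb{P}^2)$. -/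

import Mathlib

open AlgebraicGeometry CategoryTheory TopologicalSpace

universe u

attribute [local instance] MvPolynomial.gradedAlgebra

/-! ### The projective plane -/

/-- The projective plane `ℙ²` over a field `k`, as `Proj k[x₀, x₁, x₂]`. -/
noncomputable abbrev ProjectivePlane (k : Type u) [Field k] : Scheme.{u} :=
  Proj (MvPolynomial.homogeneousSubmodule (Fin 3) k)

namespace ProjectivePlane

/-- The structure morphism `ℙ² ⟶ Spec k`. -/
noncomputable def toSpec (k : Type u) [Field k] : ProjectivePlane k ⟶ Spec (CommRingCat.of k) :=
  Proj.toSpecZero (MvPolynomial.homogeneousSubmodule (Fin 3) k) ≫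
    Spec.map (CommRingCat.ofHom
      (algebraMap k (MvPolynomial.homogeneousSubmodule (Fin 3) k 0)))

variable (k : Type u) [Field k]

instance : IrreducibleSpace (ProjectivePlane k) := by
  let 𝒜 := MvPolynomial.homogeneousSubmodule (Fin 3) k
  let η : ProjectiveSpectrum 𝒜 :=
    { asHomogeneousIdeal := ⊥
      isPrime := by
        rw [HomogeneousIdeal.toIdeal_bot]
        exact Ideal.isPrime_bot
      not_irrelevant_le := by
        intro h
        have hx : (MvPolynomial.X 0 : MvPolynomial (Fin 3) k) ∈
            HomogeneousIdeal.irrelevant 𝒜 := by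
          rw [HomogeneousIdeal.mem_irrelevant_iff, GradedRing.proj_apply]
          exact DirectSum.decompose_of_mem_ne 𝒜 (i := 1)
            (MvPolynomial.isHomogeneous_X k 0) (by norm_num)
        have := h hx
        exact MvPolynomial.X_ne_zero 0 this }
  have hη : closure ({η} : Set (ProjectiveSpectrum 𝒜)) = Set.univ := by
    rw [← ProjectiveSpectrum.zeroLocus_vanishingIdeal_eq_closure,
      ProjectiveSpectrum.vanishingIdeal_singleton]
    exact ProjectiveSpectrum.zeroLocus_bot 𝒜
  have h : IsIrreducible (Set.univ : Set (ProjectiveSpectrum 𝒜)) := by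
    rw [← hη]
    exact isIrreducible_singleton.closure
  have : PreirreducibleSpace (ProjectiveSpectrum 𝒜) := ⟨h.2⟩
  exact { toPreirreducibleSpace := this, toNonempty := ⟨η⟩ }

instance : IsReduced (ProjectivePlane k) := by
  let 𝒜 := MvPolynomial.homogeneousSubmodule (Fin 3) k
  let 𝒰 : (ProjectivePlane k).AffineOpenCover := Proj.affineOpenCover 𝒜
  have h : ∀ i, IsReduced (𝒰.openCover.X i) := by
    intro i
    let f : MvPolynomial (Fin 3) k := (i : Σ j : PNat, 𝒜 j).2
    have h1 : _root_.IsReduced (HomogeneousLocalization.Away 𝒜 f) := by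
      have h2 : _root_.IsReduced (Localization (Submonoid.powers f)) :=
        isReduced_localizationPreserves (Submonoid.powers f) _ inferInstance
      exact isReduced_of_injective
        (algebraMap (HomogeneousLocalization.Away 𝒜 f) (Localization (Submonoid.powers f)))
        (HomogeneousLocalization.val_injective _)
    change IsReduced (Spec (CommRingCat.of (HomogeneousLocalization.Away 𝒜 f)))
    infer_instance
  exact IsReduced.of_openCover _ 𝒰.openCover

instance : IsIntegral (ProjectivePlane k) := isIntegral_of_irreducibleSpace_of_isReduced _

instance : IsLocallyNoetherian (ProjectivePlane k) := by
  let 𝒜 := MvPolynomial.homogeneousSubmodule (Fin 3) k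
  have h1 : Algebra.FiniteType (𝒜 0) (MvPolynomial (Fin 3) k) :=
    haveI : IsScalarTower k (𝒜 0) (MvPolynomial (Fin 3) k) := 
      ⟨fun a b c => smul_mul_assoc a (b : MvPolynomial (Fin 3) k) c⟩
    Algebra.FiniteType.of_restrictScalars_finiteType k _ _
  have h2 : IsNoetherianRing (𝒜 0) := inferInstance
  have h3 : IsLocallyNoetherian (Spec (CommRingCat.of (𝒜 0))) := inferInstance
  exact LocallyOfFiniteType.isLocallyNoetherian (Proj.toSpecZero 𝒜)

variable {k}

/-- An integral curve in `ℙ²` is given by its generic point, which is a homogeneous prime ideal.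
It has degree `n` if this ideal is generated by a nonzero form of degree `n`. -/
def IsCurveOfDegree (C : ProjectivePlane k) (n : ℕ) : Prop :=
  ∃ F : MvPolynomial (Fin 3) k, F ≠ 0 ∧ F.IsHomogeneous n ∧
    HomogeneousIdeal.toIdeal (ProjectiveSpectrum.asHomogeneousIdeal C) = Ideal.span {F}

end ProjectivePlane

/-! ### Integral closed subschemes and divisors -/

/-- The ideal sheaf of the integral closed subscheme with generic point `x`. -/
noncomputable def idealSheafOfPoint {X : Scheme.{u}} (x : X) : X.IdealSheafData :=
  Scheme.IdealSheafData.vanishingIdeal ⟨closure {x}, isClosed_closure⟩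

/-- The integral curve with generic point `C` is smooth over `k`. -/
def ProjectivePlane.IsSmoothCurve {k : Type u} [Field k] (C : ProjectivePlane k) : Prop :=
  Smooth ((idealSheafOfPoint C).subschemeι ≫ ProjectivePlane.toSpec k)

open Classical in
/-- The prime divisor with generic point `x`, as a function on points. -/
noncomputable def primeDivisor {X : Scheme.{u}} (x : X) : X → ℤ := Pi.single x 1

/-- The rational function `f` is nonzero, and its divisor is `E`: the order of vanishing of `f` at
every point of codimension one is the coefficient of `E` there (and `E` has no other
coefficients). -/
def HasDivisor {X : Scheme.{u}} [IsIntegral X] [IsLocallyNoetherian X] (f : X.functionField)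
    (E : X → ℤ) : Prop :=
  f ≠ 0 ∧ Scheme.ord f = E

/-- The rational function `f` is regular at `x` and its value in the residue field of `x` is a
square. -/
def IsSquareAt {X : Scheme.{u}} [IsIntegral X] (f : X.functionField) (x : X) : Prop :=
  ∃ a : X.presheaf.stalk x, algebraMap (X.presheaf.stalk x) X.functionField a = f ∧
    IsSquare ((X.residue x).hom a)

/-! ### Function fields of flat covers -/

lemma map_genericPoint_of_flat {X Y : Scheme.{u}} [IsIntegral X] [IsIntegral Y] (f : X ⟶ Y)
    [Flat f] : f (genericPoint X) = genericPoint Y := by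
  obtain ⟨x, hx, hfx⟩ := Flat.generalizingMap f
    (genericPoint_specializes (f (genericPoint X)))
  have : x = genericPoint X := (hx.antisymm (genericPoint_specializes x)).eq
  rw [← this, hfx]

/-- The extension of function fields `k(Y) → k(X)` given by a flat morphism `X ⟶ Y` of integral
schemes. -/
noncomputable def functionFieldMap {X Y : Scheme.{u}} [IsIntegral X] [IsIntegral Y] (f : X ⟶ Y)
    [Flat f] : Y.functionField →+* X.functionField :=
  (Y.presheaf.stalkSpecializes (specializes_of_eq (map_genericPoint_of_flat f)) ≫
    f.stalkMap (genericPoint X)).hom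

/-- `k(X) = k(Y)(√d)`. -/
def IsFunctionFieldAdjoinSqrt {X Y : Scheme.{u}} [IsIntegral X] [IsIntegral Y] (f : X ⟶ Y)
    [Flat f] (d : Y.functionField) : Prop :=
  letI := (functionFieldMap f).toAlgebra
  ∃ s : X.functionField, s ^ 2 = algebraMap Y.functionField X.functionField d ∧
    IntermediateField.adjoin Y.functionField {s} = ⊤

/-- `h` is a norm from `k(X)/k(Y)`. -/
def IsNormFromFunctionField {X Y : Scheme.{u}} [IsIntegral X] [IsIntegral Y] (f : X ⟶ Y)
    [Flat f] (h : Y.functionField) : Prop :=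
  letI := (functionFieldMap f).toAlgebra
  ∃ g : X.functionField, Algebra.norm Y.functionField g = h

/-! ### The branch divisor of a double cover -/

/-- The branch divisor (discriminant) of the double cover `f : X ⟶ Y` is the closed subscheme with
ideal sheaf `I`: over every affine open set over which `f_* 𝒪_X` has a basis with two elements,
the discriminant of the basis generates `I`. -/
def HasBranchDivisor {X Y : Scheme.{u}} (f : X ⟶ Y) (I : Y.IdealSheafData) : Prop :=
  ∀ U : Y.affineOpens,
    letI := (f.app U.1).hom.toAlgebra
    ∀ b : Module.Basis (Fin 2) Γ(Y, U.1) Γ(X, f ⁻¹ᵁ U.1),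
      Ideal.span {Algebra.discr Γ(Y, U.1) b} = I.ideal U

/-! ### The Picard group -/

/-- Restriction of invertible functions. -/
noncomputable def resUnits (X : Scheme.{u}) {U V : X.Opens} (h : V ≤ U) :
    Γ(X, U)ˣ →* Γ(X, V)ˣ :=
  Units.map (X.presheaf.map (homOfLE h).op).hom.toMonoidHom

lemma resUnits_resUnits (X : Scheme.{u}) {U V W : X.Opens} (h : V ≤ U) (h' : W ≤ V)
    (a : Γ(X, U)ˣ) : resUnits X h' (resUnits X h a) = resUnits X (h'.trans h) a := by
  ext
  change X.presheaf.map _ (X.presheaf.map _ _) = _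
  rw [← ConcreteCategory.comp_apply, ← Functor.map_comp]
  rfl

/-- Pullback of invertible functions. -/
noncomputable def pullUnits {X Y : Scheme.{u}} (f : X ⟶ Y) {U : Y.Opens} {V : X.Opens}
    (h : V ≤ f ⁻¹ᵁ U) : Γ(Y, U)ˣ →* Γ(X, V)ˣ :=
  Units.map (f.appLE U V h).hom.toMonoidHom

lemma resUnits_pullUnits {X Y : Scheme.{u}} (f : X ⟶ Y) {U : Y.Opens} {V W : X.Opens}
    (h : V ≤ f ⁻¹ᵁ U) (h' : W ≤ V) (a : Γ(Y, U)ˣ) :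
    resUnits X h' (pullUnits f h a) = pullUnits f (h'.trans h) a := by
  ext
  change X.presheaf.map _ (f.appLE U V h _) = _
  rw [← ConcreteCategory.comp_apply, Scheme.Hom.appLE_map]
  rfl

lemma pullUnits_resUnits {X Y : Scheme.{u}} (f : X ⟶ Y) {U U' : Y.Opens} {V : X.Opens}
    (h : V ≤ f ⁻¹ᵁ U') (h' : U' ≤ U) (a : Γ(Y, U)ˣ) :
    pullUnits f h (resUnits Y h' a) = pullUnits f (h.trans (f.preimage_mono h')) a := by
  ext
  change f.appLE U' V h (Y.presheaf.map _ _) = _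
  rw [← ConcreteCategory.comp_apply, Scheme.Hom.map_appLE]
  rfl

lemma le_preimage_inf {X Y : Scheme.{u}} (f : X ⟶ Y) {U V : Y.Opens} {W : X.Opens}
    (hU : W ≤ f ⁻¹ᵁ U) (hV : W ≤ f ⁻¹ᵁ V) : W ≤ f ⁻¹ᵁ (U ⊓ V) :=
  fun _ hx => ⟨hU hx, hV hx⟩

/-- A line bundle on `X` given by transition functions: an open cover (indexed by the points of
`X`, the set with index `x` being a neighbourhood of `x`, which is no restriction) and invertible
functions on the double overlaps satisfying the cocycle condition on the triple overlaps. -/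
structure LineBundle (X : Scheme.{u}) where
  /-- the trivializing open cover -/
  U : X → X.Opens
  mem : ∀ x, x ∈ U x
  /-- the transition functions -/
  g : ∀ x y, Γ(X, U x ⊓ U y)ˣ
  cocycle : ∀ (x y z : X) (W : X.Opens) (hx : W ≤ U x) (hy : W ≤ U y) (hz : W ≤ U z),
    resUnits X (le_inf hx hy) (g x y) * resUnits X (le_inf hy hz) (g y z) =
      resUnits X (le_inf hx hz) (g x z)

namespace LineBundle

variable {X Y : Scheme.{u}}

/-- The transition function `g x y`, restricted to a smaller open set. -/
noncomputable def gOn (M : LineBundle X) (x y : X) (W : X.Opens) (hx : W ≤ M.U x)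
    (hy : W ≤ M.U y) : Γ(X, W)ˣ :=
  resUnits X (le_inf hx hy) (M.g x y)

lemma gOn_mul_gOn (M : LineBundle X) (x y z : X) (W : X.Opens) (hx : W ≤ M.U x)
    (hy : W ≤ M.U y) (hz : W ≤ M.U z) :
    M.gOn x y W hx hy * M.gOn y z W hy hz = M.gOn x z W hx hz :=
  M.cocycle x y z W hx hy hz

/-- Two line bundles are isomorphic if, on a common refinement of their covers, the transition
functions differ by the coboundary of a family of invertible functions. -/
def Isomorphic (M N : LineBundle X) : Prop :=
  ∃ (V : X → X.Opens) (_ : ∀ x, x ∈ V x) (hM : ∀ x, V x ≤ M.U x) (hN : ∀ x, V x ≤ N.U x)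
    (a : ∀ x, Γ(X, V x)ˣ), ∀ (x y : X) (W : X.Opens) (hx : W ≤ V x) (hy : W ≤ V y),
      M.gOn x y W (hx.trans (hM x)) (hy.trans (hM y)) * resUnits X hy (a y) =
        resUnits X hx (a x) * N.gOn x y W (hx.trans (hN x)) (hy.trans (hN y))

/-- Line bundles on the same cover with the same transition functions, up to restriction, are
isomorphic. -/
lemma isomorphic_of_eq {M N : LineBundle X} (V : X → X.Opens) (hV : ∀ x, x ∈ V x)
    (hM : ∀ x, V x ≤ M.U x) (hN : ∀ x, V x ≤ N.U x)
    (h : ∀ x y (W : X.Opens) (hx : W ≤ V x) (hy : W ≤ V y),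
      M.gOn x y W (hx.trans (hM x)) (hy.trans (hM y)) =
        N.gOn x y W (hx.trans (hN x)) (hy.trans (hN y))) : M.Isomorphic N :=
  ⟨V, hV, hM, hN, fun _ => 1, fun x y W hx hy => by
    rw [map_one, map_one, mul_one, one_mul]; exact h x y W hx hy⟩

/-- The isomorphism relation on line bundles. -/
instance setoid (X : Scheme.{u}) : Setoid (LineBundle X) where
  r := Isomorphic
  iseqv :=
    { refl := fun M =>
        isomorphic_of_eq M.U M.mem (fun _ => le_rfl) (fun _ => le_rfl) fun _ _ _ _ _ => rfl
      symm := by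
        rintro M N ⟨V, hV, hM, hN, a, h⟩
        refine ⟨V, hV, hN, hM, fun x => (a x)⁻¹, fun x y W hx hy => ?_⟩
        have := h x y W hx hy
        rw [map_inv, map_inv, mul_inv_eq_iff_eq_mul, mul_assoc, this, inv_mul_cancel_left]
      trans := by
        rintro M N P ⟨V, hV, hM, hN, a, h⟩ ⟨V', hV', hN', hP, b, h'⟩
        refine ⟨fun x => V x ⊓ V' x, fun x => ⟨hV x, hV' x⟩, fun x => inf_le_left.trans (hM x),
          fun x => inf_le_right.trans (hP x),
          fun x => resUnits X inf_le_left (a x) * resUnits X inf_le_right (b x),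
          fun x y W hx hy => ?_⟩
        have h1 := h x y W (hx.trans inf_le_left) (hy.trans inf_le_left)
        have h2 := h' x y W (hx.trans inf_le_right) (hy.trans inf_le_right)
        rw [map_mul, map_mul, resUnits_resUnits, resUnits_resUnits, resUnits_resUnits,
          resUnits_resUnits, ← mul_assoc, h1, mul_assoc, h2, mul_assoc] }

/-- The trivial line bundle. -/
noncomputable abbrev trivial (X : Scheme.{u}) : LineBundle X where
  U _ := ⊤
  mem _ := by trivial
  g _ _ := 1
  cocycle := by simp

lemma trivial_gOn (x y : X) (W : X.Opens) (hx hy) : (trivial X).gOn x y W hx hy = 1 :=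
  map_one _

/-- The tensor product of line bundles. -/
noncomputable abbrev tensor (M N : LineBundle X) : LineBundle X where
  U x := M.U x ⊓ N.U x
  mem x := ⟨M.mem x, N.mem x⟩
  g x y := resUnits X (inf_le_inf inf_le_left inf_le_left) (M.g x y) *
    resUnits X (inf_le_inf inf_le_right inf_le_right) (N.g x y)
  cocycle x y z W hx hy hz := by
    have h1 := M.cocycle x y z W (hx.trans inf_le_left) (hy.trans inf_le_left)
      (hz.trans inf_le_left)
    have h2 := N.cocycle x y z W (hx.trans inf_le_right) (hy.trans inf_le_right)
      (hz.trans inf_le_right)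
    simp only [map_mul, resUnits_resUnits]
    rw [← h1, ← h2, mul_mul_mul_comm]

lemma tensor_gOn (M N : LineBundle X) (x y : X) (W : X.Opens) (hx : W ≤ M.U x ⊓ N.U x)
    (hy : W ≤ M.U y ⊓ N.U y) :
    (M.tensor N).gOn x y W hx hy =
      M.gOn x y W (hx.trans inf_le_left) (hy.trans inf_le_left) *
        N.gOn x y W (hx.trans inf_le_right) (hy.trans inf_le_right) := by
  refine (map_mul (resUnits X (le_inf hx hy)) _ _).trans ?_
  rw [resUnits_resUnits, resUnits_resUnits]
  rfl

/-- The dual of a line bundle. -/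
noncomputable abbrev dual (M : LineBundle X) : LineBundle X where
  U := M.U
  mem := M.mem
  g x y := (M.g x y)⁻¹
  cocycle x y z W hx hy hz := by
    rw [map_inv, map_inv, map_inv, ← M.cocycle x y z W hx hy hz, mul_inv]

lemma dual_gOn (M : LineBundle X) (x y : X) (W : X.Opens) (hx : W ≤ M.U x)
    (hy : W ≤ M.U y) : M.dual.gOn x y W hx hy = (M.gOn x y W hx hy)⁻¹ :=
  map_inv (resUnits X (le_inf hx hy)) (M.g x y)

/-- The pullback of a line bundle. -/
noncomputable abbrev pullback (f : X ⟶ Y) (M : LineBundle Y) : LineBundle X where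
  U x := f ⁻¹ᵁ M.U (f x)
  mem x := M.mem (f x)
  g x y := pullUnits f (le_preimage_inf f inf_le_left inf_le_right) (M.g (f x) (f y))
  cocycle x y z W hx hy hz := by
    have h := congr_arg (pullUnits f (V := W) (U := M.U (f x) ⊓ M.U (f y) ⊓ M.U (f z))
      (le_preimage_inf f (le_preimage_inf f hx hy) hz)) (M.cocycle (f x) (f y) (f z)
        (M.U (f x) ⊓ M.U (f y) ⊓ M.U (f z)) (inf_le_left.trans inf_le_left)
        (inf_le_left.trans inf_le_right) inf_le_right)
    rw [map_mul, pullUnits_resUnits, pullUnits_resUnits, pullUnits_resUnits] at h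
    rw [resUnits_pullUnits, resUnits_pullUnits, resUnits_pullUnits]
    exact h

lemma pullback_gOn (f : X ⟶ Y) (M : LineBundle Y) (x y : X) (V : Y.Opens)
    (hx : V ≤ M.U (f x)) (hy : V ≤ M.U (f y)) (W : X.Opens) (hW : W ≤ f ⁻¹ᵁ V)
    (hx' : W ≤ f ⁻¹ᵁ M.U (f x)) (hy' : W ≤ f ⁻¹ᵁ M.U (f y)) :
    (M.pullback f).gOn x y W hx' hy' = pullUnits f hW (M.gOn (f x) (f y) V hx hy) := by
  rw [gOn, gOn, resUnits_pullUnits, pullUnits_resUnits]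

lemma isomorphic_tensor {M M' N N' : LineBundle X} (h : M.Isomorphic M')
    (h' : N.Isomorphic N') : (M.tensor N).Isomorphic (M'.tensor N') := by
  obtain ⟨V, hV, hM, hN, a, h⟩ := h
  obtain ⟨V', hV', hM', hN', b, h'⟩ := h'
  refine ⟨fun x => V x ⊓ V' x, fun x => ⟨hV x, hV' x⟩, fun x => inf_le_inf (hM x) (hM' x),
    fun x => inf_le_inf (hN x) (hN' x),
    fun x => resUnits X inf_le_left (a x) * resUnits X inf_le_right (b x),
    fun x y W hx hy => ?_⟩
  have h1 := h x y W (hx.trans inf_le_left) (hy.trans inf_le_left)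
  have h2 := h' x y W (hx.trans inf_le_right) (hy.trans inf_le_right)
  rw [tensor_gOn, tensor_gOn, map_mul, map_mul, resUnits_resUnits, resUnits_resUnits,
    resUnits_resUnits, resUnits_resUnits, mul_mul_mul_comm, h1, h2, mul_mul_mul_comm]

lemma isomorphic_dual {M M' : LineBundle X} (h : M.Isomorphic M') :
    M.dual.Isomorphic M'.dual := by
  obtain ⟨V, hV, hM, hN, a, h⟩ := h
  refine ⟨V, hV, hM, hN, fun x => (a x)⁻¹, fun x y W hx hy => ?_⟩
  have h1 := h x y W hx hy
  rw [dual_gOn, dual_gOn, map_inv, map_inv, ← mul_inv, ← mul_inv, h1]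

lemma isomorphic_pullback (f : X ⟶ Y) {M N : LineBundle Y} (h : M.Isomorphic N) :
    (M.pullback f).Isomorphic (N.pullback f) := by
  obtain ⟨V, hV, hM, hN, a, h⟩ := h
  refine ⟨fun x => f ⁻¹ᵁ V (f x), fun x => hV (f x), fun x => f.preimage_mono (hM (f x)),
    fun x => f.preimage_mono (hN (f x)),
    fun x => pullUnits f le_rfl (a (f x)), fun x y W hx hy => ?_⟩
  have hW : W ≤ f ⁻¹ᵁ (V (f x) ⊓ V (f y)) := le_preimage_inf f hx hy
  have h := congr_arg (pullUnits f hW) (h (f x) (f y) (V (f x) ⊓ V (f y)) inf_le_left inf_le_right)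
  rw [map_mul, map_mul, pullUnits_resUnits, pullUnits_resUnits] at h
  rw [resUnits_pullUnits, resUnits_pullUnits, pullback_gOn f M x y _ _ _ W hW,
    pullback_gOn f N x y _ _ _ W hW]
  exact h

end LineBundle

/-- The Picard group of `X`: isomorphism classes of line bundles. -/
def Pic (X : Scheme.{u}) : Type u := Quotient (LineBundle.setoid X)

namespace Pic

open LineBundle

variable {X Y : Scheme.{u}}

/-- The group structure given by the tensor product. -/
noncomputable instance : CommGroup (Pic X) where
  mul := Quotient.map₂ LineBundle.tensor fun _ _ h _ _ h' => isomorphic_tensor h h'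
  one := Quotient.mk _ (LineBundle.trivial X)
  inv := Quotient.map LineBundle.dual fun _ _ h => isomorphic_dual h
  mul_assoc := by
    rintro ⟨M⟩ ⟨N⟩ ⟨P⟩
    refine Quotient.sound (isomorphic_of_eq (fun x => M.U x ⊓ N.U x ⊓ P.U x)
      (fun x => ⟨⟨M.mem x, N.mem x⟩, P.mem x⟩) (fun x => le_rfl) (fun x => inf_assoc _ _ _ |>.le)
      fun x y W hx hy => ?_)
    rw [tensor_gOn, tensor_gOn, tensor_gOn, tensor_gOn, mul_assoc]
  one_mul := by
    rintro ⟨M⟩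
    refine Quotient.sound (isomorphic_of_eq M.U M.mem (fun x => le_inf le_top le_rfl)
      (fun x => le_rfl) fun x y W hx hy => ?_)
    rw [tensor_gOn, trivial_gOn, one_mul]
  mul_one := by
    rintro ⟨M⟩
    refine Quotient.sound (isomorphic_of_eq M.U M.mem (fun x => le_inf le_rfl le_top)
      (fun x => le_rfl) fun x y W hx hy => ?_)
    rw [tensor_gOn, trivial_gOn, mul_one]
  inv_mul_cancel := by
    rintro ⟨M⟩
    refine Quotient.sound (isomorphic_of_eq M.U M.mem (fun x => le_inf le_rfl le_rfl)
      (fun x => le_top) fun x y W hx hy => ?_)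
    rw [tensor_gOn, trivial_gOn, dual_gOn, inv_mul_cancel]
  mul_comm := by
    rintro ⟨M⟩ ⟨N⟩
    refine Quotient.sound (isomorphic_of_eq (fun x => M.U x ⊓ N.U x)
      (fun x => ⟨M.mem x, N.mem x⟩) (fun x => le_rfl) (fun x => inf_comm _ _ |>.le)
      fun x y W hx hy => ?_)
    rw [tensor_gOn, tensor_gOn, mul_comm]

/-- The homomorphism `f^* : Pic Y → Pic X`. -/
noncomputable def pullback (f : X ⟶ Y) : Pic Y →* Pic X where
  toFun := Quotient.map (LineBundle.pullback f) fun _ _ h => isomorphic_pullback f h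
  map_one' := by
    refine Quotient.sound (isomorphic_of_eq (fun _ => ⊤) (fun _ => by trivial) (fun _ => le_rfl)
      (fun _ => le_rfl) fun x y W hx hy => ?_)
    rw [pullback_gOn f (trivial Y) x y ⊤ le_rfl le_rfl W le_top, trivial_gOn, trivial_gOn, map_one]
  map_mul' := by
    rintro ⟨M⟩ ⟨N⟩
    refine Quotient.sound (isomorphic_of_eq (fun x => f ⁻¹ᵁ (M.U (f x) ⊓ N.U (f x)))
      (fun x => ⟨M.mem (f x), N.mem (f x)⟩) (fun _ => le_rfl)
      (fun _ => le_rfl) fun x y W hx hy => ?_)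
    have hW : W ≤ f ⁻¹ᵁ ((M.U (f x) ⊓ N.U (f x)) ⊓ (M.U (f y) ⊓ N.U (f y))) :=
      le_preimage_inf f hx hy
    rw [pullback_gOn f (M.tensor N) x y _ inf_le_left inf_le_right W hW, tensor_gOn, tensor_gOn,
      map_mul, pullback_gOn f M x y _ _ _ W hW, pullback_gOn f N x y _ _ _ W hW]

end Pic

/-!
Since `d` is a square on the curve `C`, the preimage of `C` in the double plane `S` consists of two
curves, interchanged by the involution of `S` over the plane. Let `C₁` be one of them; the norm of
an equation of `C₁` is an equation of `C`. As the branch curve is smooth, `C₁` is a Cartier divisor,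
and as every line bundle on `S` is a pullback from the plane, `C₁` is linearly equivalent to the
pullback of a multiple `n L` of the line: `C₁ - r^*(n L)` is the divisor of a rational function `g`
on `S`. Then `f = N(g)` has divisor `C - 2 n L`, and `n` is positive since otherwise `f` would be
regular on the plane, hence invertible, while it vanishes on `C`.

The proof speaks about rational functions instead of divisors on `S`. Locally on the plane, `S` is
given by a square root `s` of an equation `δ` of the branch curve (`exists_affineOpen_sqrt`), and
`δ` does not vanish to order two anywhere (`ProjectivePlane.notMem_maximalIdeal_sq`). The ideal of
`C₁` in `A + A s`, where `A` is the local ring at a closed point, consists of the elements `p + q s`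
such that `p + q σ` vanishes on `C`, where `σ` is a square root of `δ` on `C`. It is stable under
multiplication by `s`, a matrix of trace zero with square `δ`, so that it has a cyclic vector as
`δ` is not in the square of the maximal ideal (`exists_cyclic_generator`). Freeness of the ideal
over `A` comes from a second curve through the point on which all ideals are principal
(`HasTransversals`); this replaces the theory of regular local rings. The norm of the generator is
an equation of `C` up to a unit (`exists_mem_rootIdeal_norm_eq`).

The generators form a Cartier divisor, and surjectivity of `r^*` on Picard groups
(`exists_div_mem_regularOver`) gives a rational function `w` on `S` and a Cartier divisor `h` on the
plane such that `N(w) h ^ 2` is an equation of `C` everywhere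
(`IsSplitDoubleCover.exists_forall_isLocalEquation`). On the complement of `L`, an affine plane, `h`
is the divisor of a function `q`, and `f = N(w q) = N(w) q ^ 2` is the function wanted
(`ProjectivePlane.exists_hasDivisor_mul_sq`).
-/

/-! ### Lattices in a quadratic extension stable under a square root -/

/-- If every ideal of `A` is principal modulo `x`, a submodule `N` of `A × A` on whose quotient
`x` is a nonzerodivisor is generated by two elements: modulo `x`, a generator of the second
coordinates of `N` and a generator of the first coordinates of the elements with vanishing second
coordinate suffice, and Nakayama's lemma applies. -/
lemma exists_two_generators {A : Type*} [CommRing A] [IsLocalRing A] [IsNoetherianRing A]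
    {x : A} (hx : x ∈ IsLocalRing.maximalIdeal A)
    (hJ : ∀ J : Ideal A, ∃ j ∈ J, J ≤ Ideal.span {j, x})
    (N : Submodule A (A × A)) (hN : ∀ n, x • n ∈ N → n ∈ N) :
    ∃ n₁ ∈ N, ∃ n₂ ∈ N, N ≤ Submodule.span A {n₁, n₂} := by
  obtain ⟨j₁, hj₁, hJ₁⟩ := hJ (N.map (LinearMap.snd A A A))
  obtain ⟨n₁, hn₁, rfl⟩ := hj₁
  let N' : Submodule A (A × A) :=
    N ⊓ Submodule.comap (LinearMap.snd A A A) (Ideal.span {x})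
  obtain ⟨j₂, hj₂, hJ₂⟩ := hJ (N'.map (LinearMap.fst A A A))
  obtain ⟨n₂, hn₂, rfl⟩ := hj₂
  refine ⟨n₁, hn₁, n₂, hn₂.1, ?_⟩
  refine Submodule.le_of_le_smul_of_le_jacobson_bot (I := Ideal.span {x})
    (IsNoetherian.noetherian N) ?_ ?_
  · rw [IsLocalRing.jacobson_eq_maximalIdeal _ bot_ne_top, Ideal.span_singleton_le_iff_mem]
    exact hx
  intro n hn
  obtain ⟨a, b, hab⟩ := Ideal.mem_span_pair.1 (hJ₁ ⟨n, hn, rfl⟩)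
  have hn' : n - a • n₁ ∈ N' := by
    refine ⟨N.sub_mem hn (N.smul_mem _ hn₁), ?_⟩
    refine Ideal.mem_span_singleton'.2 ⟨b, ?_⟩
    simp only [LinearMap.snd_apply, Prod.snd_sub, Prod.smul_snd, smul_eq_mul] at hab ⊢
    linear_combination hab
  obtain ⟨a', b', hab'⟩ := Ideal.mem_span_pair.1 (hJ₂ ⟨_, hn', rfl⟩)
  have h3 : n - a • n₁ - a' • n₂ ∈ N' :=
    N'.sub_mem hn' (N'.smul_mem _ hn₂)
  obtain ⟨e, he⟩ := Ideal.mem_span_singleton'.1 h3.2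
  have h4 : n - a • n₁ - a' • n₂ = x • (b', e) := by
    ext
    · simp only [LinearMap.fst_apply, Prod.fst_sub, Prod.smul_fst, smul_eq_mul] at hab' ⊢
      linear_combination -hab'
    · simp only [LinearMap.snd_apply, Prod.snd_sub, Prod.smul_snd, smul_eq_mul] at he ⊢
      linear_combination -he
  have h5 : n = (a • n₁ + a' • n₂) + x • (b', e) := by rw [← h4]; abel
  rw [h5]
  refine Submodule.add_mem_sup ?_ ?_
  · exact Submodule.mem_span_pair.2 ⟨a, a', rfl⟩
  · exact Submodule.smul_mem_smul (Ideal.mem_span_singleton_self x) (hN _ (h4 ▸ h3.1))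

/-- Let `M = K(s)` be a quadratic extension of the fraction field of a local ring `A`, where
`s ^ 2 = δ` lies in `A` but not in the square of the maximal ideal. An ideal of `A + A s` on whose
quotient some `x` is a nonzerodivisor, where all ideals of `A` are principal modulo `x`, is
principal: it is free of rank two over `A`, and multiplication by `s` is a matrix of trace zero
with square `δ`, which is not scalar modulo the maximal ideal, so that a cyclic vector exists. -/
lemma exists_cyclic_generator {A K M : Type*} [CommRing A] [IsDomain A] [IsLocalRing A]
    [IsNoetherianRing A] [Field K] [Algebra A K] [IsFractionRing A K] [Field M] [Algebra K M]
    [Algebra A M] [IsScalarTower A K M] (hKM : Module.finrank K M = 2)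
    (h2 : IsUnit (2 : A)) {s : M} (hsK : s ∉ (algebraMap K M).range) {δ : A}
    (hs : s ^ 2 = algebraMap A M δ) (hδ : δ ∉ IsLocalRing.maximalIdeal A ^ 2)
    {x : A} (hx : x ∈ IsLocalRing.maximalIdeal A)
    (hJ : ∀ J : Ideal A, ∃ j ∈ J, J ≤ Ideal.span {j, x})
    (P : Submodule A M) (hP : P ≤ Submodule.span A {1, s}) (hsP : ∀ p ∈ P, s * p ∈ P)
    (hxP : ∀ b ∈ Submodule.span A {1, s}, x • b ∈ P → b ∈ P)
    {c : A} (hc : c ≠ 0) (hcP : algebraMap A M c ∈ P) :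
    ∃ v ∈ P, P ≤ Submodule.span A {v, s * v} := by
  have hAM : Function.Injective (algebraMap A M) := by
    rw [IsScalarTower.algebraMap_eq A K M]
    exact (algebraMap K M).injective.comp (IsFractionRing.injective A K)
  have hspan : ∃ e₁ ∈ P, ∃ e₂ ∈ P, P ≤ Submodule.span A {e₁, e₂} := by
    let ψ : A × A →ₗ[A] M :=
      (LinearMap.toSpanSingleton A M 1).coprod (LinearMap.toSpanSingleton A M s)
    have hψ : ∀ n, ψ n = n.1 • (1 : M) + n.2 • s := fun n => by simp [ψ]
    obtain ⟨n₁, hn₁, n₂, hn₂, h⟩ := exists_two_generators hx hJ (P.comap ψ) (fun n hn =>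
      hxP _ (by rw [hψ]; exact Submodule.mem_span_pair.2 ⟨_, _, rfl⟩)
        (by simpa only [Submodule.mem_comap, map_smul] using hn))
    refine ⟨ψ n₁, hn₁, ψ n₂, hn₂, fun p hp => ?_⟩
    obtain ⟨a, b, hab⟩ := Submodule.mem_span_pair.1 (hP hp)
    have h1 : ((a, b) : A × A) ∈ P.comap ψ := by
      rw [Submodule.mem_comap, hψ, hab]; exact hp
    obtain ⟨a', b', h2⟩ := Submodule.mem_span_pair.1 (h h1)
    refine Submodule.mem_span_pair.2 ⟨a', b', ?_⟩
    rw [← map_smul, ← map_smul, ← map_add, h2, hψ, hab]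
  obtain ⟨e₁, he₁, e₂, he₂, hPe⟩ := hspan
  have hli : LinearIndependent K ![e₁, e₂] := by
    refine linearIndependent_of_top_le_span_of_card_eq_finrank ?_ (by simp [hKM])
    have hle : ∀ p ∈ P, p ∈ Submodule.span K (Set.range ![e₁, e₂]) := fun p hp => by
      have := Submodule.span_le_restrictScalars A K _ (hPe hp)
      rwa [Matrix.range_cons_cons_empty]
    have hcK : algebraMap A K c ≠ 0 := by
      rwa [Ne, IsFractionRing.to_map_eq_zero_iff]
    have key : ∀ m : M, algebraMap A M c * m ∈ P →
        m ∈ Submodule.span K (Set.range ![e₁, e₂]) := fun m hm => by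
      have := Submodule.smul_mem _ (algebraMap A K c)⁻¹ (hle _ hm)
      rwa [IsScalarTower.algebraMap_apply A K M, ← Algebra.smul_def, smul_smul,
        inv_mul_cancel₀ hcK, one_smul] at this
    have h1 : (1 : M) ∈ Submodule.span K (Set.range ![e₁, e₂]) := key 1 (by simpa using hcP)
    have h2 : s ∈ Submodule.span K (Set.range ![e₁, e₂]) :=
      key s (by rw [mul_comm]; exact hsP _ hcP)
    have hli' : LinearIndependent K ![(1 : M), s] := by
      rw [LinearIndependent.pair_iff' one_ne_zero]
      intro a ha
      exact hsK ⟨a, by rw [← ha, Algebra.smul_def, mul_one]⟩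
    rw [← hli'.span_eq_top_of_card_eq_finrank (by simp [hKM]), Submodule.span_le]
    rintro _ ⟨i, rfl⟩
    fin_cases i
    · exact h1
    · exact h2
  have hind : ∀ a b : A, a • e₁ + b • e₂ = 0 → a = 0 ∧ b = 0 := fun a b hab => by
    rw [LinearIndependent.pair_iff] at hli
    have := hli (algebraMap A K a) (algebraMap A K b) (by simpa using hab)
    simpa using this
  have he₁0 : e₁ ≠ 0 := fun h => one_ne_zero (hind 1 0 (by simp [h])).1
  obtain ⟨a, c', h1⟩ := Submodule.mem_span_pair.1 (hPe (hsP _ he₁))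
  obtain ⟨b, a', h2'⟩ := Submodule.mem_span_pair.1 (hPe (hsP _ he₂))
  simp only [Algebra.smul_def] at h1 h2' hind
  have r1 := hind (a ^ 2 + b * c' - δ) (c' * (a + a')) (by
    simp only [map_mul, map_add, map_sub, map_pow, ← hs]
    linear_combination (algebraMap A M a + s) * h1 + algebraMap A M c' * h2')
  have r2 := hind (b * (a + a')) (a' ^ 2 + b * c' - δ) (by
    simp only [map_mul, map_add, map_sub, map_pow, ← hs]
    linear_combination (algebraMap A M a' + s) * h2' + algebraMap A M b * h1)
  have htr : a + a' = 0 := by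
    by_contra hne
    have hc0 : c' = 0 := (mul_eq_zero.1 r1.2).resolve_right hne
    refine hsK ⟨algebraMap A K a, ?_⟩
    rw [← IsScalarTower.algebraMap_apply]
    refine mul_right_cancel₀ he₁0 ?_
    simpa [hc0] using h1
  obtain rfl : a' = -a := by linear_combination htr
  have hδ' : δ = a ^ 2 + b * c' := by linear_combination -r1.1
  have hgen : ∀ v ∈ P, e₁ ∈ Submodule.span A {v, s * v} → e₂ ∈ Submodule.span A {v, s * v} →
      ∃ v ∈ P, P ≤ Submodule.span A {v, s * v} := fun v hv h1 h2 =>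
    ⟨v, hv, hPe.trans (Submodule.span_le.2 (by rintro _ (rfl | rfl) <;> assumption))⟩
  have hmem : ∀ (v w : M) (p q : A), algebraMap A M p * v + algebraMap A M q * (s * v) = w →
      w ∈ Submodule.span A {v, s * v} := fun v w p q h =>
    Submodule.mem_span_pair.2 ⟨p, q, by simpa only [Algebra.smul_def] using h⟩
  by_cases hcu : IsUnit c'
  · obtain ⟨i, hi⟩ := hcu.exists_left_inv
    have hi' := congr_arg (algebraMap A M) hi
    simp only [map_mul, map_one] at hi'
    refine hgen e₁ he₁ (hmem _ _ 1 0 (by simp)) (hmem _ _ (-(i * a)) i ?_)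
    simp only [map_neg, map_mul]
    linear_combination -algebraMap A M i * h1 + e₂ * hi'
  by_cases hbu : IsUnit b
  · obtain ⟨i, hi⟩ := hbu.exists_left_inv
    have hi' := congr_arg (algebraMap A M) hi
    simp only [map_mul, map_one] at hi'
    refine hgen e₂ he₂ (hmem _ _ (i * a) i ?_) (hmem _ _ 1 0 (by simp))
    simp only [map_neg, map_mul] at h2' ⊢
    linear_combination -algebraMap A M i * h2' + e₁ * hi'
  have hbm : b ∈ IsLocalRing.maximalIdeal A := hbu
  have hcm : c' ∈ IsLocalRing.maximalIdeal A := hcu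
  have hau : IsUnit a := by
    by_contra hau
    have ham : a ∈ IsLocalRing.maximalIdeal A := hau
    refine hδ ?_
    rw [hδ']
    exact add_mem (Ideal.pow_mem_pow ham 2) (by rw [pow_two]; exact Ideal.mul_mem_mul hbm hcm)
  -- the determinant of `(v, s v)` for `v = e₁ + e₂`
  have hdet : IsUnit (c' - b - 2 * a) := by
    by_contra h
    have hm : c' - b - 2 * a ∈ IsLocalRing.maximalIdeal A := h
    have : 2 * a ∈ IsLocalRing.maximalIdeal A := by
      have := sub_mem (sub_mem hcm hbm) hm
      ring_nf at this ⊢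
      exact this
    exact this (h2.mul hau)
  obtain ⟨i, hi⟩ := hdet.exists_left_inv
  have hi' := congr_arg (algebraMap A M) hi
  simp only [map_mul, map_one, map_sub, map_ofNat] at hi'
  simp only [map_neg] at h2'
  refine hgen (e₁ + e₂) (add_mem he₁ he₂) (hmem _ _ (i * (c' - a)) (-i) ?_)
    (hmem _ _ (-(i * (a + b))) i ?_)
  · simp only [map_neg, map_mul, map_sub]
    linear_combination algebraMap A M i * (h1 + h2') + e₁ * hi'
  · simp only [map_neg, map_mul, map_add]
    linear_combination -algebraMap A M i * (h1 + h2') + e₂ * hi'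

/-! ### Smooth hypersurfaces -/

/-- The equation `F` of a smooth hypersurface does not vanish to order two at any point. By the
infinitesimal lifting property, `A ⧸ F ^ 2 → A ⧸ F` has a section, and the resulting endomorphism
`a ↦ a + F a'` of `A ⧸ F ^ 2` kills `F`. If `g F` were in `m ^ 2`, its image would be
`g F + F b` with `b ∈ m`, so that `g + b` would be divisible by `F`. -/
lemma not_mul_mem_sq_of_formallySmooth {k A R : Type*} [CommRing k] [CommRing A] [IsDomain A]
    [CommRing R] [Algebra k A] [Algebra k R] [Algebra.FormallySmooth k R] (π : A →ₐ[k] R)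
    (hπ : Function.Surjective π) {F : A} (hF : F ≠ 0) (hker : RingHom.ker π = Ideal.span {F})
    (m : Ideal A) [m.IsPrime] {g : A} (hg : g ∉ m) : g * F ∉ m ^ 2 := by
  intro hgF
  have hFm : F ∈ m :=
    (Ideal.IsPrime.mem_or_mem ‹_› (Ideal.pow_le_self two_ne_zero hgF)).resolve_left hg
  let J : Ideal A := Ideal.span {F ^ 2}
  have hJker : ∀ a ∈ J, π a = 0 := fun a ha => by
    have : a ∈ RingHom.ker π := by
      rw [hker]
      exact Ideal.span_singleton_le_span_singleton.2 (dvd_pow_self F two_ne_zero) ha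
    exact this
  let G : A ⧸ J →ₐ[k] R := Ideal.Quotient.liftₐ J π hJker
  have hG : Function.Surjective G := Ideal.Quotient.lift_surjective_of_surjective J hJker hπ
  have hGnil : IsNilpotent (RingHom.ker (G : A ⧸ J →+* R)) := by
    have hle : RingHom.ker (G : A ⧸ J →+* R) ≤ (Ideal.span {F}).map (Ideal.Quotient.mk J) := by
      intro y hy
      obtain ⟨a, rfl⟩ := Ideal.Quotient.mk_surjective y
      exact Ideal.mem_map_of_mem _ (hker ▸ (show a ∈ RingHom.ker π from hy))
    refine ⟨2, le_bot_iff.1 ((Ideal.pow_right_mono hle 2).trans ?_)⟩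
    rw [← Ideal.map_pow, Ideal.span_singleton_pow, Ideal.map_quotient_self]
  let σ : R →ₐ[k] A ⧸ J := Algebra.FormallySmooth.liftOfSurjective (AlgHom.id k R) G hG hGnil
  -- `σ ∘ π` is congruent to the identity modulo `F` and kills `F`.
  have hσ : ∀ a, ∃ b, σ (π a) = Ideal.Quotient.mk J (a + F * b) := fun a => by
    obtain ⟨e, he⟩ := Ideal.Quotient.mk_surjective (σ (π a))
    have h1 : G (σ (π a)) = π a :=
      Algebra.FormallySmooth.liftOfSurjective_apply (AlgHom.id k R) G hG hGnil (π a)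
    rw [← he] at h1
    have h2 : e - a ∈ RingHom.ker π := by
      rw [RingHom.mem_ker, map_sub, sub_eq_zero]
      exact h1
    rw [hker] at h2
    obtain ⟨b, hb⟩ := Ideal.mem_span_singleton.1 h2
    exact ⟨b, by rw [← hb, ← he]; congr 1; ring⟩
  have key : ∀ z ∈ m ^ 2, ∃ b ∈ m, σ (π z) = Ideal.Quotient.mk J (z + F * b) := by
    intro z hz
    rw [pow_two] at hz
    refine Submodule.mul_induction_on hz (fun p hp q hq => ?_) (fun y z hy hz => ?_)
    · obtain ⟨p', hp'⟩ := hσ p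
      obtain ⟨q', hq'⟩ := hσ q
      refine ⟨p * q' + q * p' + F * (p' * q'), ?_, ?_⟩
      · exact add_mem (add_mem (m.mul_mem_right _ hp) (m.mul_mem_right _ hq))
          (m.mul_mem_right _ hFm)
      · rw [map_mul, map_mul, hp', hq', ← map_mul]
        congr 1
        ring
    · obtain ⟨y', hym, hy'⟩ := hy
      obtain ⟨z', hzm, hz'⟩ := hz
      refine ⟨y' + z', add_mem hym hzm, ?_⟩
      rw [map_add, map_add, hy', hz', ← map_add]
      congr 1
      ring
  obtain ⟨b, hbm, hb⟩ := key _ hgF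
  have hπF : π F = 0 := by
    have : F ∈ RingHom.ker π := hker ▸ Ideal.mem_span_singleton_self F
    exact this
  rw [map_mul, hπF, mul_zero, map_zero, eq_comm, Ideal.Quotient.eq_zero_iff_mem] at hb
  obtain ⟨e, he⟩ := Ideal.mem_span_singleton.1 hb
  have : g + b = F * e := mul_left_cancel₀ hF (by linear_combination he)
  exact hg ((Ideal.add_mem_iff_left m hbm).1 (this ▸ m.mul_mem_right _ hFm))

/-! ### The ring of the affine plane -/

open Polynomial in
/-- A maximal ideal of `k[u][v]` contains a polynomial `f(u)` modulo which all ideals are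
principal. -/
lemma exists_C_mem_of_isMaximal {k : Type*} [Field k] (m : Ideal k[X][X]) [m.IsMaximal] :
    ∃ f : k[X], f ≠ 0 ∧ C f ∈ m ∧ ∀ J : Ideal k[X][X], ∃ j ∈ J, J ≤ Ideal.span {j, C f} := by
  have hmax : (m.comap (C : k[X] →+* k[X][X])).IsMaximal :=
    Polynomial.isMaximal_comap_C_of_isJacobsonRing m
  obtain ⟨f, hf⟩ := IsPrincipalIdealRing.principal (m.comap (C : k[X] →+* k[X][X]))
  have hf' : m.comap (C : k[X] →+* k[X][X]) = Ideal.span {f} := hf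
  have hfm : C f ∈ m := by
    have : f ∈ m.comap (C : k[X] →+* k[X][X]) := hf' ▸ Ideal.mem_span_singleton_self f
    exact this
  refine ⟨f, ?_, hfm, fun J => ?_⟩
  · rintro rfl
    rw [Ideal.span_singleton_zero] at hf'
    exact Polynomial.not_isField k (Ring.isField_iff_maximal_bot.2 (hf' ▸ hmax))
  · have : (Ideal.span {f}).IsMaximal := hf' ▸ hmax
    let := Ideal.Quotient.field (Ideal.span {f})
    let q : k[X][X] →+* (k[X] ⧸ Ideal.span {f})[X] := mapRingHom (Ideal.Quotient.mk _)
    have hq : Function.Surjective q :=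
      Polynomial.map_surjective _ Ideal.Quotient.mk_surjective
    have hker : RingHom.ker q = Ideal.span {C f} := by
      rw [Polynomial.ker_mapRingHom, Ideal.mk_ker, Ideal.map_span, Set.image_singleton]
    obtain ⟨j', hj'⟩ := IsPrincipalIdealRing.principal (J.map q)
    have hj1 : j' ∈ J.map q := by rw [hj']; exact Submodule.mem_span_singleton_self j'
    obtain ⟨j, hj, rfl⟩ := (Ideal.mem_map_iff_of_surjective q hq).1 hj1
    refine ⟨j, hj, fun i hi => ?_⟩
    have h1 : q i ∈ Submodule.span _ {q j} := hj' ▸ Ideal.mem_map_of_mem q hi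
    obtain ⟨a', ha'⟩ := Submodule.mem_span_singleton.1 h1
    obtain ⟨a, rfl⟩ := hq a'
    have h2 : i - a * j ∈ RingHom.ker q := by
      rw [RingHom.mem_ker, map_sub, map_mul, sub_eq_zero]
      exact ha'.symm
    rw [hker] at h2
    obtain ⟨b, hb⟩ := Ideal.mem_span_singleton'.1 h2
    exact Ideal.mem_span_pair.2 ⟨a, b, by linear_combination hb⟩

/-- The property of the coordinate ring of the affine plane used below: the point defined by a
maximal ideal `m` on the curve `c = 0` lies on another curve, on which all ideals are principal. -/
def HasTransversals (R : Type*) [CommRing R] : Prop :=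
  ∀ (m : Ideal R) [m.IsMaximal] (c : R), Prime c → c ∈ m →
    ∃ x ∈ m, ¬ c ∣ x ∧ ∀ J : Ideal R, ∃ j ∈ J, J ≤ Ideal.span {j, x}

lemma HasTransversals.of_ringEquiv_aux {R R' : Type*} [CommRing R] [CommRing R'] (e : R ≃+* R')
    {x : R'} (h : ∀ J : Ideal R', ∃ j ∈ J, J ≤ Ideal.span {j, x}) (J : Ideal R) :
    ∃ j ∈ J, J ≤ Ideal.span {j, e.symm x} := by
  obtain ⟨j, hj, hJ⟩ := h (J.comap (e.symm : R' →+* R))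
  refine ⟨e.symm j, hj, fun i hi => ?_⟩
  have : e i ∈ J.comap (e.symm : R' →+* R) := by simpa using hi
  obtain ⟨a, b, hab⟩ := Ideal.mem_span_pair.1 (hJ this)
  exact Ideal.mem_span_pair.2 ⟨e.symm a, e.symm b, by
    rw [← map_mul, ← map_mul, ← map_add, hab, e.symm_apply_apply]⟩

lemma HasTransversals.of_ringEquiv {R R' : Type*} [CommRing R] [CommRing R'] (e : R ≃+* R')
    (h : HasTransversals R') : HasTransversals R := by
  intro m hm c hc hcm
  have : (m.comap (e.symm : R' →+* R)).IsMaximal :=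
    Ideal.comap_isMaximal_of_surjective _ e.symm.surjective
  obtain ⟨x, hx, hcx, hJ⟩ := h (m.comap (e.symm : R' →+* R)) (e c)
    ((MulEquiv.prime_iff e.toMulEquiv).2 hc) (by simpa using hcm)
  refine ⟨e.symm x, hx, fun h => hcx ?_, of_ringEquiv_aux e hJ⟩
  simpa using map_dvd e h

open Polynomial in
lemma hasTransversals_polynomial (k : Type*) [Field k] : HasTransversals k[X][X] := by
  intro m hm c hc hcm
  obtain ⟨f, hf0, hfm, hfJ⟩ := exists_C_mem_of_isMaximal m
  by_cases hcf : c ∣ C f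
  -- if `c` divides `f(u)`, then it does not involve `v`, and the other coordinate serves
  swap
  · exact ⟨C f, hfm, hcf, hfJ⟩
  let e := (Polynomial.Bivariate.swap (R := k)).toRingEquiv
  have : (m.comap (e : k[X][X] →+* k[X][X])).IsMaximal :=
    Ideal.comap_isMaximal_of_surjective _ e.surjective
  obtain ⟨g, hg0, hgm, hgJ⟩ := exists_C_mem_of_isMaximal (m.comap (e : k[X][X] →+* k[X][X]))
  refine ⟨e (C g), hgm, fun hcg => ?_, HasTransversals.of_ringEquiv_aux e.symm hgJ⟩
  obtain ⟨a, rfl⟩ : ∃ a, c = C a := by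
    refine ⟨_, eq_C_of_natDegree_le_zero ?_⟩
    have := natDegree_le_of_dvd hcf (C_ne_zero.2 hf0)
    simpa using this
  have hg' : e (C g) = g.map C := Polynomial.Bivariate.swap_C g
  rw [hg', C_dvd_iff_dvd_coeff] at hcg
  have h1 := hcg g.natDegree
  rw [coeff_map, coeff_natDegree] at h1
  exact hc.not_isUnit ((isUnit_C).2 (isUnit_of_dvd_unit h1
    ((isUnit_C).2 (leadingCoeff_ne_zero.2 hg0).isUnit)))

/-- Passing to a localization of the ring preserves that all ideals are principal modulo `x`. -/
lemma exists_le_span_pair_of_isLocalization {R A : Type*} [CommRing R] [CommRing A] [Algebra R A]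
    (S : Submonoid R) [IsLocalization S A] {x : R}
    (h : ∀ J : Ideal R, ∃ j ∈ J, J ≤ Ideal.span {j, x}) (J : Ideal A) :
    ∃ j ∈ J, J ≤ Ideal.span {j, algebraMap R A x} := by
  obtain ⟨j, hj, hJ⟩ := h (J.comap (algebraMap R A))
  refine ⟨algebraMap R A j, hj, ?_⟩
  rw [← IsLocalization.map_under S A J]
  refine (Ideal.map_mono hJ).trans ?_
  rw [Ideal.map_span, Set.image_pair]

/-! ### Quadratic extensions -/

section Quadratic

variable {K M : Type*} [Field K] [Field M] [Algebra K M]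

lemma exists_eq_add_mul (hKM : Module.finrank K M = 2) {s : M} (hs : s ∉ (algebraMap K M).range)
    (x : M) : ∃ p q : K, x = algebraMap K M p + algebraMap K M q * s := by
  have hli : LinearIndependent K ![(1 : M), s] := by
    rw [LinearIndependent.pair_iff' one_ne_zero]
    intro a ha
    exact hs ⟨a, by rw [← ha, Algebra.smul_def, mul_one]⟩
  have h := hli.span_eq_top_of_card_eq_finrank (by simp [hKM])
  have hx : x ∈ Submodule.span K (Set.range ![(1 : M), s]) := h ▸ Submodule.mem_top
  rw [Matrix.range_cons_cons_empty, Submodule.mem_span_pair] at hx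
  obtain ⟨p, q, rfl⟩ := hx
  exact ⟨p, q, by simp [Algebra.smul_def]⟩

lemma add_mul_inj {s : M} (hs : s ∉ (algebraMap K M).range) {p q p' q' : K}
    (h : algebraMap K M p + algebraMap K M q * s = algebraMap K M p' + algebraMap K M q' * s) :
    p = p' ∧ q = q' := by
  have hq : q = q' := by
    by_contra hne
    have hne' : algebraMap K M (q - q') ≠ 0 := by
      rw [Ne, map_eq_zero]; exact sub_ne_zero.2 hne
    refine hs ⟨(p' - p) / (q - q'), ?_⟩
    rw [map_div₀, div_eq_iff hne', map_sub, map_sub]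
    linear_combination -h
  subst hq
  exact ⟨(algebraMap K M).injective (by linear_combination h), rfl⟩

lemma finrank_eq_two_of_adjoin_sqrt_eq_top {d : K} (hd : ¬ IsSquare d) {θ : M}
    (hθ : θ ^ 2 = algebraMap K M d) (htop : IntermediateField.adjoin K {θ} = ⊤) :
    Module.finrank K M = 2 := by
  have hirr : Irreducible (Polynomial.X ^ 2 - Polynomial.C d) :=
    X_pow_sub_C_irreducible_of_prime Nat.prime_two fun b hb => hd ⟨b, by rw [← hb, sq]⟩
  have hmonic : (Polynomial.X ^ 2 - Polynomial.C d).Monic :=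
    Polynomial.monic_X_pow_sub_C d two_ne_zero
  have heval : Polynomial.aeval θ (Polynomial.X ^ 2 - Polynomial.C d) = 0 := by
    simp [hθ]
  rw [← IntermediateField.finrank_top', ← htop,
    IntermediateField.adjoin.finrank ⟨_, hmonic, by simpa [Polynomial.aeval_def] using heval⟩,
    ← minpoly.eq_of_irreducible_of_monic hirr heval hmonic, Polynomial.natDegree_X_pow_sub_C]

lemma norm_add_mul (hKM : Module.finrank K M = 2) {s : M} (hsK : s ∉ (algebraMap K M).range)
    {δ : K} (hs : s ^ 2 = algebraMap K M δ) (p q : K) :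
    Algebra.norm K (algebraMap K M p + algebraMap K M q * s) = p ^ 2 - δ * q ^ 2 := by
  have hli : LinearIndependent K ![(1 : M), s] := by
    rw [LinearIndependent.pair_iff' one_ne_zero]
    intro a ha
    exact hsK ⟨a, by rw [← ha, Algebra.smul_def, mul_one]⟩
  let b : Module.Basis (Fin 2) K M :=
    basisOfLinearIndependentOfCardEqFinrank hli (by simp [hKM])
  have hb0 : b 0 = 1 := by simp [b]
  have hb1 : b 1 = s := by simp [b]
  have hrepr : ∀ p q : K, b.repr (algebraMap K M p + algebraMap K M q * s) =
      Finsupp.single 0 p + Finsupp.single 1 q := fun p q => by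
    rw [← LinearEquiv.eq_symm_apply]
    simp [hb0, hb1, Algebra.smul_def]
  rw [Algebra.norm_eq_matrix_det b, Matrix.det_fin_two]
  have h0 : (algebraMap K M p + algebraMap K M q * s) * b 0 =
      algebraMap K M p + algebraMap K M q * s := by rw [hb0, mul_one]
  have h1 : (algebraMap K M p + algebraMap K M q * s) * b 1 =
      algebraMap K M (δ * q) + algebraMap K M p * s := by
    rw [hb1, map_mul, ← hs]; ring
  simp only [Algebra.leftMulMatrix_eq_repr_mul, h0, h1, hrepr]
  simp
  ring

variable (A : Subring K) (G : Subring K) (m : AddSubgroup K)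

/-- The lattice `A + A s` in a quadratic extension generated by `s`. -/
def quadLattice (s : M) : Set M :=
  {x | ∃ a ∈ A, ∃ b ∈ A, x = algebraMap K M a + algebraMap K M b * s}

/-- The kernel of the map `p + q s ↦ p + q σ` modulo `m` on `G + G s`. When `s ^ 2` is a unit of
the local ring `G` with maximal ideal `m`, and `σ` is a square root of it modulo `m`, this is one
of the two prime ideals of `G + G s` over `m`. -/
def rootIdeal (s : M) (σ : K) : Set M :=
  {x | ∃ p ∈ G, ∃ q ∈ G, x = algebraMap K M p + algebraMap K M q * s ∧ p + q * σ ∈ m}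

lemma rootIdeal_scale {θ s : M} {q₀ a₀ : K} (hq₀ : q₀ ∈ G) (hq₀' : q₀⁻¹ ∈ G) (h0 : q₀ ≠ 0)
    (hs : s = algebraMap K M q₀ * θ) : rootIdeal G m s (q₀ * a₀) = rootIdeal G m θ a₀ := by
  have h0' : algebraMap K M q₀ ≠ 0 := by rwa [Ne, map_eq_zero]
  ext x
  constructor
  · rintro ⟨p, hp, q, hq, rfl, h⟩
    exact ⟨p, hp, q * q₀, G.mul_mem hq hq₀, by rw [hs, map_mul]; ring, by rwa [mul_assoc]⟩
  · rintro ⟨p, hp, q, hq, rfl, h⟩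
    refine ⟨p, hp, q * q₀⁻¹, G.mul_mem hq hq₀', ?_, ?_⟩
    · rw [hs, map_mul, map_inv₀]; field_simp
    · convert h using 2; field_simp

variable {A G m}

lemma mul_mem_quadLattice {s : M} {δ : K} (hs : s ^ 2 = algebraMap K M δ) (hδ : δ ∈ A) {x y : M}
    (hx : x ∈ quadLattice A s) (hy : y ∈ quadLattice A s) : x * y ∈ quadLattice A s := by
  obtain ⟨a, ha, b, hb, rfl⟩ := hx
  obtain ⟨a', ha', b', hb', rfl⟩ := hy
  refine ⟨a * a' + δ * (b * b'), A.add_mem (A.mul_mem ha ha') (A.mul_mem hδ (A.mul_mem hb hb')),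
    a * b' + b * a', A.add_mem (A.mul_mem ha hb') (A.mul_mem hb ha'), ?_⟩
  simp only [map_add, map_mul, ← hs]
  ring

lemma norm_mem_of_mem_quadLattice (hKM : Module.finrank K M = 2) {s : M}
    (hsK : s ∉ (algebraMap K M).range) {δ : K} (hs : s ^ 2 = algebraMap K M δ) (hδ : δ ∈ A) {x : M}
    (hx : x ∈ quadLattice A s) : Algebra.norm K x ∈ A := by
  obtain ⟨a, ha, b, hb, rfl⟩ := hx
  rw [norm_add_mul hKM hsK hs]
  exact A.sub_mem (A.pow_mem ha 2) (A.mul_mem hδ (A.pow_mem hb 2))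

/-- Division in a quadratic extension, by multiplying with the conjugate. -/
lemma add_mul_div_add_mul (hKM : Module.finrank K M = 2) {s : M}
    (hsK : s ∉ (algebraMap K M).range) {δ : K} (hs : s ^ 2 = algebraMap K M δ) (p q p' q' : K)
    (h : algebraMap K M p' + algebraMap K M q' * s ≠ 0) :
    (algebraMap K M p + algebraMap K M q * s) / (algebraMap K M p' + algebraMap K M q' * s) =
      algebraMap K M ((p * p' - δ * (q * q')) /
        Algebra.norm K (algebraMap K M p' + algebraMap K M q' * s)) +
      algebraMap K M ((q * p' - p * q') /
        Algebra.norm K (algebraMap K M p' + algebraMap K M q' * s)) * s := by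
  have : FiniteDimensional K M := Module.finite_of_finrank_eq_succ hKM
  have hN : p' ^ 2 - δ * q' ^ 2 ≠ 0 := by
    rw [← norm_add_mul hKM hsK hs]
    exact Algebra.norm_ne_zero_iff.2 h
  rw [norm_add_mul hKM hsK hs, div_eq_iff h]
  have hN' : algebraMap K M p' ^ 2 - s ^ 2 * algebraMap K M q' ^ 2 ≠ 0 := by
    rw [hs, ← map_pow, ← map_pow, ← map_mul, ← map_sub, Ne, map_eq_zero]; exact hN
  simp only [map_div₀, map_sub, map_mul, map_pow, ← hs]
  field_simp
  ring

lemma div_mem_quadLattice (hKM : Module.finrank K M = 2) {s : M}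
    (hsK : s ∉ (algebraMap K M).range) {δ : K} (hs : s ^ 2 = algebraMap K M δ) (hδ : δ ∈ A)
    {x y : M} (hx : x ∈ quadLattice A s) (hy : y ∈ quadLattice A s) (hy0 : y ≠ 0)
    (hN : (Algebra.norm K y)⁻¹ ∈ A) : x / y ∈ quadLattice A s := by
  obtain ⟨p, hp, q, hq, rfl⟩ := hx
  obtain ⟨p', hp', q', hq', rfl⟩ := hy
  rw [add_mul_div_add_mul hKM hsK hs _ _ _ _ hy0, div_eq_mul_inv, div_eq_mul_inv]
  refine ⟨_, A.mul_mem (A.sub_mem (A.mul_mem hp hp') (A.mul_mem hδ (A.mul_mem hq hq'))) hN,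
    _, A.mul_mem (A.sub_mem (A.mul_mem hq hp') (A.mul_mem hp hq')) hN, rfl⟩

/-- If `x` and `y` lie in the root ideal, then `x` times the conjugate of `y` lies in the product
of the two conjugate root ideals, whose elements have coordinates in `m`. So `x / y` lies in the
lattice if the norm of `y` generates `m ∩ A`. -/
lemma div_mem_quadLattice_of_mem_rootIdeal (hKM : Module.finrank K M = 2) (hAG : A ≤ G)
    (hGm : ∀ a ∈ G, ∀ b ∈ m, a * b ∈ m) {s : M}
    (hsK : s ∉ (algebraMap K M).range) {δ : K} (hs : s ^ 2 = algebraMap K M δ) (hδ : δ ∈ A) {σ : K}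
    (hσ : σ ∈ G) (hδσ : δ - σ ^ 2 ∈ m) {x y : M}
    (hx : x ∈ quadLattice A s) (hxm : x ∈ rootIdeal G m s σ)
    (hy : y ∈ quadLattice A s) (hym : y ∈ rootIdeal G m s σ) (hy0 : y ≠ 0)
    (hN : ∀ a ∈ A, a ∈ m → a / Algebra.norm K y ∈ A) : x / y ∈ quadLattice A s := by
  obtain ⟨p, hp, q, hq, rfl⟩ := hx
  obtain ⟨p', hp', q', hq', rfl⟩ := hy
  obtain ⟨_, _, _, _, h1, hpq⟩ := hxm
  obtain ⟨rfl, rfl⟩ := add_mul_inj hsK h1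
  obtain ⟨_, _, _, _, h1, hpq'⟩ := hym
  obtain ⟨rfl, rfl⟩ := add_mul_inj hsK h1
  rw [add_mul_div_add_mul hKM hsK hs _ _ _ _ hy0]
  refine ⟨_, hN _ (A.sub_mem (A.mul_mem hp hp') (A.mul_mem hδ (A.mul_mem hq hq'))) ?_,
    _, hN _ (A.sub_mem (A.mul_mem hq hp') (A.mul_mem hp hq')) ?_, rfl⟩
  · have h1 := hGm _ (hAG hp') _ hpq
    have h2 := hGm _ (G.mul_mem hσ (hAG hq)) _ hpq'
    have h3 := hGm _ (G.mul_mem (hAG hq) (hAG hq')) _ hδσ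
    convert m.sub_mem (m.sub_mem h1 h2) h3 using 1
    ring
  · convert m.sub_mem (hGm _ (hAG hq) _ hpq') (hGm _ (hAG hq') _ hpq) using 1
    ring

end Quadratic

/-- The local equation of one of the two curves over a curve that splits. The root ideal,
intersected with the ring `A + A s` over the local ring `A`, has a generator by
`exists_cyclic_generator`, since the quotient has no `x`-torsion for `x` not in `m`. Its norm is
an equation `c` of `m ∩ A` up to a unit. -/
lemma exists_mem_rootIdeal_norm_eq {A K M : Type*} [CommRing A] [IsDomain A] [IsLocalRing A]
    [IsNoetherianRing A] [Field K] [Algebra A K] [IsFractionRing A K] [Field M] [Algebra K M]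
    (hKM : Module.finrank K M = 2) (h2 : IsUnit (2 : A)) {G : Subring K} {m : AddSubgroup K}
    (hAG : (algebraMap A K).range ≤ G) (hGm : ∀ a ∈ G, ∀ b ∈ m, a * b ∈ m)
    (hmG : ∀ a ∈ G, a ∉ m → a⁻¹ ∈ G) (h1m : (1 : K) ∉ m)
    {s : M} (hsK : s ∉ (algebraMap K M).range) {δ : A}
    (hs : s ^ 2 = algebraMap K M (algebraMap A K δ)) (hδ : δ ∉ IsLocalRing.maximalIdeal A ^ 2)
    {σ : K} (hσ : σ ∈ G) (hδσ : algebraMap A K δ - σ ^ 2 ∈ m)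
    (hσA : ∃ a b : A, algebraMap A K b ∉ m ∧ σ * algebraMap A K b = algebraMap A K a)
    {c : A} (hc : ∀ a : A, algebraMap A K a ∈ m ↔ c ∣ a) (hc0 : c ≠ 0)
    {x : A} (hx : x ∈ IsLocalRing.maximalIdeal A) (hcx : ¬ c ∣ x)
    (hJ : ∀ J : Ideal A, ∃ j ∈ J, J ≤ Ideal.span {j, x}) :
    ∃ v ∈ quadLattice (algebraMap A K).range s, v ∈ rootIdeal G m s σ ∧
      ∃ t : A, IsUnit t ∧ Algebra.norm K v = algebraMap A K (c * t) := by
  let _ : Algebra A M := ((algebraMap K M).comp (algebraMap A K)).toAlgebra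
  have : IsScalarTower A K M := .of_algebraMap_eq fun _ => rfl
  have : FiniteDimensional K M := Module.finite_of_finrank_eq_succ hKM
  have hAG' : ∀ a : A, algebraMap A K a ∈ G := fun a => hAG ⟨a, rfl⟩
  have hδA : algebraMap A K δ ∈ (algebraMap A K).range := ⟨δ, rfl⟩
  have hlat : ∀ y : M, y ∈ quadLattice (algebraMap A K).range s ↔
      y ∈ Submodule.span A {1, s} := fun y => by
    rw [Submodule.mem_span_pair]
    constructor
    · rintro ⟨_, ⟨a, rfl⟩, _, ⟨b, rfl⟩, rfl⟩
      exact ⟨a, b, by simp [Algebra.smul_def, ← IsScalarTower.algebraMap_apply]⟩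
    · rintro ⟨a, b, rfl⟩
      exact ⟨_, ⟨a, rfl⟩, _, ⟨b, rfl⟩, by simp [Algebra.smul_def, ← IsScalarTower.algebraMap_apply]⟩
  have hsmul : ∀ a ∈ G, ∀ y ∈ rootIdeal G m s σ, algebraMap K M a * y ∈ rootIdeal G m s σ := by
    rintro a ha _ ⟨p, hp, q, hq, rfl, h⟩
    refine ⟨a * p, G.mul_mem ha hp, a * q, G.mul_mem ha hq, by simp only [map_mul]; ring, ?_⟩
    convert hGm a ha _ h using 1
    ring
  let P : Submodule A M :=
    { carrier := {y | y ∈ Submodule.span A {1, s} ∧ y ∈ rootIdeal G m s σ}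
      add_mem' := by
        rintro _ _ ⟨h1, p, hp, q, hq, rfl, h⟩ ⟨h1', p', hp', q', hq', rfl, h'⟩
        refine ⟨add_mem h1 h1', p + p', G.add_mem hp hp', q + q', G.add_mem hq hq', ?_, ?_⟩
        · simp only [map_add]; ring
        · convert m.add_mem h h' using 1; ring
      zero_mem' := ⟨zero_mem _, 0, G.zero_mem, 0, G.zero_mem, by simp, by simp [m.zero_mem]⟩
      smul_mem' := by
        rintro a y ⟨h1, h2⟩
        refine ⟨Submodule.smul_mem _ _ h1, ?_⟩
        rw [Algebra.smul_def, IsScalarTower.algebraMap_apply A K M]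
        exact hsmul _ (hAG' a) _ h2 }
  have hcm : algebraMap A K c ∈ m := (hc c).2 dvd_rfl
  have hsP : ∀ p ∈ P, s * p ∈ P := by
    rintro y ⟨h1, p, hp, q, hq, rfl, h⟩
    refine ⟨?_, q * algebraMap A K δ, G.mul_mem hq (hAG' δ), p, hp, ?_, ?_⟩
    · rw [← hlat] at h1 ⊢
      exact mul_mem_quadLattice hs hδA ⟨0, zero_mem _, 1, one_mem _, by simp⟩ h1
    · rw [map_mul, ← hs]; ring
    · convert m.add_mem (hGm σ hσ _ h) (hGm q hq _ hδσ) using 1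
      ring
  have hxm : algebraMap A K x ∉ m := fun h => hcx ((hc x).1 h)
  obtain ⟨v, hvP, hv⟩ := exists_cyclic_generator hKM h2 hsK (δ := δ) hs hδ hx hJ P
    (fun _ h => h.1) hsP (fun b hb hxb => ⟨hb, by
      have h1 := hsmul _ (hmG _ (hAG' x) hxm) _ hxb.2
      have h0 : algebraMap K M (algebraMap A K x) ≠ 0 := by
        rw [Ne, map_eq_zero]
        intro h
        exact hxm (h ▸ m.zero_mem)
      rw [Algebra.smul_def, IsScalarTower.algebraMap_apply A K M, map_inv₀,
        inv_mul_cancel_left₀ h0] at h1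
      exact h1⟩) hc0
    ⟨by
      rw [← hlat]
      exact ⟨_, ⟨c, rfl⟩, 0, zero_mem _, by simp [← IsScalarTower.algebraMap_apply]⟩,
      _, hAG' c, 0, G.zero_mem, by simp [← IsScalarTower.algebraMap_apply], by simpa using hcm⟩
  have hvL := (hlat v).2 hvP.1
  -- The norm of an element of the root ideal is divisible by `c`.
  obtain ⟨t, ht⟩ : ∃ t : A, Algebra.norm K v = algebraMap A K (c * t) := by
    obtain ⟨n, hn⟩ := norm_mem_of_mem_quadLattice hKM hsK hs hδA hvL
    obtain ⟨p, hp, q, hq, hpq, h⟩ := hvP.2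
    have hnm : algebraMap A K n ∈ m := by
      rw [hn, hpq, norm_add_mul hKM hsK hs]
      convert m.sub_mem (hGm (p - q * σ) (G.sub_mem hp (G.mul_mem hq hσ)) _ h)
        (hGm (q ^ 2) (G.pow_mem hq 2) _ hδσ) using 1
      ring
    obtain ⟨t, rfl⟩ := (hc n).1 hnm
    exact ⟨t, hn.symm⟩
  refine ⟨v, hvL, hvP.2, t, ?_, ht⟩
  -- Write `c = w v` and compare norms.
  have hcv := hv (show algebraMap A M c ∈ P from
    ⟨by
      rw [← hlat]
      exact ⟨_, ⟨c, rfl⟩, 0, zero_mem _, by simp [← IsScalarTower.algebraMap_apply]⟩,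
      _, hAG' c, 0, G.zero_mem, by simp [← IsScalarTower.algebraMap_apply], by simpa using hcm⟩)
  obtain ⟨a, b, hab⟩ := Submodule.mem_span_pair.1 hcv
  set w : M := algebraMap K M (algebraMap A K a) + algebraMap K M (algebraMap A K b) * s with hw
  have hwv : algebraMap K M (algebraMap A K c) = w * v := by
    rw [← IsScalarTower.algebraMap_apply, ← hab, hw]
    simp only [Algebra.smul_def, IsScalarTower.algebraMap_apply A K M]
    ring
  have hwL : w ∈ quadLattice (algebraMap A K).range s := ⟨_, ⟨a, rfl⟩, _, ⟨b, rfl⟩, rfl⟩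
  obtain ⟨n, hn⟩ := norm_mem_of_mem_quadLattice hKM hsK hs hδA hwL
  have hcK : algebraMap A K c ≠ 0 := by rwa [Ne, IsFractionRing.to_map_eq_zero_iff]
  have hctn : c = t * n := by
    have h1 := congr_arg (Algebra.norm K) hwv
    rw [Algebra.norm_algebraMap, hKM, map_mul, ht, ← hn, ← map_pow, ← map_mul] at h1
    have h2 := IsFractionRing.injective A K h1
    exact mul_left_cancel₀ hc0 (by linear_combination h2)
  have hw0 : w ≠ 0 := by
    rintro h
    rw [h, zero_mul, map_eq_zero] at hwv
    exact hcK hwv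
  by_contra htu
  -- Otherwise the norm of `w` is a unit, and the root ideal is contained in `c (A + A s)`.
  have hnu : IsUnit n := by
    have : algebraMap A K t ∈ m ∨ algebraMap A K n ∈ m := by
      by_contra! hcon
      refine h1m ?_
      have h1 := hGm _ (G.mul_mem (hmG _ (hAG' t) hcon.1) (hmG _ (hAG' n) hcon.2)) _ hcm
      rw [hctn, map_mul] at h1
      have h3 : algebraMap A K t ≠ 0 := fun h => hcon.1 (h ▸ m.zero_mem)
      have h4 : algebraMap A K n ≠ 0 := fun h => hcon.2 (h ▸ m.zero_mem)
      field_simp at h1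
      exact h1
    obtain h | h := this
    · obtain ⟨t', rfl⟩ := (hc t).1 h
      refine IsUnit.of_mul_eq_one t' (mul_left_cancel₀ hc0 ?_)
      linear_combination -hctn
    · obtain ⟨n', rfl⟩ := (hc n).1 h
      refine absurd (IsUnit.of_mul_eq_one n' (mul_left_cancel₀ hc0 ?_)) htu
      linear_combination -hctn
  obtain ⟨a₁, b₁, hb₁, hab₁⟩ := hσA
  have hyP :
      algebraMap K M (algebraMap A K (-a₁)) + algebraMap K M (algebraMap A K b₁) * s ∈ P := by
    refine ⟨?_, _, hAG' _, _, hAG' _, rfl, ?_⟩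
    · rw [← hlat]
      exact ⟨_, ⟨_, rfl⟩, _, ⟨_, rfl⟩, rfl⟩
    · convert m.zero_mem using 1
      rw [map_neg]
      linear_combination hab₁
  obtain ⟨a₂, b₂, hab₂⟩ := Submodule.mem_span_pair.1 (hv hyP)
  have h5 : algebraMap K M (algebraMap A K a₂) + algebraMap K M (algebraMap A K b₂) * s ∈
    quadLattice (algebraMap A K).range s := ⟨_, ⟨_, rfl⟩, _, ⟨_, rfl⟩, rfl⟩
  have h6 := div_mem_quadLattice hKM hsK hs hδA h5 hwL hw0 (by
    obtain ⟨i, hi⟩ := hnu.exists_left_inv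
    refine ⟨i, eq_inv_of_mul_eq_one_left ?_⟩
    rw [← hn, ← map_mul, hi, map_one])
  obtain ⟨_, ⟨a₃, rfl⟩, _, ⟨b₃, rfl⟩, h7⟩ := h6
  rw [div_eq_iff hw0] at h7
  have h8 : algebraMap K M (algebraMap A K (-a₁)) + algebraMap K M (algebraMap A K b₁) * s =
      algebraMap K M (algebraMap A K (c * a₃)) + algebraMap K M (algebraMap A K (c * b₃)) * s := by
    rw [← hab₂]
    simp only [Algebra.smul_def, IsScalarTower.algebraMap_apply A K M, map_mul]
    linear_combination v * h7 - (algebraMap K M (algebraMap A K a₃) +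
      algebraMap K M (algebraMap A K b₃) * s) * hwv
  have h9 := (add_mul_inj hsK h8).2
  exact hb₁ ((hc _).2 ⟨b₃, IsFractionRing.injective A K h9⟩)

/-! ### Regular rational functions -/

section Regular

open Topology

variable {X : Scheme.{u}} [IsIntegral X]

lemma genericPoint_mem {U : X.Opens} {x : X} (hx : x ∈ U) : genericPoint X ∈ U :=
  (genericPoint_specializes x).mem_open U.isOpen hx

/-- The rational function defined by a section over a nonempty open set. -/
noncomputable def sectionToFunctionField (U : X.Opens) (hU : genericPoint X ∈ U) :
    Γ(X, U) →+* X.functionField :=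
  (X.presheaf.germ U (genericPoint X) hU).hom

lemma sectionToFunctionField_injective (U : X.Opens) (hU : genericPoint X ∈ U) :
    Function.Injective (sectionToFunctionField U hU) :=
  germ_injective_of_isIntegral X _ hU

lemma sectionToFunctionField_res {U V : X.Opens} (h : V ≤ U) (hV : genericPoint X ∈ V)
    (a : Γ(X, U)) : sectionToFunctionField V hV (X.presheaf.map (homOfLE h).op a) =
      sectionToFunctionField U (h hV) a :=
  TopCat.Presheaf.germ_res_apply X.presheaf (homOfLE h) _ hV a

lemma algebraMap_germ {U : X.Opens} {x : X} (hx : x ∈ U) (a : Γ(X, U)) :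
    algebraMap (X.presheaf.stalk x) X.functionField (X.presheaf.germ U x hx a) =
      sectionToFunctionField U (genericPoint_mem hx) a :=
  TopCat.Presheaf.germ_stalkSpecializes_apply X.presheaf hx _ a

/-- The rational functions that are regular at `x`: the local ring at `x`, as a subring of the
function field. -/
noncomputable def regularAt (x : X) : Subring X.functionField :=
  (algebraMap (X.presheaf.stalk x) X.functionField).range

/-- The rational functions that are regular at `x` and vanish there. -/
noncomputable def vanishingAt (x : X) : AddSubgroup X.functionField :=
  (IsLocalRing.maximalIdeal (X.presheaf.stalk x)).toAddSubgroup.map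
    (algebraMap (X.presheaf.stalk x) X.functionField).toAddMonoidHom

lemma algebraMap_stalk_injective (x : X) :
    Function.Injective (algebraMap (X.presheaf.stalk x) X.functionField) :=
  IsFractionRing.injective _ _

lemma algebraMap_mem_vanishingAt_iff {x : X} {a : X.presheaf.stalk x} :
    algebraMap (X.presheaf.stalk x) X.functionField a ∈ vanishingAt x ↔
      a ∈ IsLocalRing.maximalIdeal (X.presheaf.stalk x) := by
  constructor
  · rintro ⟨b, hb, h⟩
    rwa [← algebraMap_stalk_injective x h]
  · exact fun h => ⟨a, h, rfl⟩

lemma mul_mem_vanishingAt {x : X} {f g : X.functionField} (hf : f ∈ regularAt x)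
    (hg : g ∈ vanishingAt x) : f * g ∈ vanishingAt x := by
  obtain ⟨a, rfl⟩ := hf
  obtain ⟨b, hb, rfl⟩ := hg
  exact ⟨a * b, Ideal.mul_mem_left _ a hb,
    map_mul (algebraMap (X.presheaf.stalk x) X.functionField) a b⟩

lemma inv_mem_regularAt_of_isUnit {x : X} {a : X.presheaf.stalk x} (ha : IsUnit a) :
    (algebraMap (X.presheaf.stalk x) X.functionField a)⁻¹ ∈ regularAt x := by
  obtain ⟨i, hi⟩ := ha.exists_left_inv
  exact ⟨i, eq_inv_of_mul_eq_one_left (by rw [← map_mul, hi, map_one])⟩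

lemma inv_mem_regularAt {x : X} {f : X.functionField} (hf : f ∈ regularAt x)
    (hf' : f ∉ vanishingAt x) : f⁻¹ ∈ regularAt x := by
  obtain ⟨a, rfl⟩ := hf
  rw [algebraMap_mem_vanishingAt_iff] at hf'
  exact inv_mem_regularAt_of_isUnit (not_not.1 hf')

lemma one_notMem_vanishingAt (x : X) : (1 : X.functionField) ∉ vanishingAt x := by
  rw [← map_one (algebraMap (X.presheaf.stalk x) X.functionField), algebraMap_mem_vanishingAt_iff]
  exact (Ideal.ne_top_iff_one _).1 (IsLocalRing.maximalIdeal.isMaximal _).ne_top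

lemma notMem_vanishingAt_of_inv_mem {x : X} {f : X.functionField} (h0 : f ≠ 0)
    (hf : f⁻¹ ∈ regularAt x) : f ∉ vanishingAt x := fun h => by
  have := mul_mem_vanishingAt hf h
  rw [inv_mul_cancel₀ h0] at this
  exact one_notMem_vanishingAt x this

lemma isUnit_of_inv_mem_regularAt {x : X} {a : X.presheaf.stalk x} (h0 : a ≠ 0)
    (h : (algebraMap (X.presheaf.stalk x) X.functionField a)⁻¹ ∈ regularAt x) : IsUnit a := by
  by_contra hu
  exact notMem_vanishingAt_of_inv_mem
    (fun h => h0 (algebraMap_stalk_injective x (by rw [h, map_zero]))) h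
    (algebraMap_mem_vanishingAt_iff.2 hu)

lemma section_mem_regularAt {U : X.Opens} {x : X} (hx : x ∈ U) (a : Γ(X, U)) :
    sectionToFunctionField U (genericPoint_mem hx) a ∈ regularAt x :=
  ⟨_, algebraMap_germ hx a⟩

lemma exists_section_of_mem_regularAt {x : X} {f : X.functionField} (hf : f ∈ regularAt x) :
    ∃ (U : X.Opens) (hx : x ∈ U) (a : Γ(X, U)),
      sectionToFunctionField U (genericPoint_mem hx) a = f := by
  obtain ⟨b, rfl⟩ := hf
  obtain ⟨U, hx, a, rfl⟩ := X.presheaf.exists_germ_eq b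
  exact ⟨U, hx, a, (algebraMap_germ hx a).symm⟩

lemma regularAt_eventually {x : X} {f : X.functionField} (hf : f ∈ regularAt x) :
    ∀ᶠ z in 𝓝 x, f ∈ regularAt z := by
  obtain ⟨U, hx, a, rfl⟩ := exists_section_of_mem_regularAt hf
  exact Filter.eventually_of_mem (U.isOpen.mem_nhds hx) fun z hz => section_mem_regularAt hz a

lemma regularAt_le_of_specializes {x y : X} (h : x ⤳ y) : regularAt y ≤ regularAt x :=
  fun _ hf => (regularAt_eventually hf).filter_mono h.nhds_le_nhds |>.self_of_nhds

/-- A rational function that is regular at every point of an open set is a section. -/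
lemma exists_section_of_forall_mem_regularAt (U : X.Opens) (hU : genericPoint X ∈ U)
    {f : X.functionField} (hf : ∀ x ∈ U, f ∈ regularAt x) :
    ∃ a : Γ(X, U), sectionToFunctionField U hU a = f := by
  have h1 : ∀ x : U, ∃ (V : X.Opens) (hx : x.1 ∈ V) (_ : V ≤ U) (a : Γ(X, V)),
      sectionToFunctionField V (genericPoint_mem hx) a = f := fun x => by
    obtain ⟨V, hx, a, ha⟩ := exists_section_of_mem_regularAt (hf x x.2)
    refine ⟨V ⊓ U, ⟨hx, x.2⟩, inf_le_right, X.presheaf.map (homOfLE inf_le_left).op a, ?_⟩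
    rw [sectionToFunctionField_res, ha]
  choose V hxV hVU a ha using h1
  obtain ⟨b, hb, -⟩ := X.sheaf.existsUnique_gluing' V U (fun x => homOfLE (hVU x))
    (fun x hx => Opens.mem_iSup.2 ⟨⟨x, hx⟩, hxV ⟨x, hx⟩⟩) a (by
      intro x y
      have hW : genericPoint X ∈ V x ⊓ V y := ⟨genericPoint_mem (hxV x), genericPoint_mem (hxV y)⟩
      refine sectionToFunctionField_injective (V x ⊓ V y) hW ?_
      exact ((sectionToFunctionField_res inf_le_left hW (a x)).trans (ha x)).trans
        ((sectionToFunctionField_res inf_le_right hW (a y)).trans (ha y)).symm)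
  refine ⟨b, ?_⟩
  rw [← ha ⟨_, hU⟩, ← hb ⟨_, hU⟩]
  exact (sectionToFunctionField_res (hVU ⟨_, hU⟩) _ b).symm

lemma exists_isUnit_section (U : X.Opens) (hU : genericPoint X ∈ U) {f : X.functionField}
    (h0 : f ≠ 0) (hf : ∀ x ∈ U, f ∈ regularAt x ∧ f⁻¹ ∈ regularAt x) :
    ∃ a : Γ(X, U)ˣ, sectionToFunctionField U hU a = f := by
  obtain ⟨a, ha⟩ := exists_section_of_forall_mem_regularAt U hU fun x hx => (hf x hx).1
  obtain ⟨b, hb⟩ := exists_section_of_forall_mem_regularAt U hU fun x hx => (hf x hx).2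
  have hab : a * b = 1 := sectionToFunctionField_injective U hU (by
    rw [map_mul, ha, hb, map_one, mul_inv_cancel₀ h0])
  exact ⟨⟨a, b, hab, by rw [mul_comm, hab]⟩, ha⟩

lemma unit_section_mem_regularAt {U : X.Opens} {x : X} (hx : x ∈ U) (a : Γ(X, U)ˣ) :
    (sectionToFunctionField U (genericPoint_mem hx) a)⁻¹ ∈ regularAt x := by
  rw [← algebraMap_germ hx]
  exact inv_mem_regularAt_of_isUnit (a.isUnit.map (X.presheaf.germ U x hx).hom)

lemma section_unit_ne_zero {U : X.Opens} (hU : genericPoint X ∈ U) (a : Γ(X, U)ˣ) :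
    sectionToFunctionField U hU a ≠ 0 :=
  (a.isUnit.map (sectionToFunctionField U hU)).ne_zero

end Regular

/-! ### Regular functions along the fibres of a morphism -/

section RegularOver

open Topology

variable {S X : Scheme.{u}} [IsIntegral S] (r : S ⟶ X)

/-- The rational functions on `S` that are regular at all points of the fibre over `y`. If `r` is
finite, this is the semilocal ring of the fibre. -/
noncomputable def regularOver (y : X) : Subring S.functionField :=
  ⨅ s : r ⁻¹' {y}, regularAt s.1

lemma mem_regularOver {y : X} {f : S.functionField} :
    f ∈ regularOver r y ↔ ∀ s, r s = y → f ∈ regularAt s := by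
  simp [regularOver, Subring.mem_iInf]

lemma regularOver_eventually [IsFinite r] {y : X} {f : S.functionField}
    (hf : f ∈ regularOver r y) : ∀ᶠ z in 𝓝 y, f ∈ regularOver r z := by
  have := r.isClosedMap.eventually_nhds_fiber (p := fun s => f ∈ regularAt s) y fun s hs =>
    regularAt_eventually ((mem_regularOver r).1 hf s hs)
  exact this.mono fun z hz => (mem_regularOver r).2 fun s hs => hz s hs

variable [IsIntegral X] [Flat r]

lemma functionFieldMap_section {U : X.Opens} (hU : genericPoint X ∈ U)
    {V : S.Opens} (hV : genericPoint S ∈ V) (h : V ≤ r ⁻¹ᵁ U) (a : Γ(X, U)) :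
    functionFieldMap r (sectionToFunctionField U hU a) =
      sectionToFunctionField V hV (r.appLE U V h a) := by
  have h1 : r (genericPoint S) ∈ U := h hV
  have h2 := TopCat.Presheaf.germ_stalkSpecializes_apply X.presheaf hU
    (specializes_of_eq (map_genericPoint_of_flat r)) a
  have h3 := r.germ_stalkMap_apply U (genericPoint S) h1 a
  have h4 : sectionToFunctionField V hV (r.appLE U V h a) =
      S.presheaf.germ (r ⁻¹ᵁ U) (genericPoint S) h1 (r.app U a) :=
    sectionToFunctionField_res h hV (r.app U a)
  rw [h4, ← h3, ← h2]
  rfl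

lemma functionFieldMap_mem_regularAt {s : S} {f : X.functionField} (hf : f ∈ regularAt (r s)) :
    functionFieldMap r f ∈ regularAt s := by
  obtain ⟨U, hx, a, rfl⟩ := exists_section_of_mem_regularAt hf
  have hs : s ∈ r ⁻¹ᵁ U := hx
  rw [functionFieldMap_section r _ (genericPoint_mem hs) le_rfl]
  exact section_mem_regularAt hs _

lemma functionFieldMap_mem_regularOver {y : X} {f : X.functionField} (hf : f ∈ regularAt y) :
    functionFieldMap r f ∈ regularOver r y :=
  (mem_regularOver r).2 fun s hs => functionFieldMap_mem_regularAt r (by rwa [hs])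

end RegularOver

/-! ### Line bundles and rational functions -/

namespace LineBundle

variable {S X : Scheme.{u}} [IsIntegral S] [IsIntegral X]

/-- The transition functions of a line bundle on an integral scheme, as rational functions. -/
noncomputable def transition (N : LineBundle X) (x y : X) : X.functionField :=
  sectionToFunctionField (N.U x ⊓ N.U y)
    ⟨genericPoint_mem (N.mem x), genericPoint_mem (N.mem y)⟩ (N.g x y)

lemma transition_ne_zero (N : LineBundle X) (x y : X) : N.transition x y ≠ 0 :=
  section_unit_ne_zero _ _

lemma section_gOn (N : LineBundle X) (x y : X) (W : X.Opens) (hx : W ≤ N.U x) (hy : W ≤ N.U y)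
    (hW : genericPoint X ∈ W) :
    sectionToFunctionField W hW (N.gOn x y W hx hy) = N.transition x y :=
  sectionToFunctionField_res (le_inf hx hy) hW _

lemma transition_mul (N : LineBundle X) (x y z : X) :
    N.transition x y * N.transition y z = N.transition x z := by
  have hW : genericPoint X ∈ N.U x ⊓ N.U y ⊓ N.U z :=
    ⟨⟨genericPoint_mem (N.mem x), genericPoint_mem (N.mem y)⟩, genericPoint_mem (N.mem z)⟩
  have hx : N.U x ⊓ N.U y ⊓ N.U z ≤ N.U x := inf_le_left.trans inf_le_left
  have hy : N.U x ⊓ N.U y ⊓ N.U z ≤ N.U y := inf_le_left.trans inf_le_right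
  have hz : N.U x ⊓ N.U y ⊓ N.U z ≤ N.U z := inf_le_right
  rw [← section_gOn N x y _ hx hy hW, ← section_gOn N y z _ hy hz hW,
    ← section_gOn N x z _ hx hz hW, ← map_mul, ← Units.val_mul, gOn_mul_gOn]

lemma transition_pullback (r : S ⟶ X) [Flat r] (N : LineBundle X) (s t : S) :
    (N.pullback r).transition s t = functionFieldMap r (N.transition (r s) (r t)) := by
  have hs : s ∈ r ⁻¹ᵁ N.U (r s) := N.mem (r s)
  have ht : t ∈ r ⁻¹ᵁ N.U (r t) := N.mem (r t)
  exact (functionFieldMap_section r _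
    (V := r ⁻¹ᵁ N.U (r s) ⊓ r ⁻¹ᵁ N.U (r t)) ⟨genericPoint_mem hs, genericPoint_mem ht⟩
    (le_preimage_inf r inf_le_left inf_le_right) _).symm

/-- The line bundle of a Cartier divisor: the divisor has the equation `v x` on `U x`. -/
lemma exists_transition_eq (U : X → X.Opens) (mem : ∀ x, x ∈ U x) (v : X → X.functionField)
    (hv : ∀ x, v x ≠ 0) (h : ∀ x y, ∀ z ∈ U x ⊓ U y, v x / v y ∈ regularAt z) :
    ∃ N : LineBundle X, ∀ x y, N.transition x y = v x / v y := by
  have h1 : ∀ x y, ∃ a : Γ(X, U x ⊓ U y)ˣ, sectionToFunctionField (U x ⊓ U y)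
      ⟨genericPoint_mem (mem x), genericPoint_mem (mem y)⟩ a = v x / v y := fun x y =>
    exists_isUnit_section _ _ (div_ne_zero (hv x) (hv y)) fun z hz =>
      ⟨h x y z hz, by rw [inv_div]; exact h y x z ⟨hz.2, hz.1⟩⟩
  choose g hg using h1
  refine ⟨⟨U, mem, g, fun x y z W hx hy hz => ?_⟩, hg⟩
  have hres : ∀ (x y : X) (hx : W ≤ U x) (hy : W ≤ U y) (hW : genericPoint X ∈ W),
      sectionToFunctionField W hW (resUnits X (le_inf hx hy) (g x y)) = v x / v y :=
    fun x y hx hy hW => (sectionToFunctionField_res (le_inf hx hy) hW _).trans (hg x y)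
  by_cases hW : genericPoint X ∈ W
  · refine Units.ext (sectionToFunctionField_injective W hW ?_)
    rw [Units.val_mul, map_mul, hres x y hx hy, hres y z hy hz, hres x z hx hz,
      div_mul_div_cancel₀ (hv y)]
  · have : W = ⊥ := by
      by_contra hne
      obtain ⟨w, hw⟩ := (Opens.ne_bot_iff_nonempty W).1 hne
      exact hW (genericPoint_mem hw)
    subst this
    have : Subsingleton Γ(X, ⊥) := inferInstance
    exact Units.ext (Subsingleton.elim _ _)

lemma Isomorphic.exists_transition {M N : LineBundle X} (h : M.Isomorphic N) :
    ∃ a : X → X.functionField, (∀ x, a x ≠ 0) ∧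
      (∀ x, a x ∈ regularAt x ∧ (a x)⁻¹ ∈ regularAt x) ∧
      ∀ x y, M.transition x y * a y = a x * N.transition x y := by
  obtain ⟨V, hV, hM, hN, a, h⟩ := h
  refine ⟨fun x => sectionToFunctionField (V x) (genericPoint_mem (hV x)) (a x),
    fun x => section_unit_ne_zero _ _,
    fun x => ⟨section_mem_regularAt (hV x) _, unit_section_mem_regularAt (hV x) _⟩,
    fun x y => ?_⟩
  have hW : genericPoint X ∈ V x ⊓ V y := ⟨genericPoint_mem (hV x), genericPoint_mem (hV y)⟩
  have h1 := congr_arg (fun b => sectionToFunctionField _ hW (Units.val b))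
    (h x y (V x ⊓ V y) inf_le_left inf_le_right)
  simp only [Units.val_mul, map_mul, section_gOn] at h1
  have hres : ∀ (z : X) (hz : V x ⊓ V y ≤ V z), sectionToFunctionField _ hW
      (resUnits X hz (a z)).val =
        sectionToFunctionField (V z) (genericPoint_mem (hV z)) (a z) := fun z hz =>
    sectionToFunctionField_res hz hW _
  rwa [hres, hres] at h1

end LineBundle

open Topology in
/-- If `r^*` is surjective on Picard groups, a Cartier divisor on `S` with equations near the
fibres of `r` is, up to a principal divisor, the pullback of a Cartier divisor. -/
lemma exists_div_mem_regularOver {S X : Scheme.{u}} [IsIntegral S] [IsIntegral X] (r : S ⟶ X)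
    [Flat r] (hPic : Function.Surjective (Pic.pullback r))
    (v : X → S.functionField) (hv : ∀ y, v y ≠ 0) (W : X → X.Opens) (hW : ∀ y, y ∈ W y)
    (h : ∀ x y, ∀ z ∈ W x ⊓ W y, v x / v y ∈ regularOver r z) :
    ∃ (q : X → X.functionField) (w : S.functionField), (∀ y, q y ≠ 0) ∧ w ≠ 0 ∧
      (∀ y, ∀ᶠ z in 𝓝 y, q y / q z ∈ regularAt z ∧ q z / q y ∈ regularAt z) ∧
      ∀ y, v y / (w * functionFieldMap r (q y)) ∈ regularOver r y ∧
        (w * functionFieldMap r (q y)) / v y ∈ regularOver r y := by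
  obtain ⟨M, hM⟩ := LineBundle.exists_transition_eq (fun s : S => r ⁻¹ᵁ W (r s))
    (fun s => hW (r s)) (fun s => v (r s)) (fun s => hv (r s)) (fun s t z hz =>
      (mem_regularOver r).1 (h (r s) (r t) (r z) hz) z rfl)
  obtain ⟨⟨N⟩, hN⟩ := hPic (Quotient.mk _ M)
  obtain ⟨a, ha0, ha, hMN⟩ := LineBundle.Isomorphic.exists_transition
    (show M.Isomorphic (N.pullback r) from Quotient.exact hN.symm)
  simp only [hM, LineBundle.transition_pullback] at hMN
  let s₀ : S := genericPoint S
  let q : X → X.functionField := fun y => N.transition y (r s₀)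
  have hq : ∀ y, q y ≠ 0 := fun y => N.transition_ne_zero _ _
  have hφq : ∀ y, functionFieldMap r (q y) ≠ 0 := fun y => by
    rw [Ne, map_eq_zero]; exact hq y
  let w : S.functionField := v (r s₀) / a s₀
  have hw : w ≠ 0 := div_ne_zero (hv _) (ha0 _)
  have key : ∀ s, v (r s) / (w * functionFieldMap r (q (r s))) = a s := fun s => by
    rw [div_eq_iff (mul_ne_zero hw (hφq _))]
    have h1 := hMN s s₀
    have h2 := hv (r s₀)
    have h3 := ha0 s₀
    simp only [w, q]
    field_simp at h1 ⊢
    linear_combination h1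
  refine ⟨q, w, hq, hw, fun y => ?_, fun y => ⟨?_, ?_⟩⟩
  · refine Filter.eventually_of_mem ((N.U y).isOpen.mem_nhds (N.mem y)) fun z hz => ?_
    have h1 : q y / q z = N.transition y z := by
      rw [div_eq_iff (hq z)]; exact (N.transition_mul _ _ _).symm
    have hz' : z ∈ N.U y ⊓ N.U z := ⟨hz, N.mem z⟩
    refine ⟨h1 ▸ section_mem_regularAt hz' _, ?_⟩
    rw [← inv_div, h1]
    exact unit_section_mem_regularAt hz' _
  · rw [mem_regularOver]
    rintro s rfl
    rw [key]
    exact (ha s).1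
  · rw [mem_regularOver]
    rintro s rfl
    rw [← inv_div, key]
    exact (ha s).2

/-! ### Finite flat covers of degree two -/

/-- A local algebra that is free of rank at most two as a module is generated by `1` and another
element as a module: since `1` is not in the maximal ideal times the algebra, it is part of a
basis. -/
lemma exists_eq_smul_one_add_smul {A T ι : Type*} [CommRing A] [IsLocalRing A] [CommRing T]
    [Algebra A T] [Nontrivial T] [Fintype ι] (e : Module.Basis ι A T) (hι : Fintype.card ι ≤ 2) :
    ∃ t : T, ∀ x, ∃ α β : A, x = α • 1 + β • t := by
  obtain ⟨i₀, hi₀⟩ : ∃ i, IsUnit (e.repr 1 i) := by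
    by_contra! hcon
    obtain ⟨j⟩ := e.index_nonempty
    have h1 : (1 : A) = ∑ i, e.repr 1 i * e.repr (e i * e j) j := by
      have h2 : e j = ∑ i, e.repr 1 i • (e i * e j) := by
        conv_lhs => rw [← one_mul (e j), ← e.sum_repr 1]
        rw [Finset.sum_mul]
        exact Finset.sum_congr rfl fun i _ => smul_mul_assoc _ _ _
      have h3 := congr_arg (fun x => e.repr x j) h2
      simpa using h3
    have h2 : (1 : A) ∈ IsLocalRing.maximalIdeal A := by
      rw [h1]
      exact Ideal.sum_mem _ fun i _ => Ideal.mul_mem_right _ _ (hcon i)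
    exact h2 isUnit_one
  classical
  obtain ⟨u, hu⟩ := hi₀.exists_left_inv
  have hu' : algebraMap A T u * algebraMap A T (e.repr 1 i₀) = 1 := by
    rw [← map_mul, hu, map_one]
  by_cases hj : ∃ j, j ≠ i₀
  · obtain ⟨j, hj⟩ := hj
    have huniv : (Finset.univ : Finset ι) = {i₀, j} := by
      symm
      apply Finset.eq_univ_of_card
      have h1 := Finset.card_le_univ {i₀, j}
      have h2 := Finset.card_pair hj.symm
      omega
    refine ⟨e j, fun x => ⟨e.repr x i₀ * u, e.repr x j - e.repr x i₀ * u * e.repr 1 j, ?_⟩⟩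
    have hx := e.sum_repr x
    have h1 := e.sum_repr 1
    rw [huniv, Finset.sum_pair hj.symm] at hx h1
    simp only [Algebra.smul_def, map_mul, map_sub, mul_one] at hx h1 ⊢
    linear_combination -hx + algebraMap A T (e.repr x i₀) * algebraMap A T u * h1 -
      algebraMap A T (e.repr x i₀) * e i₀ * hu'
  · push Not at hj
    have huniv : (Finset.univ : Finset ι) = {i₀} := by
      ext i
      simp [hj i]
    refine ⟨0, fun x => ⟨e.repr x i₀ * u, 0, ?_⟩⟩
    have hx := e.sum_repr x
    have h1 := e.sum_repr 1
    rw [huniv, Finset.sum_singleton] at hx h1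
    simp only [Algebra.smul_def, map_mul, mul_one, mul_zero, add_zero] at hx h1 ⊢
    linear_combination -hx + algebraMap A T (e.repr x i₀) * algebraMap A T u * h1 -
      algebraMap A T (e.repr x i₀) * e i₀ * hu'

open TensorProduct in
/-- A finite flat extension of domains of degree two is generated by `1` and another element as a
module, locally on the base: the localization at a prime is free, of rank at most the degree. -/
lemma exists_generator_away {R B K M : Type*} [CommRing R] [IsDomain R] [CommRing B]
    [IsDomain B] [Algebra R B] [Module.Finite R B] [Module.Flat R B] [Field K] [Field M]
    [Algebra R K] [IsFractionRing R K] [Algebra B M] [FaithfulSMul B M] [Algebra K M]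
    [Algebra R M] [IsScalarTower R K M] [IsScalarTower R B M]
    (hKM : Module.finrank K M = 2) (p : Ideal R) [p.IsPrime] (A : Type*) [CommRing A]
    [Algebra R A] [IsLocalization.AtPrime A p] :
    ∃ g ∉ p, ∃ t : B, ∀ b : B, ∃ a a' : R,
      algebraMap R B g * b = algebraMap R B a + algebraMap R B a' * t := by
  have : Module.Finite K M := Module.finite_of_finrank_eq_succ hKM
  have hBM : Function.Injective (algebraMap B M) := FaithfulSMul.algebraMap_injective B M
  have hRB : Function.Injective (algebraMap R B) := by
    have h1 : Function.Injective (algebraMap R M) := by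
      rw [IsScalarTower.algebraMap_eq R K M]
      exact (algebraMap K M).injective.comp (IsFractionRing.injective R K)
    rw [IsScalarTower.algebraMap_eq R B M] at h1
    exact Function.Injective.of_comp h1
  have : IsLocalRing A := IsLocalization.AtPrime.isLocalRing A p
  let f : B →ₗ[R] A ⊗[R] B := TensorProduct.mk R A B 1
  have hf : IsLocalizedModule p.primeCompl f :=
    (isLocalizedModule_iff_isBaseChange p.primeCompl A f).2 (TensorProduct.isBaseChange R B A)
  have hp0 : ∀ g ∉ p, g ≠ 0 := fun g hg h => hg (h ▸ p.zero_mem)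
  have hfinj : Function.Injective f := fun x y hxy => by
    obtain ⟨c, hc⟩ := (IsLocalizedModule.eq_iff_exists p.primeCompl f).1 hxy
    have hc' : (c : R) • x = (c : R) • y := hc
    rw [Algebra.smul_def, Algebra.smul_def] at hc'
    exact mul_left_cancel₀ (by
      rw [Ne, map_eq_zero_iff _ hRB]; exact hp0 _ c.2) hc'
  have hRA : Function.Injective (algebraMap R A) :=
    IsLocalization.injective A p.primeCompl_le_nonZeroDivisors
  have : Module.Free A (A ⊗[R] B) := Module.free_of_flat_of_isLocalRing
  let e := Module.Free.chooseBasis A (A ⊗[R] B)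
  have hunit : ∀ g ∉ p, IsUnit (algebraMap R A g) := fun g hg =>
    IsLocalization.map_units A (⟨g, hg⟩ : p.primeCompl)
  have hsurj : ∀ x : A ⊗[R] B, ∃ g ∉ p, ∃ b : B, algebraMap R A g • x = f b := fun x => by
    obtain ⟨⟨b, g⟩, h⟩ := IsLocalizedModule.surj p.primeCompl f x
    exact ⟨g, g.2, b, by rw [algebraMap_smul]; exact h⟩
  have hcard : Fintype.card (Module.Free.ChooseBasisIndex A (A ⊗[R] B)) ≤ 2 := by
    choose g hg b hgb using fun i => hsurj (e i)
    have h1 : LinearIndependent R b := by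
      refine LinearIndependent.of_comp f ?_
      have h2 := (e.linearIndependent.units_smul fun i => (hunit _ (hg i)).unit).restrict_scalars
        (R := R) (by
          intro x y hxy
          simp only [Algebra.smul_def, mul_one] at hxy
          exact hRA hxy)
      convert h2 using 1
      ext i
      exact (hgb i).symm
    have h2 : LinearIndependent R (fun i => algebraMap B M (b i)) :=
      h1.map' (IsScalarTower.toAlgHom R B M).toLinearMap (LinearMap.ker_eq_bot.2 hBM)
    rw [LinearIndependent.iff_fractionRing R K] at h2
    rw [← hKM]
    exact h2.fintype_card_le_finrank
  have hne : Nontrivial (A ⊗[R] B) := hfinj.nontrivial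
  obtain ⟨t', ht'⟩ := exists_eq_smul_one_add_smul e hcard
  obtain ⟨g₀, hg₀, t, ht⟩ := hsurj t'
  have hloc : ∀ b : B, ∃ g ∉ p, ∃ a a' : R,
      algebraMap R B g * b = algebraMap R B a + algebraMap R B a' * t := fun b => by
    obtain ⟨α, β, hαβ⟩ := ht' (f b)
    obtain ⟨u, hu⟩ := (hunit g₀ hg₀).exists_left_inv
    obtain ⟨a₁, s₁, h1⟩ := IsLocalization.exists_mk'_eq p.primeCompl α
    obtain ⟨a₂, s₂, h2⟩ := IsLocalization.exists_mk'_eq p.primeCompl (β * u)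
    have h1' : algebraMap R A s₁ * α = algebraMap R A a₁ := by
      rw [← h1, mul_comm, IsLocalization.mk'_spec]
    have h2' : algebraMap R A s₂ * (β * u) = algebraMap R A a₂ := by
      rw [← h2, mul_comm, IsLocalization.mk'_spec]
    refine ⟨s₁ * s₂, (s₁ * s₂).2, s₂ * a₁, s₁ * a₂, hfinj ?_⟩
    have h3 : f 1 = 1 := rfl
    rw [← Algebra.smul_def, ← Algebra.smul_def, Algebra.algebraMap_eq_smul_one, map_add,
      map_smul, map_smul, map_smul, hαβ, h3, ← ht]
    simp only [← algebraMap_smul A (_ : R) (_ : A ⊗[R] B), Algebra.smul_def, map_mul, mul_one]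
    have e1 := congr_arg (algebraMap A (A ⊗[R] B)) h1'
    have e2 := congr_arg (algebraMap A (A ⊗[R] B)) h2'
    have e3 := congr_arg (algebraMap A (A ⊗[R] B)) hu
    simp only [map_mul, map_one] at e1 e2 e3
    linear_combination algebraMap A (A ⊗[R] B) (algebraMap R A s₂) * e1 +
      algebraMap A (A ⊗[R] B) (algebraMap R A s₁) * algebraMap A (A ⊗[R] B) (algebraMap R A g₀) *
        t' * e2 - algebraMap A (A ⊗[R] B) (algebraMap R A s₁) *
        algebraMap A (A ⊗[R] B) (algebraMap R A s₂) * algebraMap A (A ⊗[R] B) β * t' * e3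
  choose g hg a a' hgb using hloc
  obtain ⟨s, hs⟩ := Module.Finite.fg_top (R := R) (M := B)
  refine ⟨∏ b ∈ s, g b, Submonoid.prod_mem p.primeCompl fun b _ => hg b, t, fun b => ?_⟩
  have h1 : ⊤ ≤ (Submodule.span R {1, t}).comap (LinearMap.lsmul R B (∏ b ∈ s, g b)) := by
    rw [← hs, Submodule.span_le]
    intro c hc
    obtain ⟨g', hg'⟩ := Finset.dvd_prod_of_mem g hc
    refine Submodule.mem_span_pair.2 ⟨g' * a c, g' * a' c, ?_⟩
    rw [LinearMap.lsmul_apply, hg']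
    simp only [Algebra.smul_def, map_mul, mul_one]
    linear_combination -algebraMap R B g' * hgb c
  obtain ⟨a, a', h⟩ := Submodule.mem_span_pair.1 (h1 (Submodule.mem_top (x := b)))
  exact ⟨a, a', by simpa [Algebra.smul_def] using h.symm⟩

lemma discr_eq_four_mul {R B : Type*} [CommRing R] [CommRing B] [Algebra R B]
    (b : Module.Basis (Fin 2) R B) (hb : b 0 = 1) {δ : R} (hδ : b 1 ^ 2 = algebraMap R B δ) :
    Algebra.discr R b = 4 * δ := by
  have h1 : b.repr 1 = Finsupp.single 0 1 := by rw [← hb, b.repr_self]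
  have hδ' : b.repr (b 1 * b 1) = Finsupp.single 0 δ := by
    rw [← pow_two, hδ, Algebra.algebraMap_eq_smul_one, map_smul, h1]
    simp
  have t1 : Algebra.trace R B 1 = 2 := by
    rw [Algebra.trace_eq_matrix_trace b, map_one, Matrix.trace_one]; simp
  have ts : Algebra.trace R B (b 1) = 0 := by
    rw [Algebra.trace_eq_matrix_trace b, Matrix.trace_fin_two]
    simp [Algebra.leftMulMatrix_eq_repr_mul, hb, hδ']
  have tss : Algebra.trace R B (b 1 * b 1) = 2 * δ := by
    rw [← pow_two, hδ, Algebra.algebraMap_eq_smul_one, map_smul, t1, smul_eq_mul, mul_comm]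
  rw [Algebra.discr_def, Matrix.det_fin_two]
  simp only [Algebra.traceMatrix_apply, Algebra.traceForm_apply, hb, one_mul, mul_one, t1, ts, tss]
  ring

section DoubleCover

variable {S X : Scheme.{u}} [IsIntegral S] [IsIntegral X] (r : S ⟶ X) [Flat r]

lemma genericPoint_mem_preimage {U : X.Opens} {x : X} (hx : x ∈ U) :
    genericPoint S ∈ r ⁻¹ᵁ U := by
  change r (genericPoint S) ∈ U
  rw [map_genericPoint_of_flat r]
  exact genericPoint_mem hx

variable [Algebra X.functionField S.functionField]

lemma functionFieldMap_app (hφ : algebraMap X.functionField S.functionField = functionFieldMap r)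
    {U : X.Opens} {x : X} (hx : x ∈ U) (a : Γ(X, U)) :
    sectionToFunctionField (r ⁻¹ᵁ U) (genericPoint_mem_preimage r hx) (r.app U a) =
      algebraMap X.functionField S.functionField
        (sectionToFunctionField U (genericPoint_mem hx) a) := by
  have h := functionFieldMap_section r (genericPoint_mem hx) (genericPoint_mem_preimage r hx)
    le_rfl a
  rw [Scheme.Hom.appLE_eq_app] at h
  rw [hφ]
  exact h.symm

lemma isFractionRing_section {U : X.Opens} (hU : IsAffineOpen U) (h : genericPoint X ∈ U) :
    letI := (sectionToFunctionField U h).toAlgebra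
    IsFractionRing Γ(X, U) X.functionField :=
  haveI : Nonempty U := ⟨⟨_, h⟩⟩
  functionField_isFractionRing_of_isAffineOpen X U hU

lemma isDomain_section {U : X.Opens} (h : genericPoint X ∈ U) : IsDomain Γ(X, U) :=
  haveI : Nonempty U := ⟨⟨_, h⟩⟩
  inferInstance

/-- Sections over the preimage of a basic open set, as rational functions. -/
lemma exists_pow_mul_section_eq [IsFinite r]
    (hφ : algebraMap X.functionField S.functionField = functionFieldMap r)
    {U : X.Opens} (hU : IsAffineOpen U) {x : X}
    (hx : x ∈ U) (g : Γ(X, U)) (hg : genericPoint X ∈ X.basicOpen g)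
    (f : Γ(S, r ⁻¹ᵁ X.basicOpen g)) :
    ∃ (n : ℕ) (b : Γ(S, r ⁻¹ᵁ U)),
      sectionToFunctionField _ (genericPoint_mem_preimage r hg) f *
        algebraMap X.functionField S.functionField
          (sectionToFunctionField U (genericPoint_mem hx) g) ^ n =
      sectionToFunctionField _ (genericPoint_mem_preimage r hx) b := by
  have hle : r ⁻¹ᵁ X.basicOpen g ≤ r ⁻¹ᵁ U := r.preimage_mono (X.basicOpen_le g)
  have hpre : IsAffineOpen (r ⁻¹ᵁ U) := hU.preimage r
  let _ : Algebra Γ(S, r ⁻¹ᵁ U) Γ(S, r ⁻¹ᵁ X.basicOpen g) :=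
    (S.presheaf.map (homOfLE hle).op).hom.toAlgebra
  have : IsLocalization.Away (r.app U g) Γ(S, r ⁻¹ᵁ X.basicOpen g) :=
    hpre.isLocalization_of_eq_basicOpen (r.app U g) (homOfLE hle) (r.preimage_basicOpen g)
  obtain ⟨n, b, hb⟩ := IsLocalization.Away.surj (r.app U g) f
  refine ⟨n, b, ?_⟩
  have h1 := congr_arg (sectionToFunctionField _ (genericPoint_mem_preimage r hg)) hb
  have h2 : ∀ c : Γ(S, r ⁻¹ᵁ U), sectionToFunctionField _ (genericPoint_mem_preimage r hg)
      (algebraMap Γ(S, r ⁻¹ᵁ U) Γ(S, r ⁻¹ᵁ X.basicOpen g) c) =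
        sectionToFunctionField _ (genericPoint_mem_preimage r hx) c := fun c =>
    sectionToFunctionField_res hle _ c
  rw [map_mul, map_pow, h2, h2, functionFieldMap_app r hφ hx] at h1
  exact h1

lemma isUnit_section_basicOpen {U : X.Opens} {x : X} (hx : x ∈ U) (g : Γ(X, U))
    (hg : genericPoint X ∈ X.basicOpen g) :
    ∃ i : Γ(X, X.basicOpen g), sectionToFunctionField _ hg i *
      sectionToFunctionField U (genericPoint_mem hx) g = 1 := by
  have h1 : IsUnit (X.presheaf.map (homOfLE (X.basicOpen_le g)).op g) :=
    RingedSpace.isUnit_res_basicOpen _ g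
  obtain ⟨i, hi⟩ := h1.exists_left_inv
  refine ⟨i, ?_⟩
  rw [← sectionToFunctionField_res (X.basicOpen_le g) hg, ← map_mul, hi, map_one]

/-- Locally on the base, the sections of a finite flat double cover are generated by `1` and
another section as a module. -/
lemma exists_affineOpen_generator [IsLocallyNoetherian X] [IsFinite r]
    (hφ : algebraMap X.functionField S.functionField = functionFieldMap r)
    (hKM : Module.finrank X.functionField S.functionField = 2) (y : X) :
    ∃ (U : X.affineOpens) (_ : y ∈ U.1) (t : Γ(S, r ⁻¹ᵁ U.1)), ∀ b : Γ(S, r ⁻¹ᵁ U.1),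
      ∃ a a' : Γ(X, U.1), b = r.app U.1 a + r.app U.1 a' * t := by
  obtain ⟨_, ⟨U₀, hU₀, rfl⟩, hyU₀, -⟩ :=
    X.isBasis_affineOpens.exists_subset_of_mem_open (Set.mem_univ y) isOpen_univ
  have hU₀ : IsAffineOpen U₀ := hU₀
  have hy₀ : y ∈ U₀ := hyU₀
  have hη := genericPoint_mem hy₀
  have hηS := genericPoint_mem_preimage r hy₀
  have := isDomain_section hη
  have := isDomain_section hηS
  have : IsNoetherianRing Γ(X, U₀) := IsLocallyNoetherian.component_noetherian ⟨U₀, hU₀⟩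
  let _ : Algebra Γ(X, U₀) Γ(S, r ⁻¹ᵁ U₀) := (r.app U₀).hom.toAlgebra
  let _ : Algebra Γ(X, U₀) X.functionField := (sectionToFunctionField U₀ hη).toAlgebra
  let _ : Algebra Γ(S, r ⁻¹ᵁ U₀) S.functionField := (sectionToFunctionField _ hηS).toAlgebra
  let _ : Algebra Γ(X, U₀) S.functionField :=
    ((algebraMap X.functionField S.functionField).comp (sectionToFunctionField U₀ hη)).toAlgebra
  have : IsScalarTower Γ(X, U₀) X.functionField S.functionField := .of_algebraMap_eq fun _ => rfl
  have : IsScalarTower Γ(X, U₀) Γ(S, r ⁻¹ᵁ U₀) S.functionField :=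
    .of_algebraMap_eq fun a => (functionFieldMap_app r hφ hy₀ a).symm
  have : IsFractionRing Γ(X, U₀) X.functionField := isFractionRing_section hU₀ hη
  have : FaithfulSMul Γ(S, r ⁻¹ᵁ U₀) S.functionField :=
    (faithfulSMul_iff_algebraMap_injective _ _).2 (sectionToFunctionField_injective _ hηS)
  have : Module.Finite Γ(X, U₀) Γ(S, r ⁻¹ᵁ U₀) := r.finite_app U₀ hU₀
  have : Module.Flat Γ(X, U₀) Γ(S, r ⁻¹ᵁ U₀) := by
    have h := r.flat_appLE hU₀ (hU₀.preimage r) le_rfl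
    rw [Scheme.Hom.appLE_eq_app] at h
    exact h
  obtain ⟨g, hg, t, ht⟩ := exists_generator_away (R := Γ(X, U₀)) (B := Γ(S, r ⁻¹ᵁ U₀)) hKM
    (hU₀.primeIdealOf ⟨y, hy₀⟩).asIdeal
    (Localization.AtPrime (hU₀.primeIdealOf ⟨y, hy₀⟩).asIdeal)
  have hyg : y ∈ X.basicOpen g := by
    have h1 : hU₀.fromSpec (hU₀.primeIdealOf ⟨y, hy₀⟩) ∈ X.basicOpen g := by
      rw [← hU₀.fromSpec_image_basicOpen]
      exact ⟨_, hg, rfl⟩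
    rwa [hU₀.fromSpec_primeIdealOf ⟨y, hy₀⟩] at h1
  have hηg := genericPoint_mem hyg
  have hle : r ⁻¹ᵁ X.basicOpen g ≤ r ⁻¹ᵁ U₀ := r.preimage_mono (X.basicOpen_le g)
  suffices h : ∀ f : Γ(S, r ⁻¹ᵁ X.basicOpen g), ∃ a a' : Γ(X, X.basicOpen g),
      f = r.app (X.basicOpen g) a + r.app (X.basicOpen g) a' *
        S.presheaf.map (homOfLE hle).op t from ⟨⟨X.basicOpen g, hU₀.basicOpen g⟩, hyg, _, h⟩
  intro f
  obtain ⟨n, b, hb⟩ := exists_pow_mul_section_eq r hφ hU₀ hy₀ g hηg f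
  obtain ⟨a, a', hab⟩ := ht b
  obtain ⟨i, hi⟩ := isUnit_section_basicOpen hy₀ g hηg
  have hi' := congr_arg (algebraMap X.functionField S.functionField) hi
  rw [map_mul, map_one] at hi'
  let ρ := X.presheaf.map (homOfLE (X.basicOpen_le g)).op
  refine ⟨i ^ (n + 1) * ρ a, i ^ (n + 1) * ρ a', sectionToFunctionField_injective _
    (genericPoint_mem_preimage r hηg) ?_⟩
  have hab' := congr_arg (sectionToFunctionField _ hηS) hab
  have e1 : ∀ c : Γ(X, U₀), sectionToFunctionField _ hηS (algebraMap Γ(X, U₀) Γ(S, r ⁻¹ᵁ U₀) c) =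
    algebraMap X.functionField S.functionField (sectionToFunctionField U₀ hη c) :=
    functionFieldMap_app r hφ hy₀
  have e2 : ∀ c : Γ(X, U₀), sectionToFunctionField _ hηg (ρ c) = sectionToFunctionField U₀ hη c :=
    sectionToFunctionField_res (X.basicOpen_le g) hηg
  have e3 : sectionToFunctionField _ (genericPoint_mem_preimage r hηg)
      (S.presheaf.map (homOfLE hle).op t) = sectionToFunctionField _ hηS t :=
    sectionToFunctionField_res hle _ t
  simp only [map_mul, map_add, e1, ← hb] at hab'
  have e4 : ∀ c c', sectionToFunctionField _ (genericPoint_mem_preimage r hηg)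
      (r.app (X.basicOpen g) c + r.app (X.basicOpen g) c' * S.presheaf.map (homOfLE hle).op t) =
      algebraMap X.functionField S.functionField (sectionToFunctionField _ hηg c) +
      algebraMap X.functionField S.functionField (sectionToFunctionField _ hηg c') *
        sectionToFunctionField _ hηS t := fun c c' => by
    rw [map_add, map_mul, functionFieldMap_app r hφ hηg, functionFieldMap_app r hφ hηg, e3]
  rw [e4]
  simp only [map_mul, map_pow, e2]
  have hi'' := congr_arg (fun c => c ^ (n + 1)) hi'
  simp only [mul_pow, one_pow] at hi''
  linear_combination -(sectionToFunctionField _ (genericPoint_mem_preimage r hηg) f) * hi'' +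
    algebraMap X.functionField S.functionField (sectionToFunctionField _ hηg i) ^ (n + 1) * hab'

/-- Locally on the base, a finite flat double cover is given by adjoining a square root `s` of
an equation `δ` of the branch divisor. -/
theorem exists_affineOpen_sqrt [IsLocallyNoetherian X] [IsFinite r]
    (hφ : algebraMap X.functionField S.functionField = functionFieldMap r)
    (h2 : ∀ U : X.Opens, IsUnit (2 : Γ(X, U)))
    (hKM : Module.finrank X.functionField S.functionField = 2) {I : X.IdealSheafData}
    (hI : HasBranchDivisor r I) (y : X) :
    ∃ (U : X.affineOpens) (hy : y ∈ U.1) (s : S.functionField) (δ : Γ(X, U.1)),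
      s ∉ (algebraMap X.functionField S.functionField).range ∧
      s ^ 2 = algebraMap X.functionField S.functionField
        (sectionToFunctionField U.1 (genericPoint_mem hy) δ) ∧
      I.ideal U = Ideal.span {δ} ∧
      ∀ z ∈ U.1, ∀ f, f ∈ regularOver r z ↔ f ∈ quadLattice (regularAt z) s := by
  obtain ⟨U, hy, t, ht⟩ := exists_affineOpen_generator r hφ hKM y
  have hη := genericPoint_mem hy
  have hηS := genericPoint_mem_preimage r hy
  obtain ⟨half, hhalf⟩ := (h2 U.1).exists_left_inv
  obtain ⟨β, α, hαβ⟩ := ht (t ^ 2)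
  have hhalf' := congr_arg (r.app U.1) hhalf
  simp only [map_mul, map_one, map_ofNat] at hhalf'
  -- completing the square
  let σ : Γ(S, r ⁻¹ᵁ U.1) := t - r.app U.1 (half * α)
  let δ : Γ(X, U.1) := β + (half * α) ^ 2
  have hσδ : σ ^ 2 = r.app U.1 δ := by
    simp only [σ, δ, map_add, map_mul, map_pow]
    linear_combination hαβ - r.app U.1 α * t * hhalf'
  have hσ : ∀ b : Γ(S, r ⁻¹ᵁ U.1), ∃ a a' : Γ(X, U.1), b = r.app U.1 a + r.app U.1 a' * σ := by
    intro b
    obtain ⟨a, a', rfl⟩ := ht b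
    refine ⟨a + a' * (half * α), a', ?_⟩
    simp only [σ, map_add, map_mul]
    ring
  let s := sectionToFunctionField _ hηS σ
  have hs : ∀ a a' : Γ(X, U.1), sectionToFunctionField _ hηS (r.app U.1 a + r.app U.1 a' * σ) =
      algebraMap X.functionField S.functionField (sectionToFunctionField U.1 hη a) +
      algebraMap X.functionField S.functionField (sectionToFunctionField U.1 hη a') * s :=
    fun a a' => by
      rw [map_add, map_mul, functionFieldMap_app r hφ hy, functionFieldMap_app r hφ hy]
  have hsK : s ∉ (algebraMap X.functionField S.functionField).range := by
    rintro ⟨κ, hκ⟩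
    let _ := (sectionToFunctionField _ hηS).toAlgebra
    have := isFractionRing_section (U.2.preimage r) hηS
    have h1 : ∀ b : Γ(S, r ⁻¹ᵁ U.1), ∃ c,
        algebraMap X.functionField S.functionField c = sectionToFunctionField _ hηS b := fun b => by
      obtain ⟨a, a', rfl⟩ := hσ b
      exact ⟨sectionToFunctionField U.1 hη a + sectionToFunctionField U.1 hη a' * κ, by
        rw [hs, map_add, map_mul, hκ]⟩
    have h3 : Module.finrank X.functionField S.functionField ≤ 1 := by
      refine finrank_le_one 1 fun w => ?_
      obtain ⟨b, b', hb', hw⟩ := IsFractionRing.div_surjective (A := Γ(S, r ⁻¹ᵁ U.1)) w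
      obtain ⟨c, hc⟩ := h1 b
      obtain ⟨c', hc'⟩ := h1 b'
      refine ⟨c / c', ?_⟩
      rw [Algebra.smul_def, mul_one, map_div₀, hc, hc']
      exact hw
    omega
  have hs2 : s ^ 2 = algebraMap X.functionField S.functionField
      (sectionToFunctionField U.1 hη δ) := by
    rw [← map_pow, hσδ, functionFieldMap_app r hφ hy]
  refine ⟨U, hy, s, δ, hsK, hs2, ?_, fun z hz f => ⟨fun hf => ?_, ?_⟩⟩
  · let _ : Algebra Γ(X, U.1) Γ(S, r ⁻¹ᵁ U.1) := (r.app U.1).hom.toAlgebra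
    have hli : LinearIndependent Γ(X, U.1) ![(1 : Γ(S, r ⁻¹ᵁ U.1)), σ] := by
      rw [LinearIndependent.pair_iff]
      intro a a' h
      have h3 := hs a a'
      have h4 : r.app U.1 a + r.app U.1 a' * σ = 0 := by
        rw [← h, Algebra.smul_def, Algebra.smul_def, mul_one]
        rfl
      rw [h4, map_zero] at h3
      obtain ⟨h5, h6⟩ := add_mul_inj hsK (p := 0) (q := 0) (p' := sectionToFunctionField U.1 hη a)
        (q' := sectionToFunctionField U.1 hη a') (by rw [← h3]; simp)
      exact ⟨sectionToFunctionField_injective _ hη (by rw [← h5, map_zero]),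
        sectionToFunctionField_injective _ hη (by rw [← h6, map_zero])⟩
    have hsp : ⊤ ≤ Submodule.span Γ(X, U.1) (Set.range ![(1 : Γ(S, r ⁻¹ᵁ U.1)), σ]) := by
      intro b _
      obtain ⟨a, a', rfl⟩ := hσ b
      rw [Matrix.range_cons_cons_empty]
      refine Submodule.mem_span_pair.2 ⟨a, a', ?_⟩
      rw [Algebra.smul_def, Algebra.smul_def, mul_one]
      rfl
    let b := Module.Basis.mk hli hsp
    have hb0 : b 0 = 1 := by simp [b]
    have hb1 : b 1 = σ := by simp [b]
    have h3 := hI U b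
    rw [← h3, discr_eq_four_mul b hb0 (δ := δ) (by rw [hb1]; exact hσδ)]
    refine Ideal.span_singleton_mul_left_unit ?_ δ
    have : (4 : Γ(X, U.1)) = 2 * 2 := by norm_num
    rw [this]
    exact (h2 U.1).mul (h2 U.1)
  -- `f` is a section over the preimage of a basic open set, which is generated by `1` and `s`
  · obtain ⟨W, hWf, hW, hzW⟩ := eventually_nhds_iff.1 (regularOver_eventually r hf)
    obtain ⟨h, hhW, hzh⟩ := U.2.exists_basicOpen_le (V := ⟨W, hW⟩) ⟨z, hzW⟩ hz
    obtain ⟨f', rfl⟩ := exists_section_of_forall_mem_regularAt (r ⁻¹ᵁ X.basicOpen h)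
      (genericPoint_mem_preimage r hzh)
      (fun x hx => (mem_regularOver r).1 (hWf (r x) (hhW hx)) x rfl)
    obtain ⟨n, b, hb⟩ := exists_pow_mul_section_eq r hφ U.2 hy h (genericPoint_mem hzh) f'
    obtain ⟨a, a', rfl⟩ := hσ b
    rw [hs] at hb
    obtain ⟨i, hi⟩ := isUnit_section_basicOpen hy h (genericPoint_mem hzh)
    have hi' := congr_arg (fun c => algebraMap X.functionField S.functionField c ^ n) hi
    simp only [map_mul, map_one, mul_pow, one_pow] at hi'
    have hiz := section_mem_regularAt hzh i
    refine ⟨_, Subring.mul_mem _ (Subring.pow_mem _ hiz n) (section_mem_regularAt hz a),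
      _, Subring.mul_mem _ (Subring.pow_mem _ hiz n) (section_mem_regularAt hz a'), ?_⟩
    simp only [map_mul, map_pow]
    linear_combination algebraMap X.functionField S.functionField
      (sectionToFunctionField _ (genericPoint_mem hzh) i) ^ n * hb -
      sectionToFunctionField _ (genericPoint_mem_preimage r (genericPoint_mem hzh)) f' * hi'
  · rintro ⟨a, ha, a', ha', rfl⟩
    rw [hφ]
    refine Subring.add_mem _ (functionFieldMap_mem_regularOver r ha) (Subring.mul_mem _
      (functionFieldMap_mem_regularOver r ha') ((mem_regularOver r).2 ?_))
    rintro x rfl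
    exact section_mem_regularAt (U := r ⁻¹ᵁ U.1) hz σ

end DoubleCover

/-! ### Rational functions on an affine open set -/

section Affine

open Topology

variable {X : Scheme.{u}} {U : X.Opens} (hU : IsAffineOpen U)

lemma exists_primeIdealOf_eq (p : Ideal Γ(X, U)) [hp : p.IsPrime] :
    ∃ (z : X) (hz : z ∈ U), (hU.primeIdealOf ⟨z, hz⟩).asIdeal = p := by
  let y : Spec Γ(X, U) := ⟨p, hp⟩
  have hz : hU.fromSpec y ∈ U := by
    have h1 : hU.fromSpec y ∈ Set.range hU.fromSpec := ⟨y, rfl⟩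
    rw [hU.range_fromSpec] at h1
    exact h1
  refine ⟨hU.fromSpec y, hz, ?_⟩
  have h1 := hU.fromSpec_primeIdealOf ⟨hU.fromSpec y, hz⟩
  have h2 := hU.fromSpec.isOpenEmbedding.injective h1
  rw [h2]

lemma height_primeIdealOf {z : X} (hz : z ∈ U) :
    (hU.primeIdealOf ⟨z, hz⟩).asIdeal.height = Order.coheight z := by
  let _ : Algebra Γ(X, U) (X.presheaf.stalk z) :=
    TopCat.Presheaf.algebra_section_stalk X.presheaf (⟨z, hz⟩ : U)
  have : IsLocalization.AtPrime (X.presheaf.stalk z) (hU.primeIdealOf ⟨z, hz⟩).asIdeal :=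
    hU.isLocalization_stalk ⟨z, hz⟩
  have h1 := IsLocalization.AtPrime.ringKrullDim_eq_height (hU.primeIdealOf ⟨z, hz⟩).asIdeal
    (X.presheaf.stalk z)
  rw [ringKrullDim_stalk_eq_coheight] at h1
  exact_mod_cast h1.symm

variable [IsIntegral X]

lemma section_mem_vanishingAt_iff {z : X} (hz : z ∈ U) {a : Γ(X, U)} :
    sectionToFunctionField U (genericPoint_mem hz) a ∈ vanishingAt z ↔
      a ∈ (hU.primeIdealOf ⟨z, hz⟩).asIdeal := by
  rw [← algebraMap_germ hz, algebraMap_mem_vanishingAt_iff, hU.primeIdealOf_eq_map_closedPoint]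
  rfl

include hU in
lemma exists_mul_section_eq {z : X} (hz : z ∈ U) {f : X.functionField} (hf : f ∈ regularAt z) :
    ∃ a b : Γ(X, U), sectionToFunctionField U (genericPoint_mem hz) b ∉ vanishingAt z ∧
      f * sectionToFunctionField U (genericPoint_mem hz) b =
        sectionToFunctionField U (genericPoint_mem hz) a := by
  obtain ⟨f, rfl⟩ := hf
  let _ : Algebra Γ(X, U) (X.presheaf.stalk z) :=
    TopCat.Presheaf.algebra_section_stalk X.presheaf (⟨z, hz⟩ : U)
  have : IsLocalization.AtPrime (X.presheaf.stalk z) (hU.primeIdealOf ⟨z, hz⟩).asIdeal :=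
    hU.isLocalization_stalk ⟨z, hz⟩
  obtain ⟨⟨a, b⟩, h⟩ :=
    IsLocalization.surj (hU.primeIdealOf ⟨z, hz⟩).asIdeal.primeCompl f
  refine ⟨a, b, fun h => b.2 ((section_mem_vanishingAt_iff hU hz).1 h), ?_⟩
  have h1 := congr_arg (algebraMap (X.presheaf.stalk z) X.functionField) h
  rw [map_mul] at h1
  have h2 : ∀ c : Γ(X, U), algebraMap (X.presheaf.stalk z) X.functionField
    (algebraMap Γ(X, U) (X.presheaf.stalk z) c) =
      sectionToFunctionField U (genericPoint_mem hz) c := algebraMap_germ hz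
  rwa [h2, h2] at h1

lemma specializes_iff_primeIdealOf_le {x y : X} (hx : x ∈ U) (hy : y ∈ U) :
    x ⤳ y ↔ (hU.primeIdealOf ⟨x, hx⟩).asIdeal ≤ (hU.primeIdealOf ⟨y, hy⟩).asIdeal := by
  constructor
  · intro h a ha
    by_contra hay
    have h0 : sectionToFunctionField U (genericPoint_mem hx) a ≠ 0 := by
      intro h
      rw [map_eq_zero_iff _ (sectionToFunctionField_injective U _)] at h
      exact hay (h ▸ Ideal.zero_mem _)
    rw [← section_mem_vanishingAt_iff hU hy] at hay
    exact notMem_vanishingAt_of_inv_mem h0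
      (regularAt_le_of_specializes h (inv_mem_regularAt (section_mem_regularAt hy a) hay))
      ((section_mem_vanishingAt_iff hU hx).2 ha)
  · intro h
    have h1 := ((PrimeSpectrum.le_iff_specializes (hU.primeIdealOf ⟨x, hx⟩)
      (hU.primeIdealOf ⟨y, hy⟩)).1 h).map hU.fromSpec.continuous
    have h2 : hU.fromSpec (hU.primeIdealOf ⟨x, hx⟩) ⤳ hU.fromSpec (hU.primeIdealOf ⟨y, hy⟩) := h1
    rwa [hU.fromSpec_primeIdealOf, hU.fromSpec_primeIdealOf] at h2

end Affine

/-! ### Local equations of prime divisors -/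

section LocalEquation

open Topology

variable {X : Scheme.{u}}

lemma eq_of_specializes_of_coheight_eq_one {x y : X} (h : x ⤳ y) (hx : Order.coheight x = 1)
    (hy : Order.coheight y = 1) : x = y := by
  by_contra hne
  have h0 : y ≤ x := h
  have h1 : y < x := lt_of_le_not_ge h0 fun h' : x ≤ y => hne (h.antisymm h').eq
  have h2 := Order.coheight_add_one_le h1
  rw [hx, hy] at h2
  exact absurd h2 (by decide)

variable [IsIntegral X]

/-- The rational function `c` is an equation at `z` of the prime divisor with generic point `γ`: if
the divisor passes through `z`, then `c` generates its ideal in the local ring at `z`, and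
otherwise `c` is a unit there. -/
def IsLocalEquation (γ : X) (c : X.functionField) (z : X) : Prop :=
  c ≠ 0 ∧ c ∈ regularAt z ∧
    (γ ⤳ z → c ∈ vanishingAt γ ∧ ∀ a ∈ regularAt z, a ∈ vanishingAt γ → a / c ∈ regularAt z) ∧
    (¬ γ ⤳ z → c⁻¹ ∈ regularAt z)

lemma IsLocalEquation.mul_unit {γ z : X} {c u : X.functionField} (h : IsLocalEquation γ c z)
    (hu0 : u ≠ 0) (hu : u ∈ regularAt z) (hu' : u⁻¹ ∈ regularAt z) :
    IsLocalEquation γ (c * u) z := by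
  obtain ⟨h0, h1, h2, h3⟩ := h
  refine ⟨mul_ne_zero h0 hu0, Subring.mul_mem _ h1 hu, fun h => ⟨?_, fun a ha haγ => ?_⟩,
    fun h => ?_⟩
  · rw [mul_comm]
    exact mul_mem_vanishingAt (regularAt_le_of_specializes h hu) (h2 h).1
  · rw [← div_div, div_eq_mul_inv]
    exact Subring.mul_mem _ ((h2 h).2 a ha haγ) hu'
  · rw [mul_inv]
    exact Subring.mul_mem _ (h3 h) hu'

lemma isLocalEquation_one {γ z : X} (h : ¬ γ ⤳ z) : IsLocalEquation γ 1 z :=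
  ⟨one_ne_zero, Subring.one_mem _, fun h' => absurd h' h, fun _ => by
    rw [inv_one]; exact Subring.one_mem _⟩

variable {U : X.Opens} (hU : IsAffineOpen U)

/-- A prime divisor has an equation on an affine open set whose ring of functions is factorial. -/
lemma exists_isLocalEquation [UniqueFactorizationMonoid Γ(X, U)] {γ : X} (hγ : γ ∈ U)
    (hγ1 : Order.coheight γ = 1) :
    ∃ c : Γ(X, U), Prime c ∧ (hU.primeIdealOf ⟨γ, hγ⟩).asIdeal = Ideal.span {c} ∧
      ∀ z ∈ U, IsLocalEquation γ (sectionToFunctionField U (genericPoint_mem hγ) c) z := by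
  have := isDomain_section (genericPoint_mem hγ)
  have hpt : (hU.primeIdealOf ⟨γ, hγ⟩).asIdeal.height = 1 := by rw [height_primeIdealOf, hγ1]
  obtain ⟨c, hcm, hc⟩ := Ideal.IsPrime.exists_mem_prime_of_ne_bot
    (hU.primeIdealOf ⟨γ, hγ⟩).isPrime (Ideal.ne_bot_of_height_eq_one hpt)
  have hspan := Ideal.eq_span_singleton_of_height_eq_one hpt hcm hc
  have hc0 : sectionToFunctionField U (genericPoint_mem hγ) c ≠ 0 := by
    rw [Ne, map_eq_zero_iff _ (sectionToFunctionField_injective U _)]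
    exact hc.ne_zero
  refine ⟨c, hc, hspan, fun z hz => ⟨hc0, section_mem_regularAt hz c,
    fun h => ⟨(section_mem_vanishingAt_iff hU hγ).2 hcm, fun a ha haγ => ?_⟩, fun h => ?_⟩⟩
  · obtain ⟨b, g, hg, hb⟩ := exists_mul_section_eq hU hz ha
    have h1 : b ∈ Ideal.span {c} := by
      rw [← hspan, ← section_mem_vanishingAt_iff hU hγ, ← hb, mul_comm]
      exact mul_mem_vanishingAt (section_mem_regularAt hγ g) haγ
    obtain ⟨e, rfl⟩ := Ideal.mem_span_singleton.1 h1
    have hg0 : sectionToFunctionField U (genericPoint_mem hz) g ≠ 0 := fun h =>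
      hg (h ▸ AddSubgroup.zero_mem _)
    rw [map_mul] at hb
    have h2 : a / sectionToFunctionField U (genericPoint_mem hγ) c =
        sectionToFunctionField U (genericPoint_mem hz) e *
          (sectionToFunctionField U (genericPoint_mem hz) g)⁻¹ := by
      rw [← div_eq_mul_inv, div_eq_div_iff hc0 hg0, hb, mul_comm]
    rw [h2]
    exact Subring.mul_mem _ (section_mem_regularAt hz e)
      (inv_mem_regularAt (section_mem_regularAt hz g) hg)
  · rw [specializes_iff_primeIdealOf_le hU hγ hz, hspan, Ideal.span_singleton_le_iff_mem,
      ← section_mem_vanishingAt_iff hU hz] at h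
    exact inv_mem_regularAt (section_mem_regularAt hz c) h

include hU in
/-- A rational function that is regular in codimension one on a factorial affine open set is
regular there. -/
lemma mem_regularAt_of_forall_coheight_eq_one [UniqueFactorizationMonoid Γ(X, U)]
    [IsNoetherianRing Γ(X, U)] {f : X.functionField}
    (hf : ∀ z ∈ U, Order.coheight z = 1 → f ∈ regularAt z) {z : X} (hz : z ∈ U) :
    f ∈ regularAt z := by
  have hη := genericPoint_mem hz
  have := isDomain_section hη
  let _ := (sectionToFunctionField U hη).toAlgebra
  have := isFractionRing_section hU hη
  obtain ⟨a, b, hab, rfl⟩ := IsFractionRing.exists_reduced_fraction Γ(X, U) f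
  have hb0 : (b : Γ(X, U)) ≠ 0 := nonZeroDivisors.coe_ne_zero b
  suffices h : IsUnit (b : Γ(X, U)) by
    obtain ⟨u, hu⟩ := h
    rw [IsFractionRing.mk'_eq_div, ← hu, div_eq_mul_inv]
    exact Subring.mul_mem _ (section_mem_regularAt hz a) (unit_section_mem_regularAt hz u)
  by_contra hbu
  obtain ⟨p, hp, hpb⟩ := WfDvdMonoid.exists_irreducible_factor hbu hb0
  have hp' : Prime p := UniqueFactorizationMonoid.irreducible_iff_prime.1 hp
  have : (Ideal.span {p}).IsPrime := (Ideal.span_singleton_prime hp'.ne_zero).2 hp'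
  obtain ⟨y, hy, hyp⟩ := exists_primeIdealOf_eq hU (Ideal.span {p})
  have h1 : Order.coheight y = 1 := by
    rw [← height_primeIdealOf hU hy, hyp]
    exact Ideal.height_span_singleton_eq_one_of_mem_nonZeroDivisors
      (mem_nonZeroDivisors_of_ne_zero hp'.ne_zero) hp.not_isUnit
  obtain ⟨e, g, hg, he⟩ := exists_mul_section_eq hU hy (hf y hy h1)
  rw [section_mem_vanishingAt_iff hU hy, hyp, Ideal.mem_span_singleton] at hg
  have hb0' : sectionToFunctionField U hη b ≠ 0 := by
    rwa [Ne, map_eq_zero_iff _ (sectionToFunctionField_injective U _)]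
  have h2 : a * g = e * b := sectionToFunctionField_injective U hη (by
    rw [map_mul, map_mul, ← he, IsFractionRing.mk'_eq_div]
    change _ = sectionToFunctionField U hη a / sectionToFunctionField U hη b *
      sectionToFunctionField U hη g * _
    field_simp)
  obtain h3 | h3 := hp'.dvd_or_dvd (h2 ▸ hpb.mul_left e : p ∣ a * g)
  · exact hp.not_isUnit (hab h3 hpb)
  · exact hg h3

end LocalEquation

/-! ### Orders of vanishing -/

section Order

variable {X : Scheme.{u}} [IsIntegral X] [IsLocallyNoetherian X]

/-- At the generic point of the divisor, an equation is a uniformizer. -/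
lemma IsLocalEquation.exists_irreducible {γ : X} {c : X.functionField}
    (h : IsLocalEquation γ c γ) :
    IsDiscreteValuationRing (X.presheaf.stalk γ) ∧ ∃ ϖ : X.presheaf.stalk γ, Irreducible ϖ ∧
      algebraMap (X.presheaf.stalk γ) X.functionField ϖ = c := by
  obtain ⟨h0, ⟨ϖ, rfl⟩, h2, -⟩ := h
  obtain ⟨h3, h4⟩ := h2 specializes_rfl
  rw [algebraMap_mem_vanishingAt_iff] at h3
  have hϖ0 : ϖ ≠ 0 := by
    rintro rfl
    exact h0 (map_zero _)
  have hmax : IsLocalRing.maximalIdeal (X.presheaf.stalk γ) = Ideal.span {ϖ} := by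
    refine le_antisymm (fun a ha => ?_) ((Ideal.span_singleton_le_iff_mem _).2 h3)
    obtain ⟨b, hb⟩ := h4 _ ⟨a, rfl⟩ (algebraMap_mem_vanishingAt_iff.2 ha)
    refine Ideal.mem_span_singleton.2 ⟨b, algebraMap_stalk_injective γ ?_⟩
    rw [map_mul, hb, mul_div_cancel₀ _ h0]
  have hnf : ¬ IsField (X.presheaf.stalk γ) := fun hf => by
    rw [IsLocalRing.isField_iff_maximalIdeal_eq] at hf
    rw [hf] at h3
    exact hϖ0 h3
  have hprin : (IsLocalRing.maximalIdeal (X.presheaf.stalk γ)).IsPrincipal := ⟨ϖ, hmax⟩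
  have hdvr : IsDiscreteValuationRing (X.presheaf.stalk γ) :=
    ((IsDiscreteValuationRing.TFAE _ hnf).out 0 4).2 hprin
  exact ⟨hdvr, ϖ, (IsDiscreteValuationRing.irreducible_iff_uniformizer ϖ).2 hmax, rfl⟩

lemma ord_eq_zero_of_mem_regularAt {z : X} {f : X.functionField} (h0 : f ≠ 0)
    (hf : f ∈ regularAt z) (hf' : f⁻¹ ∈ regularAt z) : Scheme.ord f z = 0 := by
  by_cases hz : Order.coheight z = 1
  · have : Ring.KrullDimLE 1 (X.presheaf.stalk z) := krullDimLE_of_coheight_le hz.le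
    rw [Scheme.ord_eq_iff hz h0]
    obtain ⟨a, rfl⟩ := hf
    exact Ring.ordFrac_of_isUnit
      (isUnit_of_inv_mem_regularAt (fun h => h0 (by rw [h, map_zero])) hf')
  · exact Scheme.ord_eq_zero_of_coheight_neq_one hz f

lemma IsLocalEquation.ord_eq_one {γ : X} (hγ : Order.coheight γ = 1) {c : X.functionField}
    (h : IsLocalEquation γ c γ) : Scheme.ord c γ = 1 := by
  obtain ⟨hdvr, ϖ, hϖ, rfl⟩ := h.exists_irreducible
  rw [Scheme.ord_eq_iff hγ h.1]
  exact Ring.ordFrac_irreducible hϖ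

lemma ord_inv {z : X} {f : X.functionField} (h0 : f ≠ 0) :
    Scheme.ord f⁻¹ z = -Scheme.ord f z := by
  have h1 := Scheme.ord_mul (x := z) h0 (inv_ne_zero h0)
  rw [mul_inv_cancel₀ h0,
    ord_eq_zero_of_mem_regularAt (one_ne_zero (α := X.functionField)) (Subring.one_mem _)
    (by rw [inv_one]; exact Subring.one_mem _)] at h1
  omega

lemma ord_pow_two {z : X} {f : X.functionField} (h0 : f ≠ 0) :
    Scheme.ord (f ^ 2) z = 2 * Scheme.ord f z := by
  rw [pow_two, Scheme.ord_mul h0 h0, two_mul]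

lemma mem_regularAt_of_ord_nonneg {γ : X} (hγ : Order.coheight γ = 1) {c : X.functionField}
    (h : IsLocalEquation γ c γ) {f : X.functionField} (h0 : f ≠ 0)
    (hf : 0 ≤ Scheme.ord f γ) : f ∈ regularAt γ := by
  obtain ⟨hdvr, ϖ, hϖ, rfl⟩ := h.exists_irreducible
  obtain ⟨a, ha⟩ | ⟨a, ha⟩ := ValuationRing.isInteger_or_isInteger (X.presheaf.stalk γ) f
  · exact ⟨a, ha⟩
  by_cases hau : IsUnit a
  · rw [← inv_inv f, ← ha]
    exact inv_mem_regularAt_of_isUnit hau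
  · have ha0 : a ≠ 0 := by
      rintro rfl
      rw [map_zero, eq_comm, inv_eq_zero] at ha
      exact h0 ha
    obtain ⟨b, rfl⟩ : ϖ ∣ a := by
      rw [← Ideal.mem_span_singleton,
        ← (IsDiscreteValuationRing.irreducible_iff_uniformizer ϖ).1 hϖ]
      exact hau
    have hb0 : algebraMap (X.presheaf.stalk γ) X.functionField b ≠ 0 := by
      rw [Ne, map_eq_zero_iff _ (algebraMap_stalk_injective γ)]
      exact right_ne_zero_of_mul ha0
    have h1 := ord_inv (z := γ) h0
    rw [← ha, map_mul, Scheme.ord_mul h.1 hb0, h.ord_eq_one hγ] at h1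
    have h2 : 0 ≤ Scheme.ord (algebraMap (X.presheaf.stalk γ) X.functionField b) γ := by
      obtain ⟨n, u, hu⟩ := IsDiscreteValuationRing.eq_unit_mul_pow_irreducible
        (right_ne_zero_of_mul ha0) hϖ
      rw [hu]
      clear hu h1 ha hb0 ha0 hau
      induction n with
      | zero =>
        rw [pow_zero, mul_one, ord_eq_zero_of_mem_regularAt _ ⟨_, rfl⟩
          (inv_mem_regularAt_of_isUnit u.isUnit)]
        rw [Ne, map_eq_zero_iff _ (algebraMap_stalk_injective γ)]
        exact u.ne_zero
      | succ n ih =>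
        rw [pow_succ, ← mul_assoc, map_mul, Scheme.ord_mul _ h.1, h.ord_eq_one hγ]
        · omega
        · rw [Ne, map_eq_zero_iff _ (algebraMap_stalk_injective γ)]
          exact mul_ne_zero u.ne_zero (pow_ne_zero _ hϖ.ne_zero)
    omega

lemma primeDivisor_self {X : Scheme.{u}} (x : X) : primeDivisor x x = 1 := by
  classical exact Pi.single_eq_same _ _

lemma primeDivisor_of_ne {X : Scheme.{u}} {x z : X} (h : z ≠ x) : primeDivisor x z = 0 := by
  classical exact Pi.single_eq_of_ne h _

lemma IsLocalEquation.ord_eq {γ z : X} (hγ : Order.coheight γ = 1) {c : X.functionField}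
    (h : IsLocalEquation γ c z) : Scheme.ord c z = primeDivisor γ z := by
  by_cases hz : Order.coheight z = 1
  · by_cases hzγ : z = γ
    · subst hzγ
      rw [h.ord_eq_one hγ, primeDivisor_self]
    · rw [primeDivisor_of_ne hzγ]
      exact ord_eq_zero_of_mem_regularAt h.1 h.2.1 (h.2.2.2 fun h' =>
        hzγ (eq_of_specializes_of_coheight_eq_one h' hγ hz).symm)
  · rw [Scheme.ord_eq_zero_of_coheight_neq_one hz, primeDivisor_of_ne]
    rintro rfl
    exact hz hγ

end Order

/-! ### Line bundles on a factorial affine scheme -/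

section Trivial

open Topology

variable {X : Scheme.{u}} [IsIntegral X] {U : X.Opens} (hU : IsAffineOpen U)

include hU in
lemma exists_pow_mul_eq_section (hη : genericPoint X ∈ U) (g : Γ(X, U))
    (hg : genericPoint X ∈ X.basicOpen g) {f : X.functionField}
    (hf : ∀ z ∈ X.basicOpen g, f ∈ regularAt z) :
    ∃ (n : ℕ) (b : Γ(X, U)), f * sectionToFunctionField U hη g ^ n =
      sectionToFunctionField U hη b := by
  obtain ⟨f', rfl⟩ := exists_section_of_forall_mem_regularAt (X.basicOpen g) hg hf
  have := hU.isLocalization_basicOpen g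
  obtain ⟨n, b, hb⟩ := IsLocalization.Away.surj g f'
  refine ⟨n, b, ?_⟩
  have h1 := congr_arg (sectionToFunctionField _ hg) hb
  have h2 : ∀ c : Γ(X, U), sectionToFunctionField _ hg
      (algebraMap Γ(X, U) Γ(X, X.basicOpen g) c) = sectionToFunctionField U hη c := fun c =>
    sectionToFunctionField_res (X.basicOpen_le g) hg c
  rwa [map_mul, map_pow, h2, h2] at h1

lemma section_notMem_vanishingAt {g : Γ(X, U)} {z : X} (hz : z ∈ X.basicOpen g) :
    sectionToFunctionField U (genericPoint_mem (X.basicOpen_le g hz)) g ∉ vanishingAt z := by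
  rw [← algebraMap_germ (X.basicOpen_le g hz), algebraMap_mem_vanishingAt_iff]
  exact fun h => h ((X.mem_basicOpen g z (X.basicOpen_le g hz)).1 hz)

include hU in
/-- A Cartier divisor on a factorial affine scheme is principal: its equation is a greatest common
divisor of the sections of the corresponding invertible sheaf. -/
lemma exists_forall_div_mem_regularAt [UniqueFactorizationMonoid Γ(X, U)]
    (hη : genericPoint X ∈ U) (h : X → X.functionField) (h0 : ∀ y, h y ≠ 0)
    (hloc : ∀ y, ∀ᶠ z in 𝓝 y, h y / h z ∈ regularAt z ∧ h z / h y ∈ regularAt z) :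
    ∃ q : X.functionField, q ≠ 0 ∧ ∀ z ∈ U, q / h z ∈ regularAt z ∧ h z / q ∈ regularAt z := by
  have := isDomain_section hη
  let φ := sectionToFunctionField U hη
  have hφ : Function.Injective φ := sectionToFunctionField_injective U hη
  have hφ0 : ∀ {a}, a ≠ 0 → φ a ≠ 0 := fun ha => by rwa [Ne, map_eq_zero_iff _ hφ]
  have hφz : ∀ {z}, z ∈ U → ∀ a, φ a ∈ regularAt z := fun hz a => section_mem_regularAt hz a
  have hmem : ∀ {z} {a b c : X.functionField}, b ≠ 0 → a / b ∈ regularAt z →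
      b / c ∈ regularAt z → a / c ∈ regularAt z := fun hb h1 h2 => by
    rw [← div_mul_div_cancel₀ hb]
    exact Subring.mul_mem _ h1 h2
  -- a finite cover by basic open sets on which the divisor is principal
  have hcov : ∀ y : U, ∃ g : Γ(X, U), y.1 ∈ X.basicOpen g ∧ ∀ z ∈ X.basicOpen g,
      h y / h z ∈ regularAt z ∧ h z / h y ∈ regularAt z := fun y => by
    obtain ⟨V, hV, hVo, hy⟩ := eventually_nhds_iff.1 (hloc y)
    obtain ⟨g, hgV, hg⟩ := hU.exists_basicOpen_le (V := ⟨V, hVo⟩) ⟨y.1, hy⟩ y.2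
    exact ⟨g, hg, fun z hz => hV z (hgV hz)⟩
  choose g hyg hg using hcov
  have hg0 : ∀ y, φ (g y) ≠ 0 := fun y h => section_notMem_vanishingAt (hyg y)
    (by rw [show sectionToFunctionField U _ (g y) = 0 from h]; exact AddSubgroup.zero_mem _)
  have hginv : ∀ y, ∀ z ∈ X.basicOpen (g y), (φ (g y))⁻¹ ∈ regularAt z := fun y z hz =>
    inv_mem_regularAt (hφz (X.basicOpen_le _ hz) _) (section_notMem_vanishingAt hz)
  obtain ⟨t, ht⟩ := hU.isCompact.elim_finite_subcover (fun y : U => (X.basicOpen (g y) : Set X))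
    (fun y => (X.basicOpen (g y)).isOpen)
    (fun y hy => Set.mem_iUnion.2 ⟨⟨y, hy⟩, hyg ⟨y, hy⟩⟩)
  have ht' : ∀ z ∈ U, ∃ i ∈ t, z ∈ X.basicOpen (g i) := fun z hz => by
    simpa using ht hz
  -- the sections of the invertible sheaf
  let J : Set X.functionField := {a | ∀ z ∈ U, a / h z ∈ regularAt z}
  have hJ : ∀ y ∈ U, ∃ a ∈ J, a ≠ 0 ∧ h y / a ∈ regularAt y := fun y hy => by
    have h1 : ∀ i : U, ∃ (n : ℕ) (b : Γ(X, U)),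
        h y / h i * φ (g ⟨y, hy⟩ * g i) ^ n = φ b := fun i => by
      have h2 : genericPoint X ∈ X.basicOpen (g ⟨y, hy⟩ * g i) := by
        rw [Scheme.basicOpen_mul]
        exact ⟨genericPoint_mem (hyg ⟨y, hy⟩), genericPoint_mem (hyg i)⟩
      refine exists_pow_mul_eq_section hU hη _ h2 fun z hz => ?_
      rw [Scheme.basicOpen_mul] at hz
      exact hmem (h0 z) (hg ⟨y, hy⟩ z hz.1).1 (hg i z hz.2).2
    choose n b hb using h1
    refine ⟨φ (g ⟨y, hy⟩) ^ t.sup n * h y, fun z hz => ?_,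
      mul_ne_zero (pow_ne_zero _ (hg0 _)) (h0 y), ?_⟩
    · obtain ⟨i, hi, hzi⟩ := ht' z hz
      have h3 : φ (g ⟨y, hy⟩) ^ t.sup n * h y / h z = φ (g ⟨y, hy⟩) ^ (t.sup n - n i) *
          (φ (b i) * (φ (g i))⁻¹ ^ n i) * (h i / h z) := by
        have h4 := h0 i
        have h5 := h0 z
        have h6 := hg0 i
        have h7 : φ (g ⟨y, hy⟩) ^ t.sup n =
            φ (g ⟨y, hy⟩) ^ (t.sup n - n i) * φ (g ⟨y, hy⟩) ^ n i := by
          rw [← pow_add, Nat.sub_add_cancel (Finset.le_sup hi)]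
        rw [← hb, h7, map_mul, mul_pow, inv_pow]
        field_simp
      rw [h3]
      exact Subring.mul_mem _ (Subring.mul_mem _ (Subring.pow_mem _ (hφz hz _) _)
        (Subring.mul_mem _ (hφz hz _) (Subring.pow_mem _ (hginv i z hzi) _))) (hg i z hzi).1
    · have h3 : h y / (φ (g ⟨y, hy⟩) ^ t.sup n * h y) = (φ (g ⟨y, hy⟩))⁻¹ ^ t.sup n := by
        have h4 := h0 y
        have h5 := hg0 ⟨y, hy⟩
        rw [inv_pow]
        field_simp
      rw [h3]
      exact Subring.pow_mem _ (hginv ⟨y, hy⟩ y (hyg ⟨y, hy⟩)) _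
  -- a common denominator
  obtain ⟨E, hE0, hE⟩ : ∃ E : Γ(X, U), E ≠ 0 ∧ ∀ a ∈ J, ∃ b, φ E * a = φ b := by
    let _ := φ.toAlgebra
    have := isFractionRing_section hU hη
    have h1 : ∀ i : U, ∃ b e : Γ(X, U), e ≠ 0 ∧ h i * φ e = φ b := fun i => by
      obtain ⟨b, e, he, hbe⟩ := IsFractionRing.div_surjective (A := Γ(X, U)) (h i)
      refine ⟨b, e, nonZeroDivisors.ne_zero he, ?_⟩
      rw [← hbe]
      exact div_mul_cancel₀ _ (hφ0 (nonZeroDivisors.ne_zero he))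
    choose b e he hbe using h1
    refine ⟨∏ i ∈ t, e i, Finset.prod_ne_zero_iff.2 fun i _ => he i, fun a ha => ?_⟩
    obtain ⟨b', hb'⟩ := exists_section_of_forall_mem_regularAt U hη
      (f := φ (∏ i ∈ t, e i) * a) (fun z hz => by
        obtain ⟨i, hi, hzi⟩ := ht' z hz
        obtain ⟨e', he'⟩ := Finset.dvd_prod_of_mem e hi
        have h2 : φ (∏ i ∈ t, e i) * a = a / h z * (h z / h i) * (φ (b i) * φ e') := by
          have h4 := h0 i
          have h5 := h0 z
          rw [he', map_mul, ← hbe]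
          field_simp
        rw [h2]
        exact Subring.mul_mem _ (Subring.mul_mem _ (ha z hz) (hg i z hzi).2)
          (Subring.mul_mem _ (hφz hz _) (hφz hz _)))
    exact ⟨b', hb'.symm⟩
  obtain ⟨a₀, ha₀, ha₀0, -⟩ := hJ _ hη
  -- a common divisor `q` of the sections such that `a₀ / q` is minimal
  let T : Set Γ(X, U) := {b | ∃ q, q ≠ 0 ∧ a₀ = q * φ b ∧ ∀ a ∈ J, ∃ b', a = q * φ b'}
  have hT : T.Nonempty := by
    obtain ⟨b, hb⟩ := hE a₀ ha₀
    have hE' := hφ0 hE0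
    refine ⟨b, (φ E)⁻¹, inv_ne_zero hE', by rw [← hb, inv_mul_cancel_left₀ hE'], fun a ha => ?_⟩
    obtain ⟨b', hb'⟩ := hE a ha
    exact ⟨b', by rw [← hb', inv_mul_cancel_left₀ hE']⟩
  obtain ⟨b, ⟨q, hq0, hqb, hq⟩, hmin⟩ :=
    (IsWellFounded.wf (α := Γ(X, U)) (r := DvdNotUnit)).has_min T hT
  refine ⟨q, hq0, fun z hz => ?_⟩
  obtain ⟨a, haJ, ha0, ha⟩ := hJ z hz
  obtain ⟨a', rfl⟩ := hq a haJ
  have ha'0 : φ a' ≠ 0 := right_ne_zero_of_mul ha0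
  have hqa : h z / q = h z / (q * φ a') * φ a' := by field_simp
  refine ⟨?_, hqa ▸ Subring.mul_mem _ ha (hφz hz _)⟩
  suffices hv : φ a' ∉ vanishingAt z by
    have h1 : q / h z = q * φ a' / h z * (φ a')⁻¹ := by field_simp
    rw [h1]
    exact Subring.mul_mem _ (haJ z hz) (inv_mem_regularAt (hφz hz _) hv)
  intro hv
  have hp := (hU.primeIdealOf ⟨z, hz⟩).isPrime
  have hiff : ∀ c, φ c ∈ vanishingAt z ↔ c ∈ (hU.primeIdealOf ⟨z, hz⟩).asIdeal := fun c =>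
    section_mem_vanishingAt_iff hU hz
  obtain ⟨π, hπ, hπa, hπz⟩ : ∃ π, Prime π ∧ π ∣ a' ∧
      π ∈ (hU.primeIdealOf ⟨z, hz⟩).asIdeal := by
    obtain ⟨fs, hfs, hprod⟩ := UniqueFactorizationMonoid.exists_prime_factors a'
      (fun h => ha'0 (by rw [h, map_zero]))
    rw [hiff] at hv
    obtain ⟨π, hπ, hπz⟩ := (hp.multiset_prod_mem_iff_exists_mem fs).1
      (Ideal.mem_of_dvd _ hprod.symm.dvd hv)
    exact ⟨π, hfs π hπ, (Multiset.dvd_prod hπ).trans hprod.dvd, hπz⟩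
  -- `q π` would be a common divisor as well
  have hdiv : ∀ c ∈ J, ∃ b', c = q * φ π * φ b' := fun c hc => by
    obtain ⟨c', rfl⟩ := hq c hc
    obtain ⟨e, g', hg', he⟩ := exists_mul_section_eq hU hz (f := φ c' / φ a') (by
      have h1 : φ c' / φ a' = q * φ c' / h z * (h z / (q * φ a')) := by
        have h2 := h0 z
        field_simp
      rw [h1]
      exact Subring.mul_mem _ (hc z hz) ha)
    have h1 : c' * g' = a' * e := hφ (by
      rw [map_mul, map_mul]
      change φ c' / φ a' * φ g' = φ e at he
      rw [← he]
      field_simp)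
    have h2 : ¬ π ∣ g' := fun h => hg' ((hiff g').2 (Ideal.mem_of_dvd _ h hπz))
    obtain ⟨b', rfl⟩ := (hπ.dvd_or_dvd (h1 ▸ hπa.mul_right e : π ∣ c' * g')).resolve_right h2
    exact ⟨b', by rw [map_mul, mul_assoc]⟩
  obtain ⟨b₁, hb₁⟩ := hdiv a₀ ha₀
  have hπb : b = b₁ * π := hφ (mul_left_cancel₀ hq0 (by
    rw [← hqb, hb₁, map_mul]; ring))
  have hb0 : b₁ ≠ 0 := by
    rintro rfl
    rw [map_zero, mul_zero] at hb₁
    exact ha₀0 hb₁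
  exact hmin b₁ ⟨q * φ π, mul_ne_zero hq0 (hφ0 hπ.ne_zero), hb₁, hdiv⟩
    ⟨hb0, π, hπ.not_isUnit, hπb⟩

end Trivial

/-! ### The complement of a line in the projective plane -/

section Chart

open MvPolynomial

lemma eval₂_X_mul_of_isHomogeneous {σ R B : Type*} [Fintype σ] [CommRing R] [CommRing B]
    (g : MvPolynomial σ R →+* B) (c : B) {f : MvPolynomial σ R} {n : ℕ}
    (hf : f.IsHomogeneous n) : eval₂ (g.comp C) (fun i => g (X i) * c) f = g f * c ^ n := by
  have h1 : g f = eval₂ (g.comp C) (fun i => g (X i)) f := by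
    conv_lhs => rw [← eval₂_eta f]
    rw [eval₂_comp_left]
    rfl
  rw [h1, eval₂_eq', eval₂_eq', Finset.sum_mul]
  refine Finset.sum_congr rfl fun d hd => ?_
  have hdn : ∑ i, d i = n := by
    have := hf (mem_support_iff.1 hd)
    rw [← this, Finsupp.weight_apply, Finsupp.sum_fintype _ _ (by simp)]
    simp
  rw [← hdn, mul_assoc]
  congr 1
  simp only [mul_pow, Finset.prod_mul_distrib, Finset.prod_pow_eq_pow_sum]

variable {k : Type u} [Field k]

lemma exists_perm_eq_of_isHomogeneous_one {ℓ : MvPolynomial (Fin 3) k} (hℓ : ℓ.IsHomogeneous 1)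
    (h0 : ℓ ≠ 0) : ∃ (e : Equiv.Perm (Fin 3)) (a : Fin 3 → k), a 0 ≠ 0 ∧
      ℓ = C (a 0) * X (e 0) + C (a 1) * X (e 1) + C (a 2) * X (e 2) := by
  have h1 : ℓ ∈ homogeneousSubmodule (Fin 3) k 1 := hℓ
  rw [homogeneousSubmodule_one_eq_span_X, Submodule.mem_span_range_iff_exists_fun] at h1
  obtain ⟨a, rfl⟩ := h1
  obtain ⟨i, hi⟩ : ∃ i, a i ≠ 0 := by
    by_contra! h
    exact h0 (by simp [h])
  let e := Equiv.swap 0 i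
  refine ⟨e, a ∘ e, by simpa [e] using hi, ?_⟩
  rw [← Equiv.sum_comp e, Fin.sum_univ_three]
  simp only [smul_eq_C_mul, Function.comp_apply]

open Polynomial in
/-- Dehomogenization: the degree zero part of the localization of `k[x₀, x₁, x₂]` at a linear
form is a polynomial ring in two variables. -/
lemma nonempty_ringEquiv_away {ℓ : MvPolynomial (Fin 3) k} (hℓ : ℓ.IsHomogeneous 1)
    (h0 : ℓ ≠ 0) : Nonempty (k[X][X] ≃+*
      HomogeneousLocalization.Away (homogeneousSubmodule (Fin 3) k) ℓ) := by
  obtain ⟨e, a, ha, hsum⟩ := exists_perm_eq_of_isHomogeneous_one hℓ h0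
  let 𝒜 := homogeneousSubmodule (Fin 3) k
  have hℓ' : ℓ ∈ 𝒜 1 := hℓ
  let Loc := Localization (Submonoid.powers ℓ)
  let g : MvPolynomial (Fin 3) k →+* Loc := algebraMap _ _
  let val : HomogeneousLocalization.Away 𝒜 ℓ →+* Loc := algebraMap _ _
  have hval : Function.Injective val := HomogeneousLocalization.val_injective _
  let c : Loc := Localization.mk 1 ⟨ℓ, Submonoid.mem_powers ℓ⟩
  have hgc : g ℓ * c = 1 := by
    change algebraMap _ Loc ℓ * Localization.mk 1 ⟨ℓ, Submonoid.mem_powers ℓ⟩ = 1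
    rw [← Localization.mk_one_eq_algebraMap, Localization.mk_mul, one_mul, mul_one]
    exact Localization.mk_self (⟨ℓ, Submonoid.mem_powers ℓ⟩ : Submonoid.powers ℓ)
  have hX : ∀ i, (X i : MvPolynomial (Fin 3) k) ∈ 𝒜 (1 • 1) := fun i => isHomogeneous_X k i
  let t : Fin 3 → HomogeneousLocalization.Away 𝒜 ℓ := fun i =>
    HomogeneousLocalization.Away.mk 𝒜 hℓ' 1 (X i) (hX i)
  have hmk : ∀ (n : ℕ) (f : MvPolynomial (Fin 3) k) (hf : f ∈ 𝒜 (n • 1)),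
      val (HomogeneousLocalization.Away.mk 𝒜 hℓ' n f hf) = g f * c ^ n := fun n f hf => by
    change Localization.mk f ⟨ℓ ^ n, _⟩ = algebraMap _ Loc f * Localization.mk 1 _ ^ n
    rw [← Localization.mk_one_eq_algebraMap, Localization.mk_pow, Localization.mk_mul, one_pow,
      mul_one, one_mul]
    rfl
  have ht : ∀ i, val (t i) = g (X i) * c := fun i => by rw [hmk, pow_one]
  let κ : k →+* HomogeneousLocalization.Away 𝒜 ℓ :=
    (HomogeneousLocalization.fromZeroRingHom 𝒜 _).comp (algebraMap k (𝒜 0))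
  have hκ : ∀ x, val (κ x) = g (MvPolynomial.C x) := fun x => by
    change Localization.mk (MvPolynomial.C x) 1 = _
    rw [Localization.mk_one_eq_algebraMap]
  let φ : k[X][X] →+* HomogeneousLocalization.Away 𝒜 ℓ :=
    Polynomial.eval₂RingHom (Polynomial.eval₂RingHom κ (t (e 1))) (t (e 2))
  let u : k[X][X] := Polynomial.C Polynomial.X
  let v : k[X][X] := Polynomial.X
  let κ' : k →+* k[X][X] := Polynomial.C.comp Polynomial.C
  let w : Fin 3 → k[X][X] := ![κ' (a 0)⁻¹ * (1 - κ' (a 1) * u - κ' (a 2) * v), u, v]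
  let ψ : MvPolynomial (Fin 3) k →+* k[X][X] :=
    MvPolynomial.eval₂Hom κ' (fun i => w (e.symm i))
  have hψX : ∀ i, ψ (X (e i)) = w i := fun i => by simp [ψ]
  have hψC : ∀ x, ψ (MvPolynomial.C x) = κ' x := fun x => by simp [ψ]
  have haκ : κ' (a 0) * κ' (a 0)⁻¹ = 1 := by rw [← map_mul, mul_inv_cancel₀ ha, map_one]
  have hψℓ : ψ ℓ = 1 := by
    rw [hsum]
    simp only [map_add, map_mul, hψX, hψC]
    change κ' (a 0) * (κ' (a 0)⁻¹ * (1 - κ' (a 1) * u - κ' (a 2) * v)) + κ' (a 1) * u +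
      κ' (a 2) * v = 1
    linear_combination (1 - κ' (a 1) * u - κ' (a 2) * v) * haκ
  have hφκ : ∀ x, φ (κ' x) = κ x := fun x => by simp [φ, κ']
  have hφu : φ u = t (e 1) := by simp [φ, u]
  have hφv : φ v = t (e 2) := by simp [φ, v]
  refine ⟨RingEquiv.ofBijective φ ⟨?_, ?_⟩⟩
  · -- the inverse is induced by `ψ`
    let lam : Loc →+* k[X][X] := IsLocalization.Away.lift (S := Loc) ℓ (g := ψ) (by
      rw [hψℓ]; exact isUnit_one)
    have hlam : ∀ f, lam (g f) = ψ f := fun f => IsLocalization.Away.lift_eq ℓ _ f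
    have hlamc : lam c = 1 := by
      have := congr_arg lam hgc
      rwa [map_mul, hlam, hψℓ, one_mul, map_one] at this
    have hcomp : (lam.comp val).comp φ = RingHom.id _ := by
      refine Polynomial.ringHom_ext' (Polynomial.ringHom_ext' (RingHom.ext fun x => ?_) ?_) ?_
      · change lam (val (φ (κ' x))) = κ' x
        rw [hφκ, hκ, hlam, hψC]
      · change lam (val (φ u)) = u
        rw [hφu, ht, map_mul, hlam, hlamc, hψX, mul_one]
        rfl
      · change lam (val (φ v)) = v
        rw [hφv, ht, map_mul, hlam, hlamc, hψX, mul_one]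
        rfl
    intro x y hxy
    have h1 := congr_arg (lam.comp val) hxy
    have h2 : ∀ x, (lam.comp val) (φ x) = x := fun x => RingHom.congr_fun hcomp x
    rwa [h2, h2] at h1
  · have hψ : ∀ f, val (φ (ψ f)) = eval₂ (g.comp MvPolynomial.C) (fun i => g (X i) * c) f := by
      intro f
      change ((val.comp φ).comp ψ) f = eval₂Hom (g.comp MvPolynomial.C) (fun i => g (X i) * c) f
      refine RingHom.congr_fun (MvPolynomial.ringHom_ext (fun x => ?_) fun i => ?_) f
      · rw [RingHom.comp_apply, RingHom.comp_apply, hψC, hφκ, hκ, eval₂Hom_C]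
        rfl
      · obtain ⟨i, rfl⟩ := e.surjective i
        rw [RingHom.comp_apply, RingHom.comp_apply, hψX, eval₂Hom_X']
        fin_cases i
        · have h1 : val (φ (w 0)) = g (MvPolynomial.C (a 0)⁻¹) *
              (1 - g (MvPolynomial.C (a 1)) * (g (X (e 1)) * c) -
                g (MvPolynomial.C (a 2)) * (g (X (e 2)) * c)) := by
            simp only [w, Matrix.cons_val_zero, map_mul, map_sub, map_one, hφκ, hκ, hφu, hφv, ht]
          have h2 := (congr_arg (fun p => g p * c) hsum).symm.trans hgc
          simp only [map_add, map_mul] at h2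
          have h3 : g (MvPolynomial.C (a 0)) * g (MvPolynomial.C (a 0)⁻¹) = 1 := by
            rw [← map_mul, ← map_mul, mul_inv_cancel₀ ha, map_one, map_one]
          refine h1.trans ?_
          change _ = g (X (e 0)) * c
          linear_combination -g (MvPolynomial.C (a 0)⁻¹) * h2 + g (X (e 0)) * c * h3
        · exact (congr_arg val hφu).trans (ht _)
        · exact (congr_arg val hφv).trans (ht _)
    intro x
    obtain ⟨n, f, hf, rfl⟩ := HomogeneousLocalization.Away.mk_surjective 𝒜 hℓ' x
    refine ⟨ψ f, hval ?_⟩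
    have hf' : f.IsHomogeneous n := by
      have : f ∈ 𝒜 (n • 1) := hf
      rwa [smul_eq_mul, mul_one] at this
    rw [hψ, eval₂_X_mul_of_isHomogeneous g c hf', hmk]

namespace ProjectivePlane

variable (k) in
/-- The complement of the line with equation `ℓ`. -/
noncomputable def chart (ℓ : MvPolynomial (Fin 3) k) : (ProjectivePlane k).Opens :=
  Proj.basicOpen (homogeneousSubmodule (Fin 3) k) ℓ

lemma isAffineOpen_chart {ℓ : MvPolynomial (Fin 3) k} (hℓ : ℓ.IsHomogeneous 1) :
    IsAffineOpen (chart k ℓ) :=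
  Proj.isAffineOpen_basicOpen _ ℓ hℓ one_pos

open Polynomial in
lemma nonempty_ringEquiv_chart {ℓ : MvPolynomial (Fin 3) k} (hℓ : ℓ.IsHomogeneous 1)
    (h0 : ℓ ≠ 0) : Nonempty (k[X][X] ≃+* Γ(ProjectivePlane k, chart k ℓ)) := by
  obtain ⟨e⟩ := nonempty_ringEquiv_away hℓ h0
  exact ⟨e.trans (Proj.basicOpenIsoAway (homogeneousSubmodule (Fin 3) k) ℓ hℓ
    one_pos).commRingCatIsoToRingEquiv⟩

lemma uniqueFactorizationMonoid_chart {ℓ : MvPolynomial (Fin 3) k} (hℓ : ℓ.IsHomogeneous 1)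
    (h0 : ℓ ≠ 0) : UniqueFactorizationMonoid Γ(ProjectivePlane k, chart k ℓ) := by
  obtain ⟨e⟩ := nonempty_ringEquiv_chart hℓ h0
  exact e.toMulEquiv.uniqueFactorizationMonoid inferInstance

lemma hasTransversals_chart {ℓ : MvPolynomial (Fin 3) k} (hℓ : ℓ.IsHomogeneous 1)
    (h0 : ℓ ≠ 0) : HasTransversals Γ(ProjectivePlane k, chart k ℓ) := by
  obtain ⟨e⟩ := nonempty_ringEquiv_chart hℓ h0
  exact HasTransversals.of_ringEquiv e.symm (hasTransversals_polynomial k)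

lemma exists_mem_chart (y : ProjectivePlane k) :
    ∃ ℓ : MvPolynomial (Fin 3) k, ℓ.IsHomogeneous 1 ∧ ℓ ≠ 0 ∧ y ∈ chart k ℓ := by
  let 𝒜 := homogeneousSubmodule (Fin 3) k
  have h1 := Proj.iSup_basicOpen_eq_top' 𝒜 (fun i : Fin 3 => (X i : MvPolynomial (Fin 3) k))
    (fun i => ⟨1, isHomogeneous_X k i⟩) (by
      refine eq_top_iff.2 fun p _ => ?_
      induction p using MvPolynomial.induction_on with
      | C a => exact Subalgebra.algebraMap_mem _ (⟨C a, isHomogeneous_C _ a⟩ : 𝒜 0)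
      | add p q hp hq => exact add_mem (hp trivial) (hq trivial)
      | mul_X p i hp => exact mul_mem (hp trivial) (Algebra.subset_adjoin ⟨i, rfl⟩))
  have h2 : y ∈ ⨆ i : Fin 3, Proj.basicOpen 𝒜 (X i : MvPolynomial (Fin 3) k) := by
    rw [h1]; trivial
  obtain ⟨i, hi⟩ := Opens.mem_iSup.1 h2
  exact ⟨X i, isHomogeneous_X k i, X_ne_zero i, hi⟩

lemma specializes_of_notMem_chart {L z : ProjectivePlane k} {ℓ : MvPolynomial (Fin 3) k}
    (hL : HomogeneousIdeal.toIdeal (ProjectiveSpectrum.asHomogeneousIdeal L) = Ideal.span {ℓ})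
    (hz : z ∉ chart k ℓ) : L ⤳ z := by
  have h1 : ℓ ∈ ProjectiveSpectrum.asHomogeneousIdeal z := by
    by_contra h
    exact hz h
  refine (ProjectiveSpectrum.le_iff_mem_closure (homogeneousSubmodule (Fin 3) k) L z).1 ?_
    |> specializes_iff_mem_closure.2
  change HomogeneousIdeal.toIdeal _ ≤ HomogeneousIdeal.toIdeal _
  rw [hL, Ideal.span_singleton_le_iff_mem]
  exact h1

instance universallyClosed_toSpec : UniversallyClosed (toSpec k) := by
  let 𝒜 := homogeneousSubmodule (Fin 3) k
  have h1 : Algebra.FiniteType (𝒜 0) (MvPolynomial (Fin 3) k) :=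
    haveI : IsScalarTower k (𝒜 0) (MvPolynomial (Fin 3) k) :=
      ⟨fun a b c => smul_mul_assoc a (b : MvPolynomial (Fin 3) k) c⟩
    Algebra.FiniteType.of_restrictScalars_finiteType k _ _
  have h2 : IsClosedImmersion (Spec.map (CommRingCat.ofHom (algebraMap k (𝒜 0)))) := by
    refine IsClosedImmersion.spec_of_surjective _ fun x => ?_
    have h3 : (x : MvPolynomial (Fin 3) k).IsHomogeneous 0 := x.2
    obtain ⟨f, hf⟩ := x
    refine ⟨coeff 0 f, Subtype.ext ?_⟩
    exact (totalDegree_eq_zero_iff_eq_C.1 ((totalDegree_zero_iff_isHomogeneous _).2 h3)).symm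
  exact inferInstanceAs (UniversallyClosed (Proj.toSpecZero 𝒜 ≫
    Spec.map (CommRingCat.ofHom (algebraMap k (𝒜 0)))))

/-- A rational function without poles on the projective plane is zero or invertible. -/
lemma inv_mem_regularAt_of_forall_mem_regularAt {f : (ProjectivePlane k).functionField}
    (h0 : f ≠ 0) (hf : ∀ z, f ∈ regularAt z) (z : ProjectivePlane k) : f⁻¹ ∈ regularAt z := by
  obtain ⟨a, rfl⟩ := exists_section_of_forall_mem_regularAt ⊤ trivial fun z _ => hf z
  have h1 : a ≠ 0 := by
    rintro rfl
    exact h0 (map_zero _)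
  obtain ⟨b, hb⟩ := (isField_of_universallyClosed k (toSpec k)).mul_inv_cancel h1
  have ha : IsUnit a := IsUnit.of_mul_eq_one b hb
  exact unit_section_mem_regularAt (U := ⊤) (x := z) trivial ha.unit

lemma isUnit_two_section (hk : (2 : k) ≠ 0) (U : (ProjectivePlane k).Opens) :
    IsUnit (2 : Γ(ProjectivePlane k, U)) := by
  let ρ : k →+* Γ(ProjectivePlane k, U) :=
    ((toSpec k).appLE ⊤ U le_top).hom.comp (Scheme.ΓSpecIso (CommRingCat.of k)).inv.hom
  have h1 := (IsUnit.mk0 (2 : k) hk).map ρ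
  rwa [map_ofNat] at h1

instance compactSpace : CompactSpace (ProjectivePlane k) :=
  QuasiCompact.compactSpace_of_compactSpace (toSpec k)

end ProjectivePlane

end Chart

/-! ### The equation of a smooth curve -/

section SmoothCurve

lemma section_notMem_vanishingAt_of_ideal_eq_span {X : Scheme.{u}} [IsIntegral X] {D : X}
    {U : X.affineOpens} {δ : Γ(X, U.1)} (hδ : (idealSheafOfPoint D).ideal U = Ideal.span {δ})
    {z : X} (hz : z ∈ U.1) (hDz : ¬ D ⤳ z) :
    sectionToFunctionField U.1 (genericPoint_mem hz) δ ∉ vanishingAt z := by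
  have h1 : z ∉ (idealSheafOfPoint D).support :=
    fun h => hDz (specializes_iff_mem_closure.2 h)
  rw [Scheme.IdealSheafData.mem_support_iff_of_mem hz, Scheme.mem_zeroLocus_iff] at h1
  push Not at h1
  obtain ⟨a, ha, haz⟩ := h1
  have ha' : a ∈ Ideal.span {δ} := hδ ▸ ha
  obtain ⟨b, rfl⟩ := Ideal.mem_span_singleton'.1 ha'
  intro h
  have h2 := section_notMem_vanishingAt haz
  rw [map_mul] at h2
  exact h2 (mul_mem_vanishingAt (section_mem_regularAt hz b) h)

lemma ProjectivePlane.notMem_maximalIdeal_sq {k : Type u} [Field k] {D : ProjectivePlane k}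
    (hD : ProjectivePlane.IsSmoothCurve D) {U : (ProjectivePlane k).affineOpens}
    {δ : Γ(ProjectivePlane k, U.1)} (hδ : (idealSheafOfPoint D).ideal U = Ideal.span {δ})
    (hδ0 : δ ≠ 0) {y : ProjectivePlane k} (hy : y ∈ U.1) :
    (ProjectivePlane k).presheaf.germ U.1 y hy δ ∉
      IsLocalRing.maximalIdeal ((ProjectivePlane k).presheaf.stalk y) ^ 2 := by
  let X := ProjectivePlane k
  let ι := (idealSheafOfPoint D).subschemeι
  have := isDomain_section (genericPoint_mem hy)
  have hsm : Smooth (ι ≫ ProjectivePlane.toSpec k) := hD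
  have hV : IsAffineOpen (ι ⁻¹ᵁ U.1) := U.2.preimage ι
  have h1 := (ι ≫ ProjectivePlane.toSpec k).smooth_appLE (isAffineOpen_top _) hV le_top
  have h2 : (ProjectivePlane.toSpec k).appLE ⊤ U.1 le_top ≫ ι.app U.1 =
      (ι ≫ ProjectivePlane.toSpec k).appLE ⊤ (ι ⁻¹ᵁ U.1) le_top := by
    rw [← Scheme.Hom.appLE_eq_app]
    exact Scheme.Hom.appLE_comp_appLE _ _ _ _ _ _ _
  let _ : Algebra Γ(Spec (CommRingCat.of k), ⊤) Γ(X, U.1) :=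
    ((ProjectivePlane.toSpec k).appLE ⊤ U.1 le_top).hom.toAlgebra
  let _ : Algebra Γ(Spec (CommRingCat.of k), ⊤) Γ((idealSheafOfPoint D).subscheme, ι ⁻¹ᵁ U.1) :=
    ((ι ≫ ProjectivePlane.toSpec k).appLE ⊤ (ι ⁻¹ᵁ U.1) le_top).hom.toAlgebra
  have h3 : Algebra.Smooth Γ(Spec (CommRingCat.of k), ⊤)
    Γ((idealSheafOfPoint D).subscheme, ι ⁻¹ᵁ U.1) := h1
  let π : Γ(X, U.1) →ₐ[Γ(Spec (CommRingCat.of k), ⊤)]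
      Γ((idealSheafOfPoint D).subscheme, ι ⁻¹ᵁ U.1) :=
    { (ι.app U.1).hom with
      commutes' := fun a => by
        have := congr_arg (fun f => f.hom a) h2
        exact this }
  have hker : RingHom.ker π = Ideal.span {δ} := by
    rw [← hδ, ← (idealSheafOfPoint D).ker_subschemeι_app U]
    rfl
  have hp := (U.2.primeIdealOf ⟨y, hy⟩).isPrime
  let _ : Algebra Γ(X, U.1) (X.presheaf.stalk y) :=
    TopCat.Presheaf.algebra_section_stalk X.presheaf (⟨y, hy⟩ : U.1)
  have : IsLocalization.AtPrime (X.presheaf.stalk y) (U.2.primeIdealOf ⟨y, hy⟩).asIdeal :=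
    U.2.isLocalization_stalk ⟨y, hy⟩
  intro hmem
  rw [← IsLocalization.AtPrime.map_eq_maximalIdeal (U.2.primeIdealOf ⟨y, hy⟩).asIdeal
    (X.presheaf.stalk y), ← Ideal.map_pow,
    IsLocalization.mem_map_algebraMap_iff (U.2.primeIdealOf ⟨y, hy⟩).asIdeal.primeCompl] at hmem
  obtain ⟨⟨a, g⟩, hag⟩ := hmem
  have h4 : δ * g = a := by
    refine IsLocalization.injective (X.presheaf.stalk y)
      (U.2.primeIdealOf ⟨y, hy⟩).asIdeal.primeCompl_le_nonZeroDivisors ?_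
    rw [map_mul]
    exact hag
  refine not_mul_mem_sq_of_formallySmooth π ((idealSheafOfPoint D).subschemeι_app_surjective U)
    hδ0 hker (U.2.primeIdealOf ⟨y, hy⟩).asIdeal g.2 ?_
  rw [mul_comm, h4]
  exact a.2

end SmoothCurve

/-! ### Double covers in which a curve splits -/

section Split

open Topology

variable {S X : Scheme.{u}} [IsIntegral S] [IsIntegral X] (r : S ⟶ X) [Flat r]
  [Algebra X.functionField S.functionField]

/-- The double cover `r` of `X`, with branch divisor `I` and with function field generated by a
square root `θ` of `d`, splits over the prime divisor with generic point `γ`, since `d` is a unit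
at `γ` and congruent to `a₀ ^ 2` there. Of the smoothness of the branch divisor, only the fact that
its equations do not vanish to order two is recorded (`notMem_sq`); `notMem_branch` says that it
does not contain `γ`. -/
structure IsSplitDoubleCover (I : X.IdealSheafData) (γ : X) (θ : S.functionField)
    (d a₀ : X.functionField) : Prop where
  algebraMap_eq : algebraMap X.functionField S.functionField = functionFieldMap r
  finrank_eq : Module.finrank X.functionField S.functionField = 2
  isUnit_two : ∀ U : X.Opens, IsUnit (2 : Γ(X, U))
  branch : HasBranchDivisor r I
  notMem_sq : ∀ (U : X.affineOpens) (δ : Γ(X, U.1)), I.ideal U = Ideal.span {δ} → δ ≠ 0 →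
    ∀ (y : X) (hy : y ∈ U.1), X.presheaf.germ U.1 y hy δ ∉
      IsLocalRing.maximalIdeal (X.presheaf.stalk y) ^ 2
  notMem_branch : ∀ (U : X.affineOpens) (δ : Γ(X, U.1)), I.ideal U = Ideal.span {δ} →
    ∀ hγ : γ ∈ U.1, sectionToFunctionField U.1 (genericPoint_mem hγ) δ ∉ vanishingAt γ
  valuationRing : ValuationRing (X.presheaf.stalk γ)
  coheight_eq : Order.coheight γ = 1
  notMem_range : θ ∉ (algebraMap X.functionField S.functionField).range
  sq_eq : θ ^ 2 = algebraMap X.functionField S.functionField d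
  mem_regularAt : d ∈ regularAt γ
  inv_mem_regularAt : d⁻¹ ∈ regularAt γ
  root_mem : a₀ ∈ regularAt γ
  sub_sq_mem : d - a₀ ^ 2 ∈ vanishingAt γ

/-- The rational function `v` on the double cover is an equation, along the fibre over `z`, of one
of the two curves over the curve with generic point `γ`: it is regular, it vanishes on this curve,
and its norm is an equation of the curve below. -/
def IsSplitEquation (γ : X) (θ : S.functionField) (a₀ : X.functionField) (v : S.functionField)
    (z : X) : Prop :=
  v ∈ regularOver r z ∧ (γ ⤳ z → v ∈ rootIdeal (regularAt γ) (vanishingAt γ) θ a₀) ∧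
    IsLocalEquation γ (Algebra.norm X.functionField v) z

variable {r} {I : X.IdealSheafData} {γ : X} {θ : S.functionField} {d a₀ : X.functionField}

lemma mem_regularAt_of_sq_mem (hγ : ValuationRing (X.presheaf.stalk γ)) {q : X.functionField}
    (h : q ^ 2 ∈ regularAt γ) : q ∈ regularAt γ := by
  obtain h1 | ⟨a, ha⟩ := ValuationRing.isInteger_or_isInteger (X.presheaf.stalk γ) q
  · exact h1
  by_cases h0 : q = 0
  · rw [h0]; exact Subring.zero_mem _
  have h2 : q = q ^ 2 * q⁻¹ := by field_simp
  rw [h2]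
  exact Subring.mul_mem _ h ⟨a, ha⟩

namespace IsSplitDoubleCover

lemma two_ne_zero (hr : IsSplitDoubleCover r I γ θ d a₀) :
    (2 : X.functionField) ≠ 0 := by
  have h1 := (hr.isUnit_two ⊤).map (sectionToFunctionField ⊤ trivial)
  rw [map_ofNat] at h1
  exact h1.ne_zero

lemma finiteDimensional (hr : IsSplitDoubleCover r I γ θ d a₀) :
    FiniteDimensional X.functionField S.functionField :=
  Module.finite_of_finrank_eq_succ hr.finrank_eq

/-- Another square root generating the function field differs from `θ` by a unit at `γ`. -/
lemma exists_eq_mul (hr : IsSplitDoubleCover r I γ θ d a₀)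
    {s : S.functionField}
    (hsK : s ∉ (algebraMap X.functionField S.functionField).range) {δ : X.functionField}
    (hs : s ^ 2 = algebraMap X.functionField S.functionField δ) (hδ : δ ∈ regularAt γ)
    (hδ' : δ ∉ vanishingAt γ) :
    ∃ q₀ : X.functionField, q₀ ∈ regularAt γ ∧ q₀⁻¹ ∈ regularAt γ ∧ q₀ ≠ 0 ∧
      s = algebraMap X.functionField S.functionField q₀ * θ ∧
      δ - (q₀ * a₀) ^ 2 ∈ vanishingAt γ := by
  obtain ⟨p, q, hpq⟩ := exists_eq_add_mul hr.finrank_eq hr.notMem_range s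
  have h1 := hs
  rw [hpq] at h1
  have h2 : algebraMap X.functionField S.functionField (p ^ 2 + q ^ 2 * d) +
      algebraMap X.functionField S.functionField (2 * p * q) * θ =
      algebraMap X.functionField S.functionField δ +
      algebraMap X.functionField S.functionField 0 * θ := by
    rw [← h1, map_add, map_mul, ← hr.sq_eq]
    simp only [map_mul, map_pow, map_ofNat, map_zero]
    ring
  obtain ⟨h3, h4⟩ := add_mul_inj hr.notMem_range h2
  have hq : q ≠ 0 := by
    rintro rfl
    exact hsK ⟨p, by rw [hpq, map_zero, zero_mul, add_zero]⟩
  have hp : p = 0 := by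
    simpa [hr.two_ne_zero, hq] using h4
  subst hp
  have hd0 : d ≠ 0 := by
    rintro rfl
    have := hr.sq_eq
    rw [map_zero, sq_eq_zero_iff] at this
    exact hr.notMem_range ⟨0, by rw [this, map_zero]⟩
  have h5 : δ = q ^ 2 * d := by rw [← h3]; ring
  have h6 : q ^ 2 ∈ regularAt γ := by
    have : q ^ 2 = δ * d⁻¹ := by rw [h5]; field_simp
    rw [this]
    exact Subring.mul_mem _ hδ hr.inv_mem_regularAt
  have h7 : q⁻¹ ^ 2 ∈ regularAt γ := by
    have : q⁻¹ ^ 2 = δ⁻¹ * d := by rw [h5]; field_simp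
    rw [this]
    exact Subring.mul_mem _ (_root_.inv_mem_regularAt hδ hδ') hr.mem_regularAt
  refine ⟨q, mem_regularAt_of_sq_mem hr.valuationRing h6,
    mem_regularAt_of_sq_mem hr.valuationRing h7, hq, ?_, ?_⟩
  · rw [hpq, map_zero, zero_add]
  · have : δ - (q * a₀) ^ 2 = q ^ 2 * (d - a₀ ^ 2) := by rw [h5]; ring
    rw [this]
    exact mul_mem_vanishingAt h6 hr.sub_sq_mem

variable [IsLocallyNoetherian X] [IsFinite r]

/-- The quotient of two equations of the same curve is regular, and hence a unit. -/
lemma div_mem_regularOver (hr : IsSplitDoubleCover r I γ θ d a₀)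
    {v v' : S.functionField} {z : X} (hv : IsSplitEquation r γ θ a₀ v z)
    (hv' : IsSplitEquation r γ θ a₀ v' z) : v / v' ∈ regularOver r z := by
  obtain ⟨U, hz, s, δ, hsK, hs, hδ, hlat⟩ :=
    exists_affineOpen_sqrt r hr.algebraMap_eq hr.isUnit_two hr.finrank_eq hr.branch z
  have := hr.finiteDimensional
  have hδz := section_mem_regularAt hz δ
  have hv0 : v' ≠ 0 := by
    rintro rfl
    exact hv'.2.2.1 (Algebra.norm_zero)
  have h1 := (hlat z hz v).1 hv.1
  have h2 := (hlat z hz v').1 hv'.1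
  rw [hlat z hz]
  by_cases hγz : γ ⤳ z
  · have hγU : γ ∈ U.1 := hγz.mem_open U.1.isOpen hz
    obtain ⟨q₀, hq₀, hq₀', hq0, hsθ, hroot⟩ := hr.exists_eq_mul hsK hs
      (section_mem_regularAt hγU δ) (hr.notMem_branch U δ hδ hγU)
    have h3 := rootIdeal_scale (regularAt γ) (vanishingAt γ) (a₀ := a₀) hq₀ hq₀' hq0 hsθ
    refine div_mem_quadLattice_of_mem_rootIdeal hr.finrank_eq (regularAt_le_of_specializes hγz)
      (fun a ha b hb => mul_mem_vanishingAt ha hb) hsK hs hδz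
      (Subring.mul_mem _ hq₀ hr.root_mem) hroot h1 (h3 ▸ hv.2.1 hγz) h2 (h3 ▸ hv'.2.1 hγz) hv0
      (hv'.2.2.2.2.1 hγz).2
  · exact div_mem_quadLattice hr.finrank_eq hsK hs hδz h1 h2 hv0 (hv'.2.2.2.2.2 hγz)

/-- Near a closed point with a regular factorial neighbourhood, the curve on the double cover has
an equation. -/
lemma exists_eventually_isSplitEquation (hr : IsSplitDoubleCover r I γ θ d a₀)
    {V : X.Opens} (hV : IsAffineOpen V)
    [UniqueFactorizationMonoid Γ(X, V)] (hVt : HasTransversals Γ(X, V)) {y : X} (hyV : y ∈ V)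
    (hy : IsClosed {y}) : ∃ v, ∀ᶠ z in 𝓝 y, IsSplitEquation r γ θ a₀ v z := by
  have := hr.finiteDimensional
  by_cases hγy : γ ⤳ y
  swap
  · refine ⟨1, Filter.eventually_of_mem ((isClosed_closure (s := {γ})).isOpen_compl.mem_nhds
      (fun h => hγy (specializes_iff_mem_closure.2 h))) fun z hz => ?_⟩
    have hγz : ¬ γ ⤳ z := fun h => hz (specializes_iff_mem_closure.1 h)
    exact ⟨Subring.one_mem _, fun h => absurd h hγz, by
      rw [map_one]; exact isLocalEquation_one hγz⟩
  have hγV : γ ∈ V := hγy.mem_open V.isOpen hyV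
  obtain ⟨U, hyU, s, δ, hsK, hs, hδ, hlat⟩ :=
    exists_affineOpen_sqrt r hr.algebraMap_eq hr.isUnit_two hr.finrank_eq hr.branch y
  have hγU : γ ∈ U.1 := hγy.mem_open U.1.isOpen hyU
  obtain ⟨q₀, hq₀, hq₀', hq0, hsθ, hroot⟩ := hr.exists_eq_mul hsK hs
    (section_mem_regularAt hγU δ) (hr.notMem_branch U δ hδ hγU)
  have hδ0 : δ ≠ 0 := by
    rintro rfl
    rw [map_zero, map_zero, sq_eq_zero_iff] at hs
    exact hsK ⟨0, by rw [hs, map_zero]⟩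
  obtain ⟨c, hc, hcspan, hceq⟩ := exists_isLocalEquation hV hγV hr.coheight_eq
  have hmax := hV.primeIdealOf_isMaximal_of_isClosed ⟨y, hyV⟩ hy
  have hcy : c ∈ (hV.primeIdealOf ⟨y, hyV⟩).asIdeal :=
    (specializes_iff_primeIdealOf_le hV hγV hyV).1 hγy
      (hcspan ▸ Ideal.mem_span_singleton_self c)
  obtain ⟨x, hxm, hcx, hxJ⟩ := hVt _ c hc hcy
  let _ : Algebra Γ(X, V) (X.presheaf.stalk y) :=
    TopCat.Presheaf.algebra_section_stalk X.presheaf (⟨y, hyV⟩ : V)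
  have : IsLocalization.AtPrime (X.presheaf.stalk y) (hV.primeIdealOf ⟨y, hyV⟩).asIdeal :=
    hV.isLocalization_stalk ⟨y, hyV⟩
  have halg : ∀ a : Γ(X, V), algebraMap (X.presheaf.stalk y) X.functionField
      (algebraMap Γ(X, V) (X.presheaf.stalk y) a) =
      sectionToFunctionField V (genericPoint_mem hyV) a := fun a => algebraMap_germ hyV a
  obtain ⟨hc0, -, hcγ, -⟩ := hceq y hyV
  obtain ⟨hcv, hcd⟩ := hcγ hγy
  have hciff : ∀ a : X.presheaf.stalk y,
      algebraMap (X.presheaf.stalk y) X.functionField a ∈ vanishingAt γ ↔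
        algebraMap Γ(X, V) (X.presheaf.stalk y) c ∣ a := fun a => by
    constructor
    · intro ha
      obtain ⟨b, hb⟩ := hcd _ ⟨a, rfl⟩ ha
      refine ⟨b, algebraMap_stalk_injective y ?_⟩
      rw [map_mul, halg, hb, mul_div_cancel₀ _ hc0]
    · rintro ⟨b, rfl⟩
      rw [map_mul, halg, mul_comm]
      exact mul_mem_vanishingAt (regularAt_le_of_specializes hγy ⟨b, rfl⟩) hcv
  have h2 : IsUnit (2 : X.presheaf.stalk y) := by
    have h1 := (hr.isUnit_two V).map (X.presheaf.germ V y hyV).hom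
    rwa [map_ofNat] at h1
  obtain ⟨v, hvL, hvQ, t, ht, hvN⟩ := exists_mem_rootIdeal_norm_eq (A := X.presheaf.stalk y)
    hr.finrank_eq h2 (regularAt_le_of_specializes hγy)
    (fun a ha b hb => mul_mem_vanishingAt ha hb) (fun a ha ha' => _root_.inv_mem_regularAt ha ha')
    (one_notMem_vanishingAt γ) hsK (by rw [algebraMap_germ hyU]; exact hs)
    (hr.notMem_sq U δ hδ hδ0 y hyU) (Subring.mul_mem _ hq₀ hr.root_mem)
    (by rw [algebraMap_germ hyU]; exact hroot) (by
      obtain ⟨a, b, hb, hab⟩ := exists_mul_section_eq hV hγV (Subring.mul_mem _ hq₀ hr.root_mem)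
      exact ⟨algebraMap _ _ a, algebraMap _ _ b, by rw [halg]; exact hb, by
        rw [halg, halg]; exact hab⟩) hciff
    (fun h => hc0 (by rw [← halg, h, map_zero]))
    ((IsLocalization.AtPrime.to_map_mem_maximal_iff (X.presheaf.stalk y)
      (hV.primeIdealOf ⟨y, hyV⟩).asIdeal x).2 hxm)
    (fun h => hcx (by
      rw [← hciff, halg, section_mem_vanishingAt_iff hV hγV, hcspan,
        Ideal.mem_span_singleton] at h
      exact h))
    (exists_le_span_pair_of_isLocalization
      (hV.primeIdealOf ⟨y, hyV⟩).asIdeal.primeCompl hxJ)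
  rw [rootIdeal_scale (regularAt γ) (vanishingAt γ) hq₀ hq₀' hq0 hsθ] at hvQ
  have ht0 : algebraMap (X.presheaf.stalk y) X.functionField t ≠ 0 := by
    rw [Ne, map_eq_zero_iff _ (algebraMap_stalk_injective y)]
    exact ht.ne_zero
  refine ⟨v, ?_⟩
  filter_upwards [regularOver_eventually r ((hlat y hyU v).2 hvL), V.isOpen.mem_nhds hyV,
    regularAt_eventually (x := y) ⟨t, rfl⟩, regularAt_eventually (inv_mem_regularAt_of_isUnit ht)]
    with z hz1 hz2 hz3 hz4
  refine ⟨hz1, fun _ => hvQ, ?_⟩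
  rw [hvN, map_mul, halg]
  exact (hceq z hz2).mul_unit ht0 hz3 hz4

lemma norm_mem_regularAt (hr : IsSplitDoubleCover r I γ θ d a₀) {v : S.functionField} {z : X}
    (hv : v ∈ regularOver r z) : Algebra.norm X.functionField v ∈ regularAt z := by
  obtain ⟨U, hz, s, δ, hsK, hs, -, hlat⟩ :=
    exists_affineOpen_sqrt r hr.algebraMap_eq hr.isUnit_two hr.finrank_eq hr.branch z
  exact norm_mem_of_mem_quadLattice hr.finrank_eq hsK hs (section_mem_regularAt hz δ)
    ((hlat z hz v).1 hv)

/-- One of the two curves over the curve with generic point `γ` is a Cartier divisor, hence by the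
assumption on Picard groups it is, up to the divisor of the rational function `w`, the pullback of
a divisor with local equations `h y`; its norm is the curve with generic point `γ`. -/
theorem exists_forall_isLocalEquation (hr : IsSplitDoubleCover r I γ θ d a₀) [CompactSpace X]
    (hX : ∀ y : X, ∃ V : X.Opens, IsAffineOpen V ∧ UniqueFactorizationMonoid Γ(X, V) ∧
      HasTransversals Γ(X, V) ∧ y ∈ V)
    (hPic : Function.Surjective (Pic.pullback r)) :
    ∃ (h : X → X.functionField) (w : S.functionField), (∀ y, h y ≠ 0) ∧
      (∀ y, ∀ᶠ z in nhds y, h y / h z ∈ regularAt z ∧ h z / h y ∈ regularAt z) ∧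
      ∀ z, IsLocalEquation γ (Algebra.norm X.functionField w * h z ^ 2) z := by
  have := hr.finiteDimensional
  -- equations exist near closed points, and every point specializes to a closed point
  have h1 : ∀ y : X, ∃ (v : S.functionField) (W : X.Opens), y ∈ W ∧
      ∀ z ∈ W, IsSplitEquation r γ θ a₀ v z := by
    intro y
    obtain ⟨y₀, hy₀, hcl⟩ := (isClosed_closure (s := {y})).exists_closed_singleton
      ⟨y, subset_closure rfl⟩
    obtain ⟨V, hV, hV1, hV2, hyV⟩ := hX y₀
    obtain ⟨v, hv⟩ := hr.exists_eventually_isSplitEquation hV hV2 hyV hcl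
    obtain ⟨W, hW, hWo, hyW⟩ := eventually_nhds_iff.1 hv
    exact ⟨v, ⟨W, hWo⟩, (specializes_iff_mem_closure.2 hy₀).mem_open hWo hyW, hW⟩
  choose v W hyW hvW using h1
  have hv0 : ∀ y, v y ≠ 0 := fun y h => (hvW y y (hyW y)).2.2.1 (by rw [h, Algebra.norm_zero])
  obtain ⟨h, w, hh, hw, hloc, hdiv⟩ := exists_div_mem_regularOver r hPic v hv0 W hyW
    fun x y z hz => hr.div_mem_regularOver (hvW x z hz.1) (hvW y z hz.2)
  refine ⟨h, w, hh, hloc, fun z => ?_⟩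
  obtain ⟨h2, h3⟩ := hdiv z
  rw [← hr.algebraMap_eq] at h2 h3
  have hw0 : w * algebraMap X.functionField S.functionField (h z) ≠ 0 :=
    mul_ne_zero hw ((map_ne_zero _).2 (hh z))
  have h4 : Algebra.norm X.functionField
      (w * algebraMap X.functionField S.functionField (h z) / v z) *
      Algebra.norm X.functionField
        (v z / (w * algebraMap X.functionField S.functionField (h z))) = 1 := by
    rw [← map_mul, div_mul_div_cancel₀ (hv0 z), div_self hw0, map_one]
  have h5 := (hvW z z (hyW z)).2.2.mul_unit (left_ne_zero_of_mul_eq_one h4)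
    (hr.norm_mem_regularAt h3)
    (by rw [inv_eq_of_mul_eq_one_right h4]; exact hr.norm_mem_regularAt h2)
  rwa [← map_mul, mul_div_cancel₀ _ (hv0 z), map_mul, Algebra.norm_algebraMap,
    hr.finrank_eq] at h5

end IsSplitDoubleCover

end Split

/-! ### Norms on double planes -/

namespace ProjectivePlane

variable {k : Type u} [Field k]

lemma exists_isLocalEquation_self {γ : ProjectivePlane k} (hγ : Order.coheight γ = 1) :
    ∃ c, IsLocalEquation γ c γ := by
  obtain ⟨ℓ, hℓ, h0, hy⟩ := exists_mem_chart γ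
  have := uniqueFactorizationMonoid_chart hℓ h0
  obtain ⟨c, -, -, hc⟩ := exists_isLocalEquation (isAffineOpen_chart hℓ) hy hγ
  exact ⟨_, hc γ hy⟩

lemma mem_regularAt_of_forall_coheight {f : (ProjectivePlane k).functionField}
    (hf : ∀ z, Order.coheight z = 1 → f ∈ regularAt z) (z : ProjectivePlane k) :
    f ∈ regularAt z := by
  obtain ⟨ℓ, hℓ, h0, hz⟩ := exists_mem_chart z
  have := uniqueFactorizationMonoid_chart hℓ h0
  have : IsNoetherianRing Γ(ProjectivePlane k, chart k ℓ) :=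
    IsLocallyNoetherian.component_noetherian ⟨_, isAffineOpen_chart hℓ⟩
  exact mem_regularAt_of_forall_coheight_eq_one (isAffineOpen_chart hℓ) (fun z _ hz => hf z hz) hz

/-- Away from the line the function with local equations `h` can be made global, and there
`a * q ^ 2` is an equation of the curve; the coefficient of the line is even since `a * h L ^ 2` is
a unit there, and it is negative since otherwise `a * q ^ 2` would be regular everywhere, hence
invertible. -/
theorem exists_hasDivisor_mul_sq {C L : ProjectivePlane k} (hC : Order.coheight C = 1)
    (hL1 : Order.coheight L = 1) (hCL : C ≠ L) (hL : IsCurveOfDegree L 1)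
    (h : ProjectivePlane k → (ProjectivePlane k).functionField) (hh : ∀ y, h y ≠ 0)
    (hloc : ∀ y, ∀ᶠ z in nhds y, h y / h z ∈ regularAt z ∧ h z / h y ∈ regularAt z)
    (a : (ProjectivePlane k).functionField) (hCh : ∀ z, IsLocalEquation C (a * h z ^ 2) z) :
    ∃ (n : ℕ) (q : (ProjectivePlane k).functionField), 0 < n ∧
      HasDivisor (a * q ^ 2) (primeDivisor C - (2 * n) • primeDivisor L) := by
  obtain ⟨ℓ, hℓ0, hℓ, hLℓ⟩ := hL
  have hchart : ∀ z, Order.coheight z = 1 → z ≠ L → z ∈ chart k ℓ := by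
    intro z hz hzL
    by_contra hzc
    exact hzL (eq_of_specializes_of_coheight_eq_one (specializes_of_notMem_chart hLℓ hzc)
      hL1 hz).symm
  have hCc := hchart C hC hCL
  have := uniqueFactorizationMonoid_chart hℓ hℓ0
  obtain ⟨q, hq0, hq⟩ := exists_forall_div_mem_regularAt (isAffineOpen_chart hℓ)
    (genericPoint_mem hCc) h hh hloc
  have hCq : ∀ z ∈ chart k ℓ, IsLocalEquation C (a * q ^ 2) z := by
    intro z hz
    obtain ⟨h1, h2⟩ := hq z hz
    have h3 := (hCh z).mul_unit (u := (q / h z) ^ 2) (pow_ne_zero _ (div_ne_zero hq0 (hh z)))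
      (Subring.pow_mem _ h1 2) (by rw [← inv_pow, inv_div]; exact Subring.pow_mem _ h2 2)
    rwa [mul_assoc, ← mul_pow, mul_div_cancel₀ _ (hh z)] at h3
  have hf0 : a * q ^ 2 ≠ 0 := (hCq C hCc).1
  have hnot : ¬ C ⤳ L := fun hs => hCL (eq_of_specializes_of_coheight_eq_one hs hC hL1)
  have hqh : q / h L ≠ 0 := div_ne_zero hq0 (hh L)
  have hordL : Scheme.ord (a * q ^ 2) L = 2 * Scheme.ord (q / h L) L := by
    have h1 : a * q ^ 2 = a * h L ^ 2 * (q / h L) ^ 2 := by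
      rw [mul_assoc, ← mul_pow, mul_div_cancel₀ _ (hh L)]
    rw [h1, Scheme.ord_mul (hCh L).1 (pow_ne_zero _ hqh), ord_pow_two hqh,
      ord_eq_zero_of_mem_regularAt (hCh L).1 (hCh L).2.1 ((hCh L).2.2.2 hnot), zero_add]
  -- otherwise `a * q ^ 2` is regular in codimension one, hence a unit, but it vanishes at `C`
  have hneg : Scheme.ord (q / h L) L < 0 := by
    by_contra hge
    obtain ⟨c, hc⟩ := exists_isLocalEquation_self hL1
    have h1 : ∀ z, Order.coheight z = 1 → a * q ^ 2 ∈ regularAt z := by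
      intro z hz
      by_cases hzL : z = L
      · subst hzL
        exact mem_regularAt_of_ord_nonneg hz hc hf0 (by rw [hordL]; omega)
      · exact (hCq z (hchart z hz hzL)).2.1
    exact notMem_vanishingAt_of_inv_mem hf0 (inv_mem_regularAt_of_forall_mem_regularAt hf0
      (mem_regularAt_of_forall_coheight h1) C) ((hCq C hCc).2.2.1 specializes_rfl).1
  refine ⟨(-Scheme.ord (q / h L) L).toNat, q, by omega, hf0, funext fun z => ?_⟩
  rw [Pi.sub_apply, Pi.smul_apply]
  by_cases hz : Order.coheight z = 1
  · by_cases hzL : z = L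
    · subst hzL
      rw [hordL, primeDivisor_self, primeDivisor_of_ne (Ne.symm hCL)]
      simp only [nsmul_eq_mul, Nat.cast_mul, Nat.cast_ofNat, mul_one]
      omega
    · rw [(hCq z (hchart z hz hzL)).ord_eq hC,
        primeDivisor_of_ne hzL, smul_zero, sub_zero]
  · rw [Scheme.ord_eq_zero_of_coheight_neq_one hz, primeDivisor_of_ne (by rintro rfl; exact hz hC),
      primeDivisor_of_ne (by rintro rfl; exact hz hL1),
      smul_zero, sub_zero]

/-- A double plane with smooth branch curve `D` and function field generated by a square root of
`d` splits over a curve on which `d` is a nonzero square. -/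
lemma exists_isSplitDoubleCover (hk : (2 : k) ≠ 0) {S : Scheme.{u}} [IsIntegral S]
    {r : S ⟶ ProjectivePlane k} [IsFinite r] [Flat r]
    [Algebra (ProjectivePlane k).functionField S.functionField]
    (hφ : algebraMap (ProjectivePlane k).functionField S.functionField = functionFieldMap r)
    {D : ProjectivePlane k} (hD : Order.coheight D = 1) (hDs : IsSmoothCurve D)
    (hbranch : HasBranchDivisor r (idealSheafOfPoint D))
    {d : (ProjectivePlane k).functionField} (hd0 : d ≠ 0) (hd : ¬ IsSquare d)
    {θ : S.functionField} (hθ : θ ^ 2 = algebraMap (ProjectivePlane k).functionField _ d)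
    (htop : IntermediateField.adjoin (ProjectivePlane k).functionField {θ} = ⊤)
    {C : ProjectivePlane k} (hC : Order.coheight C = 1) (hCD : C ≠ D)
    (hdC : Scheme.ord d C = 0) (hsq : IsSquareAt d C) :
    ∃ a₀, IsSplitDoubleCover r (idealSheafOfPoint D) C θ d a₀ := by
  have hrange : θ ∉ (algebraMap (ProjectivePlane k).functionField S.functionField).range := by
    rintro ⟨b, rfl⟩
    rw [← map_pow] at hθ
    exact hd ⟨b, by rw [← sq]; exact ((algebraMap _ _).injective hθ).symm⟩
  obtain ⟨c, hc⟩ := exists_isLocalEquation_self hC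
  have hdvr := hc.exists_irreducible.1
  obtain ⟨b, rfl, e, he⟩ := hsq
  obtain ⟨e, rfl⟩ := Ideal.Quotient.mk_surjective e
  refine ⟨algebraMap _ _ e, hφ, finrank_eq_two_of_adjoin_sqrt_eq_top hd hθ htop,
    isUnit_two_section hk, hbranch, fun U δ hδ hδ0 y hy =>
    notMem_maximalIdeal_sq hDs hδ hδ0 hy, fun U δ hδ hγ =>
    section_notMem_vanishingAt_of_ideal_eq_span hδ hγ fun h =>
      hCD (eq_of_specializes_of_coheight_eq_one h hD hC).symm, inferInstance, hC, hrange, hθ,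
    ⟨b, rfl⟩, mem_regularAt_of_ord_nonneg hC hc (inv_ne_zero hd0) (by rw [ord_inv hd0, hdC]; rfl),
    ⟨e, rfl⟩, ?_⟩
  rw [← map_pow, ← map_sub, algebraMap_mem_vanishingAt_iff]
  refine Ideal.Quotient.eq.1 ?_
  rw [map_pow, sq]
  exact he

end ProjectivePlane

theorem mainTheorem9 (k : Type u) [Field k] (hk : (2 : k) ≠ 0)
    (S : Scheme.{u}) [IsIntegral S] (r : S ⟶ ProjectivePlane k) [IsFinite r] [Flat r]
    (hr : ∀ y : ProjectivePlane k, r.finrank y = 2)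
    (D : ProjectivePlane k) (hD : ProjectivePlane.IsCurveOfDegree D 6)
    (hDs : ProjectivePlane.IsSmoothCurve D)
    (hbranch : HasBranchDivisor r (idealSheafOfPoint D))
    (hPic : Function.Bijective (Pic.pullback r))
    (L : ProjectivePlane k) (hL : ProjectivePlane.IsCurveOfDegree L 1)
    (d : (ProjectivePlane k).functionField)
    (hd : HasDivisor d (primeDivisor D - 6 • primeDivisor L))
    (hS : IsFunctionFieldAdjoinSqrt r d)
    (C : ProjectivePlane k) (hC : Order.coheight C = 1) (hCD : C ≠ D) (hCL : C ≠ L)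
    (hsq : IsSquareAt d C) :
    ∃ n : ℕ, 0 < n ∧ ∃ f : (ProjectivePlane k).functionField,
      HasDivisor f (primeDivisor C - (2 * n) • primeDivisor L) ∧
        IsNormFromFunctionField r f := by
  let _ : Algebra (ProjectivePlane k).functionField S.functionField :=
    (functionFieldMap r).toAlgebra
  obtain ⟨θ, hθ, htop⟩ := hS
  have hord : ∀ z, Scheme.ord d z = primeDivisor D z - 6 * primeDivisor L z := fun z => by
    rw [hd.2, Pi.sub_apply, Pi.smul_apply, nsmul_eq_mul, Nat.cast_ofNat]
  have hordD := hord D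
  rw [primeDivisor_self] at hordD
  have hD1 : Order.coheight D = 1 := by
    by_contra h
    rw [Scheme.ord_eq_zero_of_coheight_neq_one h] at hordD
    omega
  have hL1 : Order.coheight L = 1 := by
    by_contra h
    have h1 := hord L
    rw [Scheme.ord_eq_zero_of_coheight_neq_one h, primeDivisor_self] at h1
    by_cases hDL : L = D
    · rw [hDL, primeDivisor_self] at h1
      omega
    · rw [primeDivisor_of_ne hDL] at h1
      omega
  -- `d` has odd order along `D`
  have hdsq : ¬ IsSquare d := by
    rintro ⟨b, rfl⟩
    rw [← sq, ord_pow_two (left_ne_zero_of_mul hd.1)] at hordD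
    omega
  have hdC : Scheme.ord d C = 0 := by
    rw [hord, primeDivisor_of_ne hCD, primeDivisor_of_ne hCL]
    rfl
  obtain ⟨a₀, ha₀⟩ := ProjectivePlane.exists_isSplitDoubleCover hk rfl hD1 hDs hbranch hd.1 hdsq hθ
    htop hC hCD hdC hsq
  obtain ⟨h, w, hh, hloc, hCh⟩ := ha₀.exists_forall_isLocalEquation (fun y => by
    obtain ⟨ℓ, hℓ, h0, hy⟩ := ProjectivePlane.exists_mem_chart y
    exact ⟨_, ProjectivePlane.isAffineOpen_chart hℓ,
      ProjectivePlane.uniqueFactorizationMonoid_chart hℓ h0,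
      ProjectivePlane.hasTransversals_chart hℓ h0, hy⟩) hPic.2
  obtain ⟨n, q, hn, hq⟩ := ProjectivePlane.exists_hasDivisor_mul_sq hC hL1 hCL hL h hh hloc _ hCh
  refine ⟨n, hn, _, hq, w * algebraMap _ _ q, ?_⟩
  rw [map_mul, Algebra.norm_algebraMap, ha₀.finrank_eq]
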